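/- Theorem (Main Formula). For a partition $\lambda$ with at most $n$ parts, let $F^\lambda_n$ denote the finite-dimensional irreducible polynomial representation of $\mathrm{GL}_n(\mathbb{C})$ with highest weight $\lambda$. For partitions $\lambda,\mu^{(1)},\dots,\mu^{(m)}$, let $c^\lambda_{\boldsymbol\mu}$ be the multiplicity of $F^\lambda_n$ in $F^{\mu^{(1)}}_n\otimes\cdots\otimes F^{\mu^{(m)}}_n$ under the diagonal action of $\mathrm{GL}_n(\mathbb{C})$, where $n$ is any integer such that $\lambda$ and all the $\mu^{(j)}$ have at most $n$ parts ($n$ may be chosen differently for different pairs $(\lambda,\boldsymbol\mu)$). Let $t_1,t_2,t_3,\dots$ be a countably infinite set of indeterminates. Then, as formal power series with integer coefficients, \[ \prod_{k=1}^{\infty}\frac{1}{1-(t_1^k+t_2^k+t_3^k+\cdots)}=\sum_{\lambda}\sum_{\boldsymbol\mu}\bigl(c^\lambda_{\boldsymbol\mu}\bigr)^2\,\mathbf{t}^{\boldsymbol\mu}, \] where $\lambda$ runs over all partitions, $\boldsymbol\mu=(\mu^{(1)},\mu^{(2)},\dots)$ runs over all sequences of partitions with only finitely many nonempty terms (trailing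 empty partitions are dropped in the definition of $c^\lambda_{\boldsymbol\mu}$), and $\mathbf{t}^{\boldsymbol\mu}=t_1^{|\mu^{(1)}|}t_2^{|\mu^{(2)}|}\cdots$. The infinite product converges, and the family of terms indexed by the pairs $(\lambda,\boldsymbol\mu)$ is summable, in the topology of coefficientwise convergence with discrete coefficients. -/

import Mathlib

open scoped MvPowerSeries.WithPiTopology

noncomputable section

namespace LRSquares

/-! ### Partitions and finitely supported sequences of partitions

An integer partition `lam = (lam_1 ≥ lam_2 ≥ ⋯ ≥ 0)` is given by its Young diagram: the parts are
`lam.rowLen 0 ≥ lam.rowLen 1 ≥ ⋯`, the size is `lam.card`, the length (number of nonzero parts)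
is `lam.colLen 0`, and the empty partition is `⊥`. -/

/-- Sequences `(μ^(1), μ^(2), …)` of partitions with only finitely many nonempty terms
(the term `μ^(j+1)` has index `j`). -/
def PartitionSeq : Type :=
  {mu : ℕ → YoungDiagram // ∃ m, ∀ j, m ≤ j → mu j = ⊥}

namespace PartitionSeq

/-- The least `m` such that `μ^(j) = ∅` for all `j > m`. -/
def length (mu : PartitionSeq) : ℕ := sInf {m | ∀ j, m ≤ j → mu.1 j = ⊥}

theorem eq_bot_of_length_le (mu : PartitionSeq) {j : ℕ} (hj : mu.length ≤ j) : mu.1 j = ⊥ := by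
  have h : mu.length ∈ {m | ∀ j, m ≤ j → mu.1 j = ⊥} := Nat.sInf_mem mu.2
  exact h j hj

/-- The finite sequence `(μ^(1), …, μ^(m))`, where `m = mu.length`. -/
def toFin (mu : PartitionSeq) : Fin mu.length → YoungDiagram := fun j => mu.1 j

/-- The exponent `(|μ^(1)|, |μ^(2)|, …)`. -/
def sizes (mu : PartitionSeq) : ℕ →₀ ℕ :=
  Finsupp.onFinset (Finset.range mu.length) (fun j => (mu.1 j).card) (by
    intro j hj
    rw [Finset.mem_range]
    by_contra h
    apply hj
    rw [mu.eq_bot_of_length_le (not_lt.mp h)]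
    rfl)

end PartitionSeq

/-! ### Irreducible polynomial representations of the general linear group -/

/-- A finite dimensional irreducible polynomial representation of `GL_n` over the complex numbers
with highest weight `w = (w_1, …, w_n)`: all its matrix coefficients are polynomials in the matrix
entries, and some nonzero vector is scaled by `∏ i, b_ii ^ w_i` under every invertible upper
triangular matrix `b`. -/
structure HighestWeightIrrep (n : ℕ) (w : Fin n → ℕ) where
  V : Type
  [addCommGroup : AddCommGroup V]
  [module : Module ℂ V]
  rho : Representation ℂ (Matrix.GeneralLinearGroup (Fin n) ℂ) V
  finiteDimensional : FiniteDimensional ℂ V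
  isIrreducible : rho.IsIrreducible
  isPolynomial : ∀ (phi : Module.Dual ℂ V) (v : V), ∃ p : MvPolynomial (Fin n × Fin n) ℂ,
    ∀ g : Matrix.GeneralLinearGroup (Fin n) ℂ,
      phi (rho g v) = MvPolynomial.eval (fun ij => (g : Matrix (Fin n) (Fin n) ℂ) ij.1 ij.2) p
  exists_highestWeightVector : ∃ v : V, v ≠ 0 ∧
    ∀ b : Matrix.GeneralLinearGroup (Fin n) ℂ,
      (b : Matrix (Fin n) (Fin n) ℂ).BlockTriangular id →
        rho b v = (∏ i, (b : Matrix (Fin n) (Fin n) ℂ) i i ^ w i) • v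

attribute [instance] HighestWeightIrrep.addCommGroup HighestWeightIrrep.module
  HighestWeightIrrep.finiteDimensional

/-- The highest weight `(lam_1, …, lam_n)` given by a partition with at most `n` parts. -/
def weight (n : ℕ) (lam : YoungDiagram) : Fin n → ℕ := fun i => lam.rowLen i

section Existence

/-! Existence of the irreducible representation with highest weight `lam`: the translates of a
product of leading principal minors span a finite dimensional representation, and a simple quotient
of it is the one sought. -/

variable {n : ℕ}

/-- Functions on `n × n` matrices, with `GL_n` acting by right translation. -/
def translation (n : ℕ) :
    Representation ℂ (Matrix.GeneralLinearGroup (Fin n) ℂ) (Matrix (Fin n) (Fin n) ℂ → ℂ) where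
  toFun g :=
    { toFun := fun f X => f (X * (g : Matrix (Fin n) (Fin n) ℂ))
      map_add' := fun _ _ => rfl
      map_smul' := fun _ _ => rfl }
  map_one' := by ext f X; simp
  map_mul' g h := by ext f X; simp [Matrix.mul_assoc]

theorem translation_apply (g : Matrix.GeneralLinearGroup (Fin n) ℂ)
    (f : Matrix (Fin n) (Fin n) ℂ → ℂ) (X : Matrix (Fin n) (Fin n) ℂ) :
    translation n g f X = f (X * (g : Matrix (Fin n) (Fin n) ℂ)) := rfl

/-- The polynomial function on matrices given by a polynomial in the entries. -/
def polyFun (p : MvPolynomial (Fin n × Fin n) ℂ) (X : Matrix (Fin n) (Fin n) ℂ) : ℂ :=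
  MvPolynomial.eval (fun ij => X ij.1 ij.2) p

theorem polyFun_mul_right (p : MvPolynomial (Fin n × Fin n) ℂ) :
    ∃ (s : Finset ((Fin n × Fin n) →₀ ℕ))
      (a : ((Fin n × Fin n) →₀ ℕ) → Matrix (Fin n) (Fin n) ℂ → ℂ)
      (b : ((Fin n × Fin n) →₀ ℕ) → MvPolynomial (Fin n × Fin n) ℂ),
      ∀ X Y : Matrix (Fin n) (Fin n) ℂ,
        polyFun p (X * Y) = ∑ k ∈ s, polyFun (b k) Y * a k X := by
  classical
  let q : MvPolynomial (Fin n × Fin n) (MvPolynomial (Fin n × Fin n) ℂ) :=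
    MvPolynomial.eval₂ (MvPolynomial.C.comp MvPolynomial.C)
      (fun ij => ∑ l, MvPolynomial.C (MvPolynomial.X (ij.1, l)) * MvPolynomial.X (l, ij.2)) p
  refine ⟨q.support, fun k X => polyFun (q.coeff k) X, fun k => MvPolynomial.monomial k 1, ?_⟩
  intro X Y
  have h1 : polyFun p (X * Y) = MvPolynomial.eval₂
      (MvPolynomial.eval (fun ij => X ij.1 ij.2)) (fun ij => Y ij.1 ij.2) q := by
    have : (MvPolynomial.eval₂Hom (MvPolynomial.eval (fun ij : Fin n × Fin n => X ij.1 ij.2))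
        (fun ij : Fin n × Fin n => Y ij.1 ij.2)).comp (MvPolynomial.eval₂Hom
          (MvPolynomial.C.comp MvPolynomial.C) (fun ij : Fin n × Fin n => ∑ l,
            MvPolynomial.C (MvPolynomial.X (ij.1, l)) * MvPolynomial.X (l, ij.2))) =
        MvPolynomial.eval (fun ij : Fin n × Fin n => (X * Y) ij.1 ij.2) := by
      apply MvPolynomial.ringHom_ext
      · intro r; simp
      · intro ij; simp [Matrix.mul_apply]
    exact (RingHom.congr_fun this p).symm
  rw [h1, MvPolynomial.eval₂_eq']
  refine Finset.sum_congr rfl fun k _ => ?_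
  rw [mul_comm]
  congr 1
  simp [polyFun, MvPolynomial.eval_monomial, Finsupp.prod_fintype]

theorem exists_poly_mul_left (p : MvPolynomial (Fin n × Fin n) ℂ)
    (X : Matrix (Fin n) (Fin n) ℂ) :
    ∃ q : MvPolynomial (Fin n × Fin n) ℂ, ∀ Y, polyFun q Y = polyFun p (Y * X) := by
  refine ⟨MvPolynomial.eval₂ MvPolynomial.C (fun ij : Fin n × Fin n =>
    ∑ l, MvPolynomial.X (ij.1, l) * MvPolynomial.C (X l ij.2)) p, fun Y => ?_⟩
  have : (MvPolynomial.eval (fun ij : Fin n × Fin n => Y ij.1 ij.2)).comp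
      (MvPolynomial.eval₂Hom MvPolynomial.C (fun ij : Fin n × Fin n =>
        ∑ l, MvPolynomial.X (ij.1, l) * MvPolynomial.C (X l ij.2))) =
      MvPolynomial.eval (fun ij : Fin n × Fin n => (Y * X) ij.1 ij.2) := by
    apply MvPolynomial.ringHom_ext
    · intro r; simp
    · intro ij; simp [Matrix.mul_apply]
  exact RingHom.congr_fun this p

/-- The leading principal `k × k` minor of a matrix (for `k ≤ n`). -/
def leadingMinor (k : ℕ) (X : Matrix (Fin n) (Fin n) ℂ) : ℂ :=
  (X.submatrix (fun i : {i : Fin n // (i : ℕ) < k} => i.1)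
    (fun i : {i : Fin n // (i : ℕ) < k} => i.1)).det

theorem leadingMinor_mul (k : ℕ) (X b : Matrix (Fin n) (Fin n) ℂ) (hb : b.BlockTriangular id) :
    leadingMinor k (X * b) =
      (∏ i : Fin n, if (i : ℕ) < k then b i i else 1) * leadingMinor k X := by
  classical
  let e : {i : Fin n // (i : ℕ) < k} → Fin n := fun i => i.1
  have h1 : (X * b).submatrix e e = X.submatrix e e * b.submatrix e e := by
    ext i j
    simp only [Matrix.submatrix_apply, Matrix.mul_apply]
    rw [← Finset.sum_subtype (Finset.univ.filter fun l : Fin n => (l : ℕ) < k) (by simp)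
      (fun l => X (e i) l * b l (e j)), Finset.sum_filter]
    refine Finset.sum_congr rfl fun l _ => ?_
    split_ifs with h
    · rfl
    · have hlt : e j < l := by
        have := j.2
        rw [Fin.lt_def]
        change (j.1 : ℕ) < l
        omega
      have h0 : b l (e j) = 0 := hb hlt
      rw [h0, mul_zero]
  have h2 : (b.submatrix e e).det = ∏ i : Fin n, if (i : ℕ) < k then b i i else 1 := by
    have ht : (b.submatrix e e).BlockTriangular id := fun i j hij => hb hij
    rw [Matrix.det_of_isUpperTriangular ht, ← Finset.prod_filter,
      Finset.prod_subtype (p := fun l : Fin n => (l : ℕ) < k)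
        (Finset.univ.filter fun l : Fin n => (l : ℕ) < k) (by simp)
      (fun l => b l l)]
    rfl
  change ((X * b).submatrix e e).det = _ * (X.submatrix e e).det
  rw [h1, Matrix.det_mul, h2, mul_comm]

theorem leadingMinor_poly (k : ℕ) :
    ∃ p : MvPolynomial (Fin n × Fin n) ℂ, ∀ X, polyFun p X = leadingMinor k X := by
  refine ⟨(Matrix.of fun i j : {i : Fin n // (i : ℕ) < k} =>
    (MvPolynomial.X (i.1, j.1) : MvPolynomial (Fin n × Fin n) ℂ)).det, fun X => ?_⟩
  unfold polyFun leadingMinor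
  rw [RingHom.map_det]
  congr 1
  ext i j
  simp

/-- The product of the leading principal minors of the sizes of the columns of `lam`. -/
def highestFun (n : ℕ) (lam : YoungDiagram) (X : Matrix (Fin n) (Fin n) ℂ) : ℂ :=
  ∏ c ∈ Finset.range (lam.rowLen 0), leadingMinor (lam.colLen c) X

theorem highestFun_mul (lam : YoungDiagram) (X b : Matrix (Fin n) (Fin n) ℂ)
    (hb : b.BlockTriangular id) :
    highestFun n lam (X * b) = (∏ i, b i i ^ weight n lam i) * highestFun n lam X := by
  unfold highestFun
  simp_rw [leadingMinor_mul _ X b hb]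
  rw [Finset.prod_mul_distrib, Finset.prod_comm]
  congr 1
  refine Finset.prod_congr rfl fun i _ => ?_
  rw [← Finset.prod_filter, Finset.prod_const]
  congr 1
  have : (Finset.range (lam.rowLen 0)).filter (fun c => (i : ℕ) < lam.colLen c) =
      Finset.range (lam.rowLen i) := by
    ext c
    rw [Finset.mem_filter, Finset.mem_range, Finset.mem_range, ← YoungDiagram.mem_iff_lt_colLen,
      YoungDiagram.mem_iff_lt_rowLen]
    have := lam.rowLen_anti 0 i (Nat.zero_le _)
    constructor
    · exact fun h => h.2
    · exact fun h => ⟨lt_of_lt_of_le h this, h⟩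
  rw [this, Finset.card_range]
  rfl

theorem highestFun_one (lam : YoungDiagram) : highestFun n lam 1 = 1 := by
  refine Finset.prod_eq_one fun c _ => ?_
  unfold leadingMinor
  rw [Matrix.submatrix_one _ Subtype.val_injective, Matrix.det_one]

theorem highestFun_poly (n : ℕ) (lam : YoungDiagram) :
    ∃ p : MvPolynomial (Fin n × Fin n) ℂ, ∀ X, polyFun p X = highestFun n lam X := by
  choose p hp using fun k => leadingMinor_poly (n := n) k
  refine ⟨∏ c ∈ Finset.range (lam.rowLen 0), p (lam.colLen c), fun X => ?_⟩
  unfold polyFun highestFun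
  rw [map_prod]
  exact Finset.prod_congr rfl fun c _ => hp _ X

/-- A cyclic finite dimensional representation has an irreducible quotient in which the image of
the generator is nonzero. -/
theorem exists_simple_quotient {G V : Type} [Group G] [AddCommGroup V] [Module ℂ V]
    [FiniteDimensional ℂ V] (rho : Representation ℂ G V) (v : V) (hv : v ≠ 0)
    (hgen : ∀ U : Submodule ℂ V, (∀ g, U ≤ U.comap (rho g)) → v ∈ U → U = ⊤) :
    ∃ (U : Submodule ℂ V) (hU : ∀ g, U ≤ U.comap (rho g)),
      v ∉ U ∧ (rho.quotient U hU).IsIrreducible := by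
  let S : Set (Submodule ℂ V) := {U | (∀ g, U ≤ U.comap (rho g)) ∧ v ∉ U}
  have hS : S.Nonempty := by
    refine ⟨⊥, fun g => bot_le, ?_⟩
    simpa using hv
  obtain ⟨U, ⟨hU, hvU⟩, hmax⟩ := wellFounded_gt.has_min S hS
  refine ⟨U, hU, hvU, ?_⟩
  have key : ∀ s : Subrepresentation (rho.quotient U hU), s = ⊥ ∨ s = ⊤ := by
    intro s
    let W : Submodule ℂ V := s.toSubmodule.comap U.mkQ
    have hW : ∀ g, W ≤ W.comap (rho g) := fun g x hx => s.apply_mem_toSubmodule g hx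
    have hUW : U ≤ W := by
      intro x hx
      have : U.mkQ x = 0 := by simpa using hx
      change U.mkQ x ∈ s.toSubmodule
      rw [this]
      exact zero_mem _
    by_cases hvW : v ∈ W
    · right
      have hT := hgen W hW hvW
      apply Subrepresentation.toSubmodule_injective
      refine top_unique fun y _ => ?_
      obtain ⟨x, rfl⟩ := U.mkQ_surjective y
      have : x ∈ W := hT ▸ Submodule.mem_top
      exact this
    · left
      have hEq : U = W := by
        by_contra hne
        exact hmax W ⟨hW, hvW⟩ (lt_of_le_of_ne hUW hne)
      apply Subrepresentation.toSubmodule_injective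
      refine bot_unique fun y hy => ?_
      obtain ⟨x, rfl⟩ := U.mkQ_surjective y
      have : x ∈ U := by rw [hEq]; exact hy
      change U.mkQ x = 0
      simpa using this
  have hne : (⊥ : Subrepresentation (rho.quotient U hU)) ≠ ⊤ := by
    intro h
    have h' : (⊥ : Submodule ℂ (V ⧸ U)) = ⊤ := congrArg Subrepresentation.toSubmodule h
    have h0 : U.mkQ v ∈ (⊥ : Submodule ℂ (V ⧸ U)) := h' ▸ Submodule.mem_top
    exact hvU (by simpa using h0)
  exact { exists_pair_ne := ⟨_, _, hne⟩, eq_bot_or_eq_top := key }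

theorem nonempty_highestWeightIrrep (n : ℕ) (lam : YoungDiagram) :
    Nonempty (HighestWeightIrrep n (weight n lam)) := by
  obtain ⟨p, hp⟩ := highestFun_poly n lam
  have hp' : highestFun n lam = polyFun p := funext fun X => (hp X).symm
  let M : Submodule ℂ (Matrix (Fin n) (Fin n) ℂ → ℂ) :=
    Submodule.span ℂ (Set.range fun g => translation n g (highestFun n lam))
  have hM : ∀ g, M ≤ M.comap (translation n g) := by
    intro g
    rw [Submodule.span_le]
    rintro _ ⟨h, rfl⟩
    refine Submodule.subset_span ⟨g * h, ?_⟩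
    simp
  have hfin : FiniteDimensional ℂ M := by
    obtain ⟨s, a, b, hab⟩ := polyFun_mul_right p
    have hle : M ≤ Submodule.span ℂ (a '' (s : Set _)) := by
      rw [Submodule.span_le]
      rintro _ ⟨g, rfl⟩
      have : translation n g (highestFun n lam) =
          ∑ k ∈ s, polyFun (b k) (g : Matrix (Fin n) (Fin n) ℂ) • a k := by
        ext X
        rw [translation_apply, hp', hab]
        simp
      change translation n g (highestFun n lam) ∈ _
      rw [this]
      exact Submodule.sum_mem _ fun k hk =>
        Submodule.smul_mem _ _ (Submodule.subset_span ⟨k, hk, rfl⟩)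
    have : FiniteDimensional ℂ (Submodule.span ℂ (a '' (s : Set _))) :=
      FiniteDimensional.span_of_finite ℂ (s.finite_toSet.image a)
    exact Submodule.finiteDimensional_of_le hle
  have hpolyM : ∀ f ∈ M, ∃ q : MvPolynomial (Fin n × Fin n) ℂ, f = polyFun q := by
    intro f hf
    induction hf using Submodule.span_induction with
    | mem f hf =>
      obtain ⟨g, rfl⟩ := hf
      obtain ⟨q, hq⟩ := exists_poly_mul_left p (g : Matrix (Fin n) (Fin n) ℂ)
      refine ⟨q, ?_⟩
      ext X
      rw [hq]
      exact congrFun hp' (X * (g : Matrix (Fin n) (Fin n) ℂ))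
    | zero => exact ⟨0, by ext X; simp [polyFun]⟩
    | add f g _ _ hf hg =>
      obtain ⟨q, rfl⟩ := hf
      obtain ⟨r, rfl⟩ := hg
      exact ⟨q + r, by ext X; simp [polyFun]⟩
    | smul c f _ hf =>
      obtain ⟨q, rfl⟩ := hf
      exact ⟨c • q, by ext X; simp [polyFun]⟩
  have hfM : highestFun n lam ∈ M := Submodule.subset_span ⟨1, by simp⟩
  let sigma := (translation n).subrepresentation M hM
  let v : M := ⟨highestFun n lam, hfM⟩
  have hv : v ≠ 0 := by
    intro h
    have h1 : highestFun n lam = 0 := congrArg Subtype.val h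
    have h2 := congrFun h1 1
    rw [highestFun_one] at h2
    exact one_ne_zero h2
  have hgen : ∀ U : Submodule ℂ M, (∀ g, U ≤ U.comap (sigma g)) → v ∈ U → U = ⊤ := by
    intro U hU hvU
    have hle : M ≤ U.map M.subtype := by
      rw [Submodule.span_le]
      rintro _ ⟨g, rfl⟩
      exact ⟨sigma g v, hU g hvU, rfl⟩
    refine top_unique fun x _ => ?_
    obtain ⟨y, hy, hyx⟩ := hle x.2
    have : y = x := Subtype.ext hyx
    exact this ▸ hy
  obtain ⟨U, hU, hvU, hirr⟩ := exists_simple_quotient sigma v hv hgen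
  refine ⟨{ V := M ⧸ U, rho := sigma.quotient U hU, finiteDimensional := inferInstance,
            isIrreducible := hirr, isPolynomial := ?_, exists_highestWeightVector := ?_ }⟩
  · intro phi y
    obtain ⟨x, rfl⟩ := U.mkQ_surjective y
    obtain ⟨q, hq⟩ := hpolyM x.1 x.2
    obtain ⟨s, a, b, hab⟩ := polyFun_mul_right q
    obtain ⟨psi, hpsi⟩ := LinearMap.exists_extend (phi.comp U.mkQ)
    refine ⟨∑ k ∈ s, MvPolynomial.C (psi (a k)) * b k, fun g => ?_⟩
    have h1 : phi (sigma.quotient U hU g (U.mkQ x)) = psi (translation n g x.1) :=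
      (LinearMap.congr_fun hpsi (sigma g x)).symm
    have h2 : translation n g x.1 =
        ∑ k ∈ s, polyFun (b k) (g : Matrix (Fin n) (Fin n) ℂ) • a k := by
      ext X
      rw [translation_apply, hq, hab]
      simp
    rw [h1, h2, map_sum, map_sum]
    refine Finset.sum_congr rfl fun k _ => ?_
    rw [map_smul, map_mul, MvPolynomial.eval_C, smul_eq_mul, mul_comm]
    rfl
  · refine ⟨U.mkQ v, by simpa using hvU, fun b hb => ?_⟩
    have h1 : sigma b v = (∏ i, (b : Matrix (Fin n) (Fin n) ℂ) i i ^ weight n lam i) • v := by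
      apply Subtype.ext
      ext X
      exact highestFun_mul lam X _ hb
    change U.mkQ (sigma b v) = _
    rw [h1, map_smul]

end Existence

/-- `F^lam_n`: the irreducible representation of `GL_n` with highest weight `lam`, where `lam` is a
partition with at most `n` parts. (It is unique up to isomorphism.) -/
def irrep (n : ℕ) (lam : YoungDiagram) : HighestWeightIrrep n (weight n lam) :=
  (nonempty_highestWeightIrrep n lam).some

/-! ### Generalized Littlewood–Richardson coefficients -/

/-- The diagonal action of `GL_n` on `F^{μ^(1)}_n ⊗ ⋯ ⊗ F^{μ^(m)}_n`. -/
def tensorRep (n : ℕ) {m : ℕ} (mu : Fin m → YoungDiagram) :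
    Representation ℂ (Matrix.GeneralLinearGroup (Fin n) ℂ)
      (PiTensorProduct ℂ fun j => (irrep n (mu j)).V) :=
  PiTensorProduct.mapMonoidHom.comp (MonoidHom.pi fun j => (irrep n (mu j)).rho)

/-- The multiplicity of `F^lam_n` in `F^{μ^(1)}_n ⊗ ⋯ ⊗ F^{μ^(m)}_n`, i.e. the dimension of the
space of `GL_n`-equivariant linear maps from the former to the latter. -/
def lrCoeff (n : ℕ) (lam : YoungDiagram) {m : ℕ} (mu : Fin m → YoungDiagram) : ℕ :=
  Module.finrank ℂ (Representation.IntertwiningMap (irrep n lam).rho (tensorRep n mu))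

/-! ### The power sums -/

/-- The power sum `p_k = t_1^k + t_2^k + ⋯` as a formal power series (for `k ≥ 1`), where `t_(j+1)`
is the variable of index `j`. Convergence is coefficientwise, `ℤ` being discrete. -/
def powerSum (k : ℕ) : MvPowerSeries ℕ ℤ := ∑' j : ℕ, MvPowerSeries.X j ^ k

theorem summable_X_pow {k : ℕ} (hk : k ≠ 0) :
    Summable fun j : ℕ => (MvPowerSeries.X j : MvPowerSeries ℕ ℤ) ^ k := by
  classical
  rw [MvPowerSeries.WithPiTopology.summable_iff_summable_coeff]
  intro d
  apply summable_of_hasFiniteSupport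
  refine d.support.finite_toSet.subset fun j hj => ?_
  rw [Function.mem_support, MvPowerSeries.coeff_X_pow] at hj
  have : d = Finsupp.single j k := by
    by_contra h
    exact hj (if_neg h)
  simp [this, hk]

theorem constantCoeff_powerSum {k : ℕ} (hk : k ≠ 0) :
    MvPowerSeries.constantCoeff (powerSum k) = 0 := by
  have h := (MvPowerSeries.WithPiTopology.hasSum_iff_hasSum_coeff.mp
    (summable_X_pow hk).hasSum) 0
  have h0 : ∀ j : ℕ, MvPowerSeries.coeff 0 ((MvPowerSeries.X j : MvPowerSeries ℕ ℤ) ^ k) = 0 := by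
    intro j
    simp [hk]
  simp_rw [h0] at h
  exact h.unique hasSum_zero

/-- The geometric series `1 / (1 - (t_1^k + t_2^k + ⋯))` (for `k ≥ 1`). -/
def geomFactor (k : ℕ) : MvPowerSeries ℕ ℤ := MvPowerSeries.invOfUnit (1 - powerSum k) 1

theorem mul_geomFactor {k : ℕ} (hk : k ≠ 0) : (1 - powerSum k) * geomFactor k = 1 :=
  MvPowerSeries.mul_invOfUnit _ _ (by simp [constantCoeff_powerSum hk])

end LRSquares

end

open scoped MvPowerSeries.WithPiTopology

noncomputable section

namespace LRSquares

set_option linter.unusedSectionVars false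

/-! ### Polynomial functions on the general linear group -/

section Density

variable {n : ℕ}

/-! Fix a multidegree `d` with total `N`. The claim in that degree is that the squares of the
multiplicities sum to the number, over all partitions `p` of `N`, of ways to obtain `t^d` from the
product of power sums of type `p`. That is also the coefficient of the infinite product, since
expanding the geometric series gives one product of power sums for each partition
(`coeff_prod_geomFactor`).

Representations of degree `N` are modules over the Schur algebra of matrices on words of length `N`
that are invariant under place permutations (`IsPolyHom.exists_algHom`). This algebra is semisimple.
Computing the trace of `a ↦ x a y` on it in two ways, as an average over the symmetric group and as
a sum over matrix blocks, gives orthogonality for the coefficients expressing power sums through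
irreducible characters (`exists_permTrace_coeff`). Orthogonality bounds the number of blocks by the
number of conjugacy classes. Highest weight theory puts the partitions of `N` injectively into the
blocks, so the two sets correspond (`exists_blocks`). The result is a square table `Q` with
orthogonal rows, hence orthogonal columns, together with the Cauchy identity
(`exists_character_table`, `sum_irrChar_mul_irrChar`).

Now multiply the Cauchy identities of degrees `d j` at a pair `(x, y)`. On the character side, the
coefficient of the characters of `lam` and `nu` is the sum over `mu` of the product of the two
multiplicities. On the power sum side, the average over a Young subgroup becomes an average over the
full symmetric group, weighted by the number of words of content `d` fixed by `σ`
(`sum_wordCount_mul`). Comparing coefficients, setting `lam = nu` and summing, column orthogonality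
leaves one fixed-word count per cycle type (`sum_lrCoeff_sq`), and that count is the required
coefficient (`wordCount_eq_coeff`).

This computation is made in rank `N`. The other admissible ranks are reached by cutting
representations down with the projection to the first coordinates (`lrCoeff_eq`). -/

theorem polyFun_add (p q : MvPolynomial (Fin n × Fin n) ℂ) (X : Matrix (Fin n) (Fin n) ℂ) :
    polyFun (p + q) X = polyFun p X + polyFun q X := by simp [polyFun]

theorem polyFun_mul (p q : MvPolynomial (Fin n × Fin n) ℂ) (X : Matrix (Fin n) (Fin n) ℂ) :
    polyFun (p * q) X = polyFun p X * polyFun q X := by simp [polyFun]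

theorem eq_zero_of_polyFun_eq_zero {p : MvPolynomial (Fin n × Fin n) ℂ}
    (h : ∀ X, polyFun p X = 0) : p = 0 := by
  refine MvPolynomial.funext fun x => ?_
  have := h (Matrix.of fun i j => x (i, j))
  simpa [polyFun] using this

/-- The determinant as a polynomial in the matrix entries. -/
def detPoly (n : ℕ) : MvPolynomial (Fin n × Fin n) ℂ :=
  (Matrix.of fun i j => MvPolynomial.X (i, j)).det

theorem polyFun_detPoly (X : Matrix (Fin n) (Fin n) ℂ) : polyFun (detPoly n) X = X.det := by
  unfold polyFun detPoly
  rw [RingHom.map_det]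
  congr 1
  ext i j
  simp

/-- The general linear group is Zariski dense in the space of matrices. -/
theorem eq_zero_of_forall_GL {p : MvPolynomial (Fin n × Fin n) ℂ}
    (h : ∀ g : Matrix.GeneralLinearGroup (Fin n) ℂ, polyFun p (g : Matrix (Fin n) (Fin n) ℂ) = 0) :
    p = 0 := by
  -- The factor `detPoly` vanishes on singular matrices, so the product vanishes everywhere. The
  -- polynomial ring is a domain, and the determinant is nonzero at the identity.
  have h1 : p * detPoly n = 0 := by
    refine eq_zero_of_polyFun_eq_zero fun X => ?_
    rw [polyFun_mul, polyFun_detPoly]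
    by_cases hX : X.det = 0
    · rw [hX, mul_zero]
    · have := h (Matrix.GeneralLinearGroup.mkOfDetNeZero X hX)
      change polyFun p X = 0 at this
      rw [this, zero_mul]
  refine (mul_eq_zero.mp h1).resolve_right fun h0 => ?_
  have := polyFun_detPoly (1 : Matrix (Fin n) (Fin n) ℂ)
  rw [h0, Matrix.det_one] at this
  simp [polyFun] at this

end Density

/-! ### Tensor powers of matrices and the Schur algebra -/

section Words

variable {ι α β γ : Type} [Fintype ι]

/-- The tensor power of a matrix, with rows and columns indexed by words. -/
def tpow (ι : Type) [Fintype ι] (X : Matrix α β ℂ) : Matrix (ι → α) (ι → β) ℂ :=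
  Matrix.of fun I J => ∏ k, X (I k) (J k)

theorem tpow_apply (X : Matrix α β ℂ) (I : ι → α) (J : ι → β) :
    tpow ι X I J = ∏ k, X (I k) (J k) := rfl

theorem tpow_mul [DecidableEq ι] [Fintype β] (X : Matrix α β ℂ) (Y : Matrix β γ ℂ) :
    tpow ι (X * Y) = tpow ι X * tpow ι Y := by
  ext I J
  simp only [tpow_apply, Matrix.mul_apply]
  rw [Finset.prod_univ_sum, Fintype.piFinset_univ]
  simp_rw [Finset.prod_mul_distrib]

theorem tpow_one [DecidableEq α] : tpow ι (1 : Matrix α α ℂ) = 1 := by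
  ext I J
  rw [tpow_apply]
  by_cases h : I = J
  · subst h
    simp
  · rw [Matrix.one_apply_ne h]
    obtain ⟨k, hk⟩ := Function.ne_iff.mp h
    exact Finset.prod_eq_zero (Finset.mem_univ k) (Matrix.one_apply_ne hk)

/-- A matrix indexed by words is symmetric if it is invariant under simultaneous permutation of
the positions in both words. -/
def IsSymm (M : Matrix (ι → α) (ι → β) ℂ) : Prop :=
  ∀ (σ : Equiv.Perm ι) I J, M (I ∘ σ) (J ∘ σ) = M I J

theorem tpow_isSymm (X : Matrix α β ℂ) : IsSymm (tpow ι X) := by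
  intro σ I J
  exact Equiv.prod_comp σ fun k => X (I k) (J k)

theorem IsSymm.mul [DecidableEq ι] [Fintype β] {M : Matrix (ι → α) (ι → β) ℂ} {M' : Matrix (ι → β) (ι → γ) ℂ}
    (h : IsSymm M) (h' : IsSymm M') : IsSymm (M * M') := by
  intro σ I J
  rw [Matrix.mul_apply, Matrix.mul_apply,
    ← Equiv.sum_comp (Equiv.arrowCongr σ.symm (Equiv.refl β))]
  refine Finset.sum_congr rfl fun K _ => ?_
  exact congrArg₂ _ (h σ I K) (h' σ K J)

end Words

/-! ### The Schur algebra and its semisimplicity -/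

section SchurAlgebra

variable {ι α : Type} [Fintype ι] [DecidableEq ι] [Fintype α] [DecidableEq α]

/-- The Schur algebra, i.e. the symmetric matrices indexed by words. -/
def schurAlg (ι α : Type) [Fintype ι] [DecidableEq ι] [Fintype α] [DecidableEq α] :
    Subalgebra ℂ (Matrix (ι → α) (ι → α) ℂ) where
  carrier := {M | IsSymm M}
  mul_mem' h h' := h.mul h'
  add_mem' h h' σ I J := congrArg₂ (· + ·) (h σ I J) (h' σ I J)
  algebraMap_mem' c σ I J := by
    rw [Matrix.algebraMap_matrix_apply, Matrix.algebraMap_matrix_apply]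
    have : (I ∘ σ = J ∘ σ) = (I = J) := by
      rw [σ.surjective.injective_comp_right.eq_iff]
    simp [this]

/-- The tensor power of a matrix as an element of the Schur algebra. -/
def spow (ι : Type) [Fintype ι] [DecidableEq ι] (X : Matrix α α ℂ) : schurAlg ι α :=
  ⟨tpow ι X, tpow_isSymm X⟩

theorem spow_mul (X Y : Matrix α α ℂ) : spow ι (X * Y) = spow ι X * spow ι Y :=
  Subtype.ext (tpow_mul X Y)

theorem spow_one : spow ι (1 : Matrix α α ℂ) = 1 := Subtype.ext tpow_one

open scoped ComplexOrder in
-- A Hermitian `z` with `z ^ 2 = 0` satisfies `zᴴ z = 0`, hence vanishes by positivity. Halving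
-- exponents shows that a nilpotent Hermitian matrix is zero, and this applies to `xᴴ x`.
theorem eq_zero_of_isNilpotent_conjTranspose_mul_self {m : Type} [Fintype m] [DecidableEq m]
    {x : Matrix m m ℂ} (h : IsNilpotent (x.conjTranspose * x)) : x = 0 := by
  have key : ∀ k, ∀ z : Matrix m m ℂ, z.IsHermitian → z ^ (2 ^ k) = 0 → z = 0 := by
    intro k
    induction k with
    | zero => intro z _ h; simpa using h
    | succ k ih =>
      intro z hz h
      have h1 : (z ^ 2 : Matrix _ _ ℂ) = 0 := by
        refine ih (z ^ 2) (hz.pow 2) ?_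
        rw [← pow_mul, ← pow_succ', h]
      rw [pow_two] at h1
      nth_rewrite 1 [← hz.eq] at h1
      exact Matrix.conjTranspose_mul_self_eq_zero.mp h1
  obtain ⟨k, hk⟩ := h
  exact Matrix.conjTranspose_mul_self_eq_zero.mp
    (key k _ (Matrix.isHermitian_conjTranspose_mul_self x)
      (pow_eq_zero_of_le (Nat.lt_two_pow_self).le hk))

theorem IsSymm.conjTranspose {M : Matrix (ι → α) (ι → α) ℂ} (h : IsSymm M) :
    IsSymm M.conjTranspose := by
  intro σ I J
  rw [Matrix.conjTranspose_apply, Matrix.conjTranspose_apply, h]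

instance : IsArtinianRing (schurAlg ι α) := IsArtinianRing.of_finite ℂ _

theorem isNilpotent_of_mem_jacobson {R : Type*} [Ring R] [IsArtinianRing R] {x : R}
    (hx : x ∈ Ring.jacobson R) : IsNilpotent x := by
  obtain ⟨k, hk⟩ := IsArtinianRing.isNilpotent_jacobson_bot (R := R)
  rw [Ideal.jacobson_bot] at hk
  refine ⟨k, ?_⟩
  have h1 : x ^ k ∈ (Ring.jacobson R) ^ k := Ideal.pow_mem_pow hx k
  rw [hk] at h1
  exact h1

/-- The Schur algebra is semisimple, since it is closed under conjugate transposition. -/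
instance : IsSemisimpleRing (schurAlg ι α) := by
  rw [IsArtinianRing.isSemisimpleRing_iff_jacobson, eq_bot_iff]
  rintro ⟨x, hs⟩ hx
  -- The adjoint of a symmetric matrix is symmetric, so `xᴴ x` is again in the radical, whose
  -- elements are nilpotent.
  obtain ⟨k, hk⟩ := isNilpotent_of_mem_jacobson
    (Ideal.mul_mem_left _ (⟨_, IsSymm.conjTranspose hs⟩ : schurAlg ι α) hx)
  have hnil : IsNilpotent (x.conjTranspose * x) := ⟨k, congrArg Subtype.val hk⟩
  exact Subtype.ext (eq_zero_of_isNilpotent_conjTranspose_mul_self hnil)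

end SchurAlgebra

/-! ### Words and monomials -/

section Content

variable {ι α : Type} [Fintype ι]

/-- The content of a word, i.e. the multiplicities of its letters. -/
def content (w : ι → α) : α →₀ ℕ := ∑ k, Finsupp.single (w k) 1

theorem content_apply [DecidableEq α] (w : ι → α) (a : α) :
    content w a = Fintype.card {k // w k = a} := by
  simp [content, Finsupp.finsetSum_apply, Finsupp.single_apply, Fintype.card_subtype]

theorem content_comp (w : ι → α) (σ : Equiv.Perm ι) : content (w ∘ σ) = content w :=
  Equiv.sum_comp σ fun k => Finsupp.single (w k) 1

/-- Equal contents mean that the fibres over each letter have the same size; bijections of fibres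
glue to a permutation of positions. -/
theorem exists_perm_of_content_eq {w w' : ι → α} (h : content w = content w') :
    ∃ σ : Equiv.Perm ι, w' = w ∘ σ := by
  classical
  have e : ∀ a, Nonempty ({k // w' k = a} ≃ {k // w k = a}) := fun a => by
    rw [← Fintype.card_eq]
    have := DFunLike.congr_fun h a
    rw [content_apply, content_apply] at this
    convert this.symm
  refine ⟨Equiv.ofFiberEquiv fun a => (e a).some, ?_⟩
  ext k
  exact (Equiv.ofFiberEquiv_map _ k).symm

theorem exists_content_eq (m : α →₀ ℕ) (hm : m.degree = Fintype.card ι) :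
    ∃ w : ι → α, content w = m := by
  classical
  obtain ⟨l, hl⟩ := Quot.exists_rep (Finsupp.toMultiset m)
  have hl' : (l : Multiset α) = Finsupp.toMultiset m := hl
  have hcard : Fintype.card ι = l.length := by
    rw [← hm, ← Multiset.coe_card, hl', Finsupp.card_toMultiset]
    rfl
  let e : ι ≃ Fin l.length := Fintype.equivFinOfCardEq hcard
  refine ⟨fun k => l.get (e k), ?_⟩
  ext a
  have h1 : m a = l.count a := by
    rw [← Multiset.coe_count, hl', Finsupp.count_toMultiset]
  rw [h1, content_apply, ← Fintype.card_congr (e.subtypeEquiv fun k => Iff.rfl :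
    {k // l.get (e k) = a} ≃ {i : Fin l.length // l.get i = a}).symm, Fintype.card_subtype]
  have h2 : l.count a = (List.ofFn l.get).count a := by rw [List.ofFn_get]
  rw [h2, ← Multiset.coe_count]
  have h3 : ((List.ofFn l.get : List α) : Multiset α) = Finset.univ.val.map l.get := by
    rw [Fin.univ_val_map]
  rw [h3, Multiset.count_map, Finset.card_def, Finset.filter_val]
  simp only [eq_comm]

end Content

/-! ### Spanning of the Schur algebra by tensor powers -/

section Polarization

variable {ι : Type} [Fintype ι] [DecidableEq ι] {n : ℕ}

theorem eval_monomial_content (w : ι → Fin n × Fin n) (c : ℂ) (X : Matrix (Fin n) (Fin n) ℂ) :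
    polyFun (MvPolynomial.monomial (content w) c) X = c * ∏ k, X (w k).1 (w k).2 := by
  unfold polyFun content
  rw [MvPolynomial.eval_monomial, ← Finsupp.prod_finsetSum_index (by simp) (by simp [pow_add])]
  simp

/-- A homogeneous polynomial in the entries of a matrix is a linear function of its tensor power. -/
theorem exists_linear_tpow {p : MvPolynomial (Fin n × Fin n) ℂ}
    (hp : p.IsHomogeneous (Fintype.card ι)) :
    ∃ l : Matrix (ι → Fin n) (ι → Fin n) ℂ →ₗ[ℂ] ℂ, ∀ X, l (tpow ι X) = polyFun p X := by
  -- Each monomial of degree `card ι` is the content of a word of index pairs, so it is a single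
  -- entry of the tensor power.
  have h : ∀ m : p.support, ∃ w : ι → Fin n × Fin n, content w = m := fun m =>
    exists_content_eq m.1 (by
      rw [← hp (MvPolynomial.mem_support_iff.mp m.2), Finsupp.degree_eq_weight_one]
      rfl)
  choose w hw using h
  refine ⟨∑ m : p.support, p.coeff m • Matrix.entryLinearMap ℂ ℂ
    (fun k => (w m k).1) (fun k => (w m k).2), fun X => ?_⟩
  have h1 : polyFun p X = ∑ m : p.support, polyFun (MvPolynomial.monomial m (p.coeff m)) X := by
    rw [Finset.sum_coe_sort p.support fun m => polyFun (MvPolynomial.monomial m (p.coeff m)) X]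
    simp only [polyFun]
    rw [← map_sum, ← p.as_sum]
  rw [h1, LinearMap.sum_apply]
  refine Finset.sum_congr rfl fun m _ => ?_
  conv_rhs => rw [← hw m, eval_monomial_content]
  rw [hw m]
  rfl

/-- The Schur algebra is spanned by the tensor powers of invertible matrices. -/
theorem span_tpow_GL : Submodule.span ℂ (Set.range fun g : Matrix.GeneralLinearGroup (Fin n) ℂ =>
      tpow ι (g : Matrix (Fin n) (Fin n) ℂ)) = Subalgebra.toSubmodule (schurAlg ι (Fin n)) := by
  classical
  refine le_antisymm ?_ ?_
  · rw [Submodule.span_le]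
    rintro _ ⟨g, rfl⟩
    exact tpow_isSymm _
  intro M hM
  by_contra hMS
  -- A functional separating `M` from the span restricts to a polynomial function on the group that
  -- vanishes identically, so by density all its coefficients vanish.
  obtain ⟨φ, hφM, hφ⟩ := Submodule.exists_le_ker_of_notMem hMS
  let c : (ι → Fin n) → (ι → Fin n) → ℂ := fun I J => φ (Matrix.single I J 1)
  have hφ' : ∀ X, φ X = ∑ I, ∑ J, c I J * X I J := by
    intro X
    conv_lhs => rw [Matrix.matrix_eq_sum_single X]
    simp only [map_sum]
    refine Finset.sum_congr rfl fun I _ => Finset.sum_congr rfl fun J _ => ?_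
    rw [← mul_one (X I J), ← smul_eq_mul, ← Matrix.smul_single, map_smul, smul_eq_mul, mul_comm,
      smul_eq_mul, mul_one]
  let pr : (ι → Fin n) × (ι → Fin n) → (ι → Fin n × Fin n) := fun P k => (P.1 k, P.2 k)
  let p : MvPolynomial (Fin n × Fin n) ℂ :=
    ∑ P, MvPolynomial.monomial (content (pr P)) (c P.1 P.2)
  have hp : p = 0 := by
    refine eq_zero_of_forall_GL fun g => ?_
    have h0 : φ (tpow ι (g : Matrix (Fin n) (Fin n) ℂ)) = 0 :=
      hφ (Submodule.subset_span ⟨g, rfl⟩)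
    rw [hφ', ← Fintype.sum_prod_type' (f := fun I J => c I J * tpow ι _ I J)] at h0
    rw [← h0]
    have : polyFun p (g : Matrix (Fin n) (Fin n) ℂ) = ∑ P,
        polyFun (MvPolynomial.monomial (content (pr P)) (c P.1 P.2)) g := by
      simp [polyFun, p]
    rw [this]
    refine Finset.sum_congr rfl fun P _ => ?_
    rw [eval_monomial_content]
    rfl
  apply hφM
  -- Index pairs with the same content differ by a place permutation, and `M` is constant on them.
  -- So `φ M` is a combination of coefficients of `p`.
  rw [hφ', ← Fintype.sum_prod_type' (f := fun I J => c I J * M I J),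
    ← Finset.sum_fiberwise_of_maps_to (t := Finset.univ.image fun P => content (pr P))
      (g := fun P => content (pr P)) (fun P hP => Finset.mem_image_of_mem _ hP)]
  refine Finset.sum_eq_zero fun m hm => ?_
  obtain ⟨P₀, -, rfl⟩ := Finset.mem_image.mp hm
  have h1 : ∀ P ∈ Finset.univ.filter (fun P => content (pr P) = content (pr P₀)),
      c P.1 P.2 * M P.1 P.2 = c P.1 P.2 * M P₀.1 P₀.2 := by
    intro P hP
    obtain ⟨σ, hσ⟩ := exists_perm_of_content_eq (Finset.mem_filter.mp hP).2
    have h1 : P₀.1 = P.1 ∘ σ := funext fun k => congrArg Prod.fst (congrFun hσ k)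
    have h2 : P₀.2 = P.2 ∘ σ := funext fun k => congrArg Prod.snd (congrFun hσ k)
    rw [h1, h2, hM σ]
  rw [Finset.sum_congr rfl h1, ← Finset.sum_mul]
  have h2 : MvPolynomial.coeff (content (pr P₀)) p = 0 := by rw [hp, MvPolynomial.coeff_zero]
  rw [MvPolynomial.coeff_sum] at h2
  simp only [MvPolynomial.coeff_monomial] at h2
  rw [Finset.sum_filter, h2, zero_mul]

theorem span_spow_GL : Submodule.span ℂ (Set.range fun g : Matrix.GeneralLinearGroup (Fin n) ℂ =>
      spow ι (g : Matrix (Fin n) (Fin n) ℂ)) = ⊤ := by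
  have hinj : Function.Injective
      (Submodule.map (Subalgebra.toSubmodule (schurAlg ι (Fin n))).subtype) :=
    Submodule.map_injective_of_injective Subtype.val_injective
  apply hinj
  rw [Submodule.map_span, Submodule.map_top, Submodule.range_subtype, ← Set.range_comp]
  exact span_tpow_GL

theorem schurAlg_induction {P : schurAlg ι (Fin n) → Prop}
    (hg : ∀ g : Matrix.GeneralLinearGroup (Fin n) ℂ, P (spow ι (g : Matrix (Fin n) (Fin n) ℂ)))
    (h0 : P 0) (hadd : ∀ a b, P a → P b → P (a + b)) (hsmul : ∀ (c : ℂ) a, P a → P (c • a))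
    (a : schurAlg ι (Fin n)) : P a := by
  have ha : a ∈ Submodule.span ℂ (Set.range fun g : Matrix.GeneralLinearGroup (Fin n) ℂ =>
      spow ι (g : Matrix (Fin n) (Fin n) ℂ)) := by rw [span_spow_GL]; trivial
  induction ha using Submodule.span_induction with
  | mem x hx => obtain ⟨g, rfl⟩ := hx; exact hg g
  | zero => exact h0
  | add x y _ _ hx hy => exact hadd x y hx hy
  | smul c x _ hx => exact hsmul c x hx

end Polarization

/-! ### Homogeneous representations as modules over the Schur algebra -/

section Extension

variable {n : ℕ} {V : Type} [AddCommGroup V] [Module ℂ V]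

/-- All matrix coefficients are homogeneous polynomials of degree `d` in the matrix entries. -/
def IsPolyHom (rho : Representation ℂ (Matrix.GeneralLinearGroup (Fin n) ℂ) V) (d : ℕ) : Prop :=
  ∀ (phi : Module.Dual ℂ V) (v : V), ∃ p : MvPolynomial (Fin n × Fin n) ℂ, p.IsHomogeneous d ∧
    ∀ g : Matrix.GeneralLinearGroup (Fin n) ℂ,
      phi (rho g v) = polyFun p (g : Matrix (Fin n) (Fin n) ℂ)

/-- A homogeneous polynomial representation of `GL_n` is a module over the Schur algebra. -/
theorem IsPolyHom.exists_algHom [FiniteDimensional ℂ V]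
    {rho : Representation ℂ (Matrix.GeneralLinearGroup (Fin n) ℂ) V} {d : ℕ}
    (h : IsPolyHom rho d) :
    ∃ Θ : schurAlg (Fin d) (Fin n) →ₐ[ℂ] Module.End ℂ V,
      ∀ g : Matrix.GeneralLinearGroup (Fin n) ℂ,
        Θ (spow (Fin d) (g : Matrix (Fin n) (Fin n) ℂ)) = rho g := by
  classical
  let b := Module.finBasis ℂ V
  have h1 : ∀ i j, ∃ l : Matrix (Fin d → Fin n) (Fin d → Fin n) ℂ →ₗ[ℂ] ℂ,
      ∀ g : Matrix.GeneralLinearGroup (Fin n) ℂ,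
        l (tpow (Fin d) (g : Matrix (Fin n) (Fin n) ℂ)) = b.coord j (rho g (b i)) := by
    intro i j
    obtain ⟨p, hp, hpg⟩ := h (b.coord j) (b i)
    obtain ⟨l, hl⟩ := exists_linear_tpow (ι := Fin d) (by rwa [Fintype.card_fin])
    exact ⟨l, fun g => by rw [hl, hpg]⟩
  choose l hl using h1
  let T : schurAlg (Fin d) (Fin n) →ₗ[ℂ] Module.End ℂ V :=
    (Matrix.toLin b b).toLinearMap ∘ₗ
      (LinearMap.pi fun j => LinearMap.pi fun i =>
        (l i j) ∘ₗ (Subalgebra.toSubmodule (schurAlg (Fin d) (Fin n))).subtype)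
  have hT : ∀ g : Matrix.GeneralLinearGroup (Fin n) ℂ,
      T (spow (Fin d) (g : Matrix (Fin n) (Fin n) ℂ)) = rho g := by
    intro g
    refine b.ext fun i => ?_
    refine (Matrix.toLin_self b b _ i).trans ?_
    rw [← b.sum_repr (rho g (b i))]
    refine Finset.sum_congr rfl fun j _ => ?_
    exact congrArg (· • b j) (hl i j g)
  -- Both sides are bilinear, so multiplicativity need only be checked on tensor powers of group
  -- elements, where it is that of `rho`.
  have hmul : ∀ x y, T (x * y) = T x * T y := by
    intro x y
    induction x using schurAlg_induction with
    | h0 => simp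
    | hadd a b ha hb => rw [add_mul, map_add, map_add, add_mul, ha, hb]
    | hsmul c a ha => rw [smul_mul_assoc, map_smul, map_smul, smul_mul_assoc, ha]
    | hg g =>
      induction y using schurAlg_induction with
      | h0 => simp
      | hadd a b ha hb => rw [mul_add, map_add, map_add, mul_add, ha, hb]
      | hsmul c a ha => rw [mul_smul_comm, map_smul, map_smul, mul_smul_comm, ha]
      | hg g' => rw [← spow_mul, ← Units.val_mul, hT, hT, hT, map_mul]
  refine ⟨AlgHom.ofLinearMap T ?_ hmul, hT⟩
  have := hT 1
  rwa [map_one, Units.val_one, spow_one] at this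

end Extension

/-! ### Traces twisted by permutations -/

section PermTrace

variable {ι α : Type} [Fintype ι] [DecidableEq ι] [Fintype α] [DecidableEq α]

/-- The trace of a symmetric matrix composed with the permutation `σ` of positions. -/
def permTrace (σ : Equiv.Perm ι) : schurAlg ι α →ₗ[ℂ] ℂ where
  toFun M := ∑ I, (M : Matrix (ι → α) (ι → α) ℂ) I (I ∘ σ)
  map_add' _ _ := Finset.sum_add_distrib
  map_smul' _ _ := (Finset.mul_sum _ _ _).symm

theorem permTrace_apply (σ : Equiv.Perm ι) (M : schurAlg ι α) :
    permTrace σ M = ∑ I, (M : Matrix (ι → α) (ι → α) ℂ) I (I ∘ σ) := rfl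

theorem sum_comp_perm (σ : Equiv.Perm ι) (f : (ι → α) → ℂ) : ∑ I, f (I ∘ σ) = ∑ I, f I :=
  Equiv.sum_comp (Equiv.arrowCongr σ.symm (Equiv.refl α)) f

/-- Elements of the Schur algebra commute with place permutations, so the usual cyclicity argument
survives the twist by `σ`. -/
theorem permTrace_mul_comm (σ : Equiv.Perm ι) (a b : schurAlg ι α) :
    permTrace σ (a * b) = permTrace σ (b * a) := by
  simp only [permTrace_apply, MulMemClass.coe_mul, Matrix.mul_apply]
  rw [Finset.sum_comm]
  rw [← sum_comp_perm σ]
  refine Finset.sum_congr rfl fun J _ => Finset.sum_congr rfl fun I _ => ?_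
  rw [b.2 σ, mul_comm]

theorem permTrace_conj (σ τ : Equiv.Perm ι) (a : schurAlg ι α) :
    permTrace (τ * σ * τ⁻¹) a = permTrace σ a := by
  simp only [permTrace_apply]
  rw [← sum_comp_perm τ⁻¹]
  refine Finset.sum_congr rfl fun I _ => ?_
  rw [← a.2 τ⁻¹ I (I ∘ σ)]
  exact congrArg _ (funext fun k => by simp)

theorem permTrace_eq_of_isConj {σ τ : Equiv.Perm ι} (h : IsConj σ τ) (a : schurAlg ι α) :
    permTrace σ a = permTrace τ a := by
  obtain ⟨c, hc⟩ := isConj_iff.mp h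
  rw [← hc, permTrace_conj]

/-- A permutation and its inverse are conjugate. This is why the orthogonality relations below need
no complex conjugation. -/
theorem permTrace_inv (σ : Equiv.Perm ι) (a : schurAlg ι α) : permTrace σ⁻¹ a = permTrace σ a :=
  permTrace_eq_of_isConj (Equiv.Perm.isConj_iff_cycleType_eq.mpr σ.cycleType_inv) a

theorem trace_matrix_end {m : Type} [Fintype m] [DecidableEq m]
    (f : Matrix m m ℂ →ₗ[ℂ] Matrix m m ℂ) :
    LinearMap.trace ℂ _ f = ∑ i, ∑ j, f (Matrix.single i j 1) i j := by
  rw [LinearMap.trace_eq_matrix_trace ℂ (Matrix.stdBasis ℂ m m), Matrix.trace,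
    Fintype.sum_prod_type]
  refine Finset.sum_congr rfl fun i _ => Finset.sum_congr rfl fun j _ => ?_
  rw [Matrix.diag_apply, LinearMap.toMatrix_apply, Matrix.stdBasis_eq_single]
  rfl

/-- Averaging over simultaneous permutations of the positions. -/
def symmetrize (ι α : Type) [Fintype ι] [DecidableEq ι] [Fintype α] [DecidableEq α] :
    Matrix (ι → α) (ι → α) ℂ →ₗ[ℂ] schurAlg ι α where
  toFun M := ⟨Matrix.of fun I J => ((Fintype.card ι).factorial : ℂ)⁻¹ *
      ∑ σ : Equiv.Perm ι, M (I ∘ σ) (J ∘ σ), fun τ I J => by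
    simp only [Matrix.of_apply]
    rw [← Equiv.sum_comp (Equiv.mulLeft τ) (fun σ : Equiv.Perm ι => M (I ∘ σ) (J ∘ σ))]
    rfl⟩
  map_add' M M' := Subtype.ext <| by
    ext I J
    simp [Finset.sum_add_distrib, mul_add]
  map_smul' c M := Subtype.ext <| by
    ext I J
    simp only [Matrix.smul_apply, ← Finset.smul_sum, Matrix.of_apply, mul_smul_comm,
      SetLike.val_smul, RingHom.id_apply]

theorem symmetrize_coe (a : schurAlg ι α) : symmetrize ι α a = a := by
  refine Subtype.ext ?_
  ext I J
  change ((Fintype.card ι).factorial : ℂ)⁻¹ *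
    ∑ σ : Equiv.Perm ι, (a : Matrix _ _ ℂ) (I ∘ σ) (J ∘ σ) = _
  rw [Finset.sum_congr rfl fun σ _ => a.2 σ I J, Finset.sum_const, Finset.card_univ,
    Fintype.card_perm, nsmul_eq_mul, ← mul_assoc, inv_mul_cancel₀, one_mul]
  exact_mod_cast Nat.factorial_ne_zero _

/-- The trace of `a ↦ x a y` on the Schur algebra. -/
theorem trace_mulLeft_mulRight (x y : schurAlg ι α) :
    LinearMap.trace ℂ _ (LinearMap.mulLeft ℂ x ∘ₗ LinearMap.mulRight ℂ y) =
      ((Fintype.card ι).factorial : ℂ)⁻¹ *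
        ∑ σ : Equiv.Perm ι, permTrace σ x * permTrace σ y := by
  let incl : schurAlg ι α →ₗ[ℂ] Matrix (ι → α) (ι → α) ℂ := (schurAlg ι α).val.toLinearMap
  let f : schurAlg ι α →ₗ[ℂ] Matrix (ι → α) (ι → α) ℂ :=
    incl ∘ₗ LinearMap.mulLeft ℂ x ∘ₗ LinearMap.mulRight ℂ y
  -- Since `symmetrize` is a projection onto the Schur algebra, cyclicity moves the trace to the
  -- full matrix space, where it can be read off on matrix units.
  have h1 : LinearMap.mulLeft ℂ x ∘ₗ LinearMap.mulRight ℂ y = symmetrize ι α ∘ₗ f :=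
    LinearMap.ext fun a => (symmetrize_coe _).symm
  rw [h1, LinearMap.trace_comp_comm', trace_matrix_end]
  have h2 : ∀ I J, (f ∘ₗ symmetrize ι α) (Matrix.single I J 1) I J =
      ((Fintype.card ι).factorial : ℂ)⁻¹ * ∑ σ : Equiv.Perm ι,
        (x : Matrix _ _ ℂ) I (I ∘ σ) * (y : Matrix _ _ ℂ) (J ∘ σ) J := by
    intro I J
    have h3 : (f ∘ₗ symmetrize ι α) (Matrix.single I J 1) =
        (x : Matrix _ _ ℂ) * (((Fintype.card ι).factorial : ℂ)⁻¹ • ∑ σ : Equiv.Perm ι,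
          (Matrix.single I J (1 : ℂ)).submatrix (fun I => I ∘ σ) (fun I => I ∘ σ)) *
          (y : Matrix _ _ ℂ) := by
      rw [mul_assoc]
      have h6 : ((symmetrize ι α (Matrix.single I J 1) : schurAlg ι α) : Matrix _ _ ℂ) =
          ((Fintype.card ι).factorial : ℂ)⁻¹ • ∑ σ : Equiv.Perm ι,
            (Matrix.single I J (1 : ℂ)).submatrix (fun I => I ∘ σ) (fun I => I ∘ σ) := by
        ext K L
        rw [Matrix.smul_apply, Matrix.sum_apply]
        rfl
      rw [← h6]
      rfl
    have h4 : ∀ σ : Equiv.Perm ι,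
        (Matrix.single I J (1 : ℂ)).submatrix (fun I => I ∘ σ) (fun I => I ∘ σ) =
          Matrix.single (I ∘ (σ⁻¹ : Equiv.Perm ι)) (J ∘ (σ⁻¹ : Equiv.Perm ι)) 1 := by
      intro σ
      have h5 : ∀ I K : ι → α, (I = K ∘ σ) = (I ∘ (σ⁻¹ : Equiv.Perm ι) = K) := by
        intro I K
        refine propext ⟨?_, ?_⟩
        · rintro rfl
          ext k
          simp
        · rintro rfl
          ext k
          simp
      ext K L
      simp only [Matrix.submatrix_apply, Matrix.single_apply, h5]
    rw [h3, mul_smul_comm, smul_mul_assoc, Matrix.smul_apply, smul_eq_mul, Finset.mul_sum,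
      Finset.sum_mul, Matrix.sum_apply, ← Equiv.sum_comp (Equiv.inv (Equiv.Perm ι))]
    congr 1
    refine Finset.sum_congr rfl fun σ _ => ?_
    rw [h4]
    simp [Matrix.mul_apply, Matrix.single_apply, Finset.sum_ite_eq, ite_and]
  simp_rw [h2, ← Finset.mul_sum]
  congr 1
  simp_rw [Finset.sum_comm (s := (Finset.univ : Finset (ι → α)))
    (t := (Finset.univ : Finset (Equiv.Perm ι))), permTrace_apply]
  refine Finset.sum_congr rfl fun σ _ => ?_
  rw [Finset.sum_mul_sum]
  refine Finset.sum_congr rfl fun I _ => ?_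
  rw [← Finset.mul_sum, ← Finset.mul_sum]
  congr 1
  -- The second factor appears as `y` at `(J ∘ σ, J)`, which is the trace twisted by `σ⁻¹`.
  have h6 := permTrace_inv σ y
  rw [permTrace_apply, permTrace_apply] at h6
  rw [← h6]
  refine Eq.trans ?_
    (sum_comp_perm σ fun J : ι → α =>
      (y : Matrix (ι → α) (ι → α) ℂ) J (J ∘ (σ⁻¹ : Equiv.Perm ι)))
  refine Finset.sum_congr rfl fun J _ => ?_
  exact congrArg _ (funext fun k => by simp)

end PermTrace

/-! ### Equivariant maps out of a cyclic module -/

section Hom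

variable {A G F M : Type} [Ring A] [Algebra ℂ A] [Monoid G]
  [AddCommGroup F] [Module ℂ F] [AddCommGroup M] [Module ℂ M]

theorem intertwining_of_span {s : G → A} (hs : Submodule.span ℂ (Set.range s) = ⊤)
    {θF : A →ₐ[ℂ] Module.End ℂ F} {θM : A →ₐ[ℂ] Module.End ℂ M} {f : F →ₗ[ℂ] M}
    (hf : ∀ g x, f (θF (s g) x) = θM (s g) (f x)) (a : A) (x : F) :
    f (θF a x) = θM a (f x) := by
  have ha : a ∈ Submodule.span ℂ (Set.range s) := by rw [hs]; trivial
  induction ha using Submodule.span_induction with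
  | mem a ha => obtain ⟨g, rfl⟩ := ha; exact hf g x
  | zero => simp
  | add a b _ _ ha hb => simp [ha, hb]
  | smul c a _ ha => simp [ha]

/-- If `F` is generated by `u`, and `ε u = u`, and `ε` is killed on the left by the annihilator of
`u`, then equivariant maps from `F` to `M` correspond to the vectors of `M` fixed by `ε`. -/
theorem nonempty_equiv_fixed {s : G → A} (hs : Submodule.span ℂ (Set.range s) = ⊤)
    {rhoF : Representation ℂ G F} {rhoM : Representation ℂ G M}
    {θF : A →ₐ[ℂ] Module.End ℂ F} {θM : A →ₐ[ℂ] Module.End ℂ M}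
    (hF : ∀ g, θF (s g) = rhoF g) (hM : ∀ g, θM (s g) = rhoM g)
    {u : F} (hu : ∀ x, ∃ a, θF a u = x) {ε : A} (hεu : θF ε u = u)
    (hε : ∀ a, θF a u = 0 → a * ε = 0) :
    Nonempty (Representation.IntertwiningMap rhoF rhoM ≃ₗ[ℂ] LinearMap.ker (θM ε - 1)) := by
  have hcomm : ∀ (f : Representation.IntertwiningMap rhoF rhoM) a x, f (θF a x) = θM a (f x) := by
    intro f a x
    refine intertwining_of_span hs (f := f.toLinearMap) (fun g x => ?_) a x
    rw [hF, hM]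
    exact f.isIntertwining rhoF rhoM g x
  let ev : Representation.IntertwiningMap rhoF rhoM →ₗ[ℂ] LinearMap.ker (θM ε - 1) :=
    { toFun := fun f => ⟨f u, by
        rw [LinearMap.mem_ker, LinearMap.sub_apply, ← hcomm, hεu]
        exact sub_self _⟩
      map_add' := fun _ _ => rfl
      map_smul' := fun _ _ => rfl }
  refine ⟨LinearEquiv.ofBijective ev ⟨?_, ?_⟩⟩
  · rw [injective_iff_map_eq_zero]
    intro f hf
    have h0 : f u = 0 := congrArg Subtype.val hf
    apply Representation.IntertwiningMap.ext
    ext x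
    obtain ⟨a, rfl⟩ := hu x
    change f (θF a u) = 0
    rw [hcomm, h0, map_zero]
  · rintro ⟨m, hm⟩
    have hm' : θM ε m = m := by
      rw [LinearMap.mem_ker, LinearMap.sub_apply, sub_eq_zero] at hm
      exact hm
    -- The map with prescribed value `m` at `u` has to send `θF a u` to `θM a m`. It is well defined
    -- because `θF a u = 0` gives `a * ε = 0`, while `m = θM ε m`. The map `g` is a linear section
    -- of `a ↦ θF a u`.
    let Lu : A →ₗ[ℂ] F := (LinearMap.applyₗ u) ∘ₗ θF.toLinearMap
    let Lm : A →ₗ[ℂ] M := (LinearMap.applyₗ m) ∘ₗ θM.toLinearMap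
    obtain ⟨g, hg⟩ := Lu.exists_rightInverse_of_surjective (LinearMap.range_eq_top.mpr hu)
    have hker : ∀ a, Lu a = 0 → Lm a = 0 := by
      intro a ha
      change θM a m = 0
      rw [← hm', ← Module.End.mul_apply, ← map_mul, hε a ha, map_zero]
      rfl
    have hfac : ∀ a, Lm (g (Lu a)) = Lm a := by
      intro a
      rw [← sub_eq_zero, ← map_sub]
      apply hker
      rw [map_sub, sub_eq_zero]
      exact LinearMap.congr_fun hg (Lu a)
    have hint : ∀ h x, (Lm ∘ₗ g) (rhoF h x) = rhoM h ((Lm ∘ₗ g) x) := by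
      intro h x
      obtain ⟨a, rfl⟩ := hu x
      have h1 : rhoF h (θF a u) = Lu (s h * a) := by
        change _ = θF (s h * a) u
        rw [map_mul, hF]
        rfl
      rw [h1]
      change Lm (g (Lu _)) = rhoM h (Lm (g (Lu a)))
      rw [hfac, hfac, ← hM]
      change θM _ m = θM (s h) (θM a m)
      rw [map_mul]
      rfl
    refine ⟨(Lm ∘ₗ g).intertwiningMap_of_isIntertwiningMap rhoF rhoM hint, Subtype.ext ?_⟩
    change Lm (g u) = m
    have h1 : u = Lu 1 := by
      change u = θF 1 u
      rw [map_one]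
      rfl
    rw [h1, hfac]
    change θM 1 m = m
    rw [map_one]
    rfl

/-- Applying `hε` to `ε - 1` shows that `ε` is idempotent, and the trace of a projection is the
dimension of its fixed space. -/
theorem finrank_intertwiningMap_eq_trace [FiniteDimensional ℂ M]
    {s : G → A} (hs : Submodule.span ℂ (Set.range s) = ⊤)
    {rhoF : Representation ℂ G F} {rhoM : Representation ℂ G M}
    {θF : A →ₐ[ℂ] Module.End ℂ F} {θM : A →ₐ[ℂ] Module.End ℂ M}
    (hF : ∀ g, θF (s g) = rhoF g) (hM : ∀ g, θM (s g) = rhoM g)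
    {u : F} (hu : ∀ x, ∃ a, θF a u = x) {ε : A} (hεu : θF ε u = u)
    (hε : ∀ a, θF a u = 0 → a * ε = 0) :
    (Module.finrank ℂ (Representation.IntertwiningMap rhoF rhoM) : ℂ) =
      LinearMap.trace ℂ M (θM ε) := by
  obtain ⟨e⟩ := nonempty_equiv_fixed hs hF hM hu hεu hε
  have hidem : ε * ε = ε := by
    have := hε (ε - 1) (by rw [map_sub, map_one, LinearMap.sub_apply, hεu]; exact sub_self u)
    rwa [sub_mul, one_mul, sub_eq_zero] at this
  have hmem : ∀ x, x ∈ LinearMap.ker (θM ε - 1) ↔ θM ε x = x := by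
    intro x
    rw [LinearMap.mem_ker, LinearMap.sub_apply, sub_eq_zero]
    rfl
  have hproj : LinearMap.IsProj (LinearMap.ker (θM ε - 1)) (θM ε) :=
    ⟨fun x => by
      rw [hmem, ← Module.End.mul_apply, ← map_mul, hidem], fun x hx => (hmem x).mp hx⟩
  rw [hproj.trace, e.finrank_eq]

end Hom

/-! ### Modules over a product of matrix algebras -/

section MatrixAlgebra

variable {k : ℕ} {d : Fin k → ℕ}

/-- A product of matrix algebras. -/
abbrev PiMat (d : Fin k → ℕ) : Type := (i : Fin k) → Matrix (Fin (d i)) (Fin (d i)) ℂ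

theorem piMat_eq_sum (b : PiMat d) :
    b = ∑ i, ∑ r, ∑ c, b i r c • (Pi.single i (Matrix.single r c 1) : PiMat d) := by
  conv_lhs => rw [← Finset.univ_sum_single b]
  refine Finset.sum_congr rfl fun i _ => ?_
  conv_lhs => rw [Matrix.matrix_eq_sum_single (b i)]
  rw [← LinearMap.single_apply (R := ℂ), map_sum]
  refine Finset.sum_congr rfl fun r _ => ?_
  rw [map_sum]
  refine Finset.sum_congr rfl fun c _ => ?_
  rw [← LinearMap.single_apply (R := ℂ), ← map_smul, Matrix.smul_single, smul_eq_mul, mul_one]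

theorem mul_piSingle (b : PiMat d) (i : Fin k) (M : Matrix (Fin (d i)) (Fin (d i)) ℂ) :
    b * Pi.single i M = Pi.single i (b i * M) := by
  ext1 j
  by_cases h : j = i
  · subst h; simp
  · simp [Pi.single_eq_of_ne h]

/-- Writing the matrix unit `(r, c)` as the product of the units `(r, 0)` and `(0, c)` and
exchanging the factors gives zero off the diagonal and the unit `(0, 0)` on it. So one constant per
block determines the functional. -/
theorem trace_functional [∀ i, NeZero (d i)] (τ : PiMat d →ₗ[ℂ] ℂ)
    (hτ : ∀ a b, τ (a * b) = τ (b * a)) :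
    ∃ c : Fin k → ℂ, ∀ b, τ b = ∑ i, c i * (b i).trace := by
  refine ⟨fun i => τ (Pi.single i (Matrix.single 0 0 1)), fun b => ?_⟩
  conv_lhs => rw [piMat_eq_sum b]
  simp only [map_sum, map_smul, smul_eq_mul]
  refine Finset.sum_congr rfl fun i _ => ?_
  have h1 : ∀ r c : Fin (d i), τ (Pi.single i (Matrix.single r c 1)) =
      if r = c then τ (Pi.single i (Matrix.single 0 0 1)) else 0 := by
    intro r c
    have h2 : (Pi.single i (Matrix.single r c 1) : PiMat d) =
        Pi.single i (Matrix.single r 0 1) * Pi.single i (Matrix.single 0 c 1) := by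
      rw [mul_piSingle]; simp
    rw [h2, hτ, mul_piSingle]
    split_ifs with h
    · subst h
      rw [Pi.single_eq_same, Matrix.single_mul_single_same, one_mul]
    · rw [Pi.single_eq_same, Matrix.single_mul_single_of_ne _ _ _ _ (Ne.symm h), Pi.single_zero, map_zero]
  generalize τ (Pi.single i (Matrix.single 0 0 1)) = T at h1 ⊢
  simp only [h1]
  rw [Matrix.trace, Finset.mul_sum]
  refine Finset.sum_congr rfl fun r _ => ?_
  rw [Finset.sum_eq_single r (fun c _ hc => by rw [if_neg hc.symm, mul_zero]) (by simp),
    if_pos rfl, Matrix.diag_apply, mul_comm]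

/-- The coefficient of `x E y` at the matrix unit `E = (r, c)` of block `i` is `x i r r * y i c c`.
-/
theorem trace_mulLeft_mulRight_piMat (x y : PiMat d) :
    LinearMap.trace ℂ _ (LinearMap.mulLeft ℂ x ∘ₗ LinearMap.mulRight ℂ y) =
      ∑ i, (x i).trace * (y i).trace := by
  rw [LinearMap.trace_eq_matrix_trace ℂ
    (Pi.basis fun i => Matrix.stdBasis ℂ (Fin (d i)) (Fin (d i))), Matrix.trace,
    Fintype.sum_sigma]
  refine Finset.sum_congr rfl fun i _ => ?_
  rw [Fintype.sum_prod_type, Matrix.trace, Matrix.trace, Finset.sum_mul_sum]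
  refine Finset.sum_congr rfl fun r _ => Finset.sum_congr rfl fun c _ => ?_
  rw [Matrix.diag_apply, LinearMap.toMatrix_apply, Pi.basis_repr, Pi.basis_apply,
    Matrix.stdBasis_eq_single]
  change ((x * ((Pi.single i (Matrix.single r c 1) : PiMat d) * y) : PiMat d) i) r c = _
  rw [Pi.mul_apply, Pi.mul_apply, Pi.single_eq_same]
  simp [Matrix.mul_apply, Matrix.single_apply, ite_and]

variable {V : Type} [AddCommGroup V] [Module ℂ V]

/-- A simple module over a product of matrix algebras is the column module of one factor. -/
theorem exists_equiv_column (θ : PiMat d →ₐ[ℂ] Module.End ℂ V) {u : V} (hu : u ≠ 0)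
    (hsimple : ∀ w : V, w ≠ 0 → ∀ x, ∃ b, θ b w = x) :
    ∃ (i : Fin k) (e : V ≃ₗ[ℂ] (Fin (d i) → ℂ)), ∀ b x, e (θ b x) = (b i).mulVec (e x) := by
  -- The identity is the sum of the diagonal matrix units, so one of them does not kill `u`.
  have h1 : ∃ i, ∃ r : Fin (d i), θ (Pi.single i (Matrix.single r r 1)) u ≠ 0 := by
    by_contra! h
    apply hu
    have h2 : θ 1 u = 0 := by
      rw [piMat_eq_sum (1 : PiMat d)]
      simp only [map_sum, map_smul, LinearMap.sum_apply, LinearMap.smul_apply]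
      refine Finset.sum_eq_zero fun i _ => Finset.sum_eq_zero fun r _ =>
        Finset.sum_eq_zero fun c _ => ?_
      by_cases hrc : r = c
      · subst hrc
        rw [h, smul_zero]
      · rw [Pi.one_apply, Matrix.one_apply_ne hrc, zero_smul]
    rwa [map_one] at h2
  obtain ⟨i, k₀, hw⟩ := h1
  set w := θ (Pi.single i (Matrix.single k₀ k₀ 1)) u with hw_def
  have hww : θ (Pi.single i (Matrix.single k₀ k₀ 1)) w = w := by
    rw [hw_def, ← Module.End.mul_apply, ← map_mul, mul_piSingle]
    simp
  clear_value w
  let col : (Fin (d i) → ℂ) →ₗ[ℂ] Matrix (Fin (d i)) (Fin (d i)) ℂ :=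
    { toFun := fun x => Matrix.vecMulVec x (Pi.single k₀ 1)
      map_add' := fun x y => Matrix.add_vecMulVec x y _
      map_smul' := fun c x => Matrix.smul_vecMulVec c x _ }
  -- The column `x` is placed as column `k₀` of block `i` and applied to `w`. If `x r ≠ 0`, the unit
  -- `(k₀, r)` carries `ψ x` to a nonzero multiple of `w`, whence injectivity.
  let ψ : (Fin (d i) → ℂ) →ₗ[ℂ] V := LinearMap.applyₗ w ∘ₗ θ.toLinearMap ∘ₗ
    LinearMap.single ℂ (fun i => Matrix (Fin (d i)) (Fin (d i)) ℂ) i ∘ₗ col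
  have hψ : ∀ x, ψ x = θ (Pi.single i (Matrix.vecMulVec x (Pi.single k₀ 1))) w := fun x => rfl
  have hcol : Matrix.vecMulVec (Pi.single k₀ 1) (Pi.single k₀ 1) =
      (Matrix.single k₀ k₀ 1 : Matrix (Fin (d i)) (Fin (d i)) ℂ) := by
    ext r c
    simp [Matrix.vecMulVec_apply, Matrix.single_apply, Pi.single_apply, ite_and, eq_comm]
    split_ifs <;> rfl
  have hψk : ψ (Pi.single k₀ 1) = w := by rw [hψ, hcol, hww]
  have heq : ∀ b x, ψ ((b i).mulVec x) = θ b (ψ x) := by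
    intro b x
    rw [hψ, hψ, ← Module.End.mul_apply, ← map_mul, mul_piSingle, Matrix.mul_vecMulVec]
  have hinj : Function.Injective ψ := by
    rw [injective_iff_map_eq_zero]
    intro x hx
    by_contra hne
    obtain ⟨r, hr⟩ := Function.ne_iff.mp hne
    have h2 := heq (Pi.single i (Matrix.single k₀ r 1)) x
    rw [hx, map_zero, Pi.single_eq_same, Matrix.single_mulVec, one_mul] at h2
    have h3 : (Pi.single k₀ (x r) : Fin (d i) → ℂ) = x r • Pi.single k₀ 1 := by
      rw [← Pi.single_smul, smul_eq_mul, mul_one]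
    have h4 : Function.update (0 : Fin (d i) → ℂ) k₀ (x r) = Pi.single k₀ (x r) := rfl
    rw [h4, h3, map_smul, hψk, smul_eq_zero] at h2
    exact h2.elim hr hw
  have hsurj : Function.Surjective ψ := by
    intro y
    obtain ⟨b, hb⟩ := hsimple w hw y
    exact ⟨(b i).mulVec (Pi.single k₀ 1), by rw [heq, hψk, hb]⟩
  let e := LinearEquiv.ofBijective ψ ⟨hinj, hsurj⟩
  refine ⟨i, e.symm, fun b x => ?_⟩
  apply e.injective
  rw [e.apply_symm_apply]
  change _ = ψ _
  rw [heq]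
  change _ = θ b (e (e.symm x))
  rw [e.apply_symm_apply]

end MatrixAlgebra

/-! ### Modules over a split semisimple algebra -/

section SplitAlgebra

variable {A G V F M : Type} [Ring A] [Algebra ℂ A] [Monoid G]
  [AddCommGroup V] [Module ℂ V] [AddCommGroup F] [Module ℂ F] [AddCommGroup M] [Module ℂ M]
  {k : ℕ} {d : Fin k → ℕ} [∀ i, NeZero (d i)] (e : A ≃ₐ[ℂ] PiMat d)

/-- The character of the simple module belonging to the `i`-th block. -/
def blockChar (i : Fin k) : A →ₗ[ℂ] ℂ :=
  Matrix.traceLinearMap (Fin (d i)) ℂ ℂ ∘ₗ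
    LinearMap.proj (φ := fun i => Matrix (Fin (d i)) (Fin (d i)) ℂ) i ∘ₗ e.toLinearMap

theorem blockChar_apply (i : Fin k) (a : A) : blockChar e i a = (e a i).trace := rfl

theorem blockChar_independent {c : Fin k → ℂ} (h : ∀ a, ∑ i, c i * blockChar e i a = 0) :
    c = 0 := by
  ext i
  have h1 := h (e.symm (Pi.single i (Matrix.single 0 0 1)))
  rw [Finset.sum_eq_single i (fun j _ hj => ?_) (by simp)] at h1
  · rw [blockChar_apply, e.apply_symm_apply, Pi.single_eq_same, Matrix.trace_single_eq_same,
      mul_one] at h1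
    exact h1
  · rw [blockChar_apply, e.apply_symm_apply, Pi.single_eq_of_ne hj, Matrix.trace_zero, mul_zero]

theorem trace_functional_eq_sum_blockChar (τ : A →ₗ[ℂ] ℂ) (hτ : ∀ a b, τ (a * b) = τ (b * a)) :
    ∃ c : Fin k → ℂ, ∀ a, τ a = ∑ i, c i * blockChar e i a := by
  obtain ⟨c, hc⟩ := trace_functional (τ ∘ₗ e.symm.toLinearMap) fun a b => by
    change τ (e.symm (a * b)) = τ (e.symm (b * a))
    rw [map_mul e.symm, hτ, map_mul e.symm]
  refine ⟨c, fun a => ?_⟩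
  have := hc (e a)
  change τ (e.symm (e a)) = _ at this
  rw [e.symm_apply_apply] at this
  exact this

theorem trace_mulLeft_mulRight_eq_sum_blockChar (x y : A) :
    LinearMap.trace ℂ _ (LinearMap.mulLeft ℂ x ∘ₗ LinearMap.mulRight ℂ y) =
      ∑ i, blockChar e i x * blockChar e i y := by
  have h := trace_mulLeft_mulRight_piMat (e x) (e y)
  rw [← LinearMap.trace_conj' _ e.toLinearEquiv]
  refine Eq.trans (congrArg _ ?_) h
  refine LinearMap.ext fun b => ?_
  change e (x * (e.symm b * y)) = e x * (b * e y)
  rw [map_mul, map_mul, e.apply_symm_apply]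

/-- The module `V` is isomorphic to the column module of the `i`-th block. -/
def IsColumn (θ : A →ₐ[ℂ] Module.End ℂ V) (i : Fin k) : Prop :=
  ∃ f : V ≃ₗ[ℂ] (Fin (d i) → ℂ), ∀ a x, f (θ a x) = (e a i).mulVec (f x)

theorem exists_isColumn (θ : A →ₐ[ℂ] Module.End ℂ V) {u : V} (hu : u ≠ 0)
    (hsimple : ∀ w : V, w ≠ 0 → ∀ x, ∃ a, θ a w = x) : ∃ i, IsColumn e θ i := by
  obtain ⟨i, f, hf⟩ := exists_equiv_column (θ.comp e.symm.toAlgHom) hu (fun w hw x => by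
    obtain ⟨a, ha⟩ := hsimple w hw x
    refine ⟨e a, ?_⟩
    change θ (e.symm (e a)) w = x
    rw [e.symm_apply_apply, ha])
  refine ⟨i, f, fun a x => ?_⟩
  rw [← hf]
  change _ = f (θ (e.symm (e a)) x)
  rw [e.symm_apply_apply]

variable {e}

theorem IsColumn.trace_eq {θ : A →ₐ[ℂ] Module.End ℂ V} {i : Fin k} (h : IsColumn e θ i) (a : A) :
    LinearMap.trace ℂ V (θ a) = blockChar e i a := by
  obtain ⟨f, hf⟩ := h
  rw [← LinearMap.trace_conj' _ f, blockChar_apply, ← Matrix.trace_toLin'_eq]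
  congr 1
  refine LinearMap.ext fun x => ?_
  change f (θ a (f.symm x)) = _
  rw [hf, f.apply_symm_apply, Matrix.toLin'_apply]

/-- The element `ε` is the rank one operator `x ↦ φ x • u` in block `i` and zero in the others.
Anything killing `u` kills its image. For `φ u = 1` it is a primitive idempotent. -/
theorem IsColumn.exists_rankOne {θ : A →ₐ[ℂ] Module.End ℂ V} {i : Fin k} (h : IsColumn e θ i)
    (u : V) (φ : Module.Dual ℂ V) :
    ∃ ε : A, (∀ x, θ ε x = φ x • u) ∧ (∀ a, θ a u = 0 → a * ε = 0) ∧
      (∀ j, blockChar e j ε = if j = i then φ u else 0) := by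
  obtain ⟨f, hf⟩ := h
  let w : Fin (d i) → ℂ := fun r => φ (f.symm (Pi.single r 1))
  have hw : ∀ x, w ⬝ᵥ f x = φ x := by
    intro x
    have h1 : x = ∑ r, f x r • f.symm (Pi.single r 1) := by
      rw [← f.symm_apply_apply x]
      simp only [f.apply_symm_apply, ← map_smul, ← map_sum]
      congr 1
      ext r
      simp [Finset.sum_apply, Pi.single_apply]
    conv_rhs => rw [h1]
    rw [map_sum]
    refine Finset.sum_congr rfl fun r _ => ?_
    rw [map_smul, smul_eq_mul, mul_comm]
  refine ⟨e.symm (Pi.single i (Matrix.vecMulVec (f u) w)), fun x => ?_, fun a ha => ?_, fun j => ?_⟩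
  · apply f.injective
    rw [hf, e.apply_symm_apply, Pi.single_eq_same, map_smul, Matrix.vecMulVec_mulVec, hw]
    ext r
    simp [mul_comm]
  · apply e.injective
    rw [map_mul, e.apply_symm_apply, map_zero, mul_piSingle, Matrix.mul_vecMulVec, ← hf, ha,
      map_zero, Matrix.zero_vecMulVec, Pi.single_zero]
  · rw [blockChar_apply, e.apply_symm_apply]
    split_ifs with hj
    · subst hj
      rw [Pi.single_eq_same, Matrix.trace_vecMulVec, dotProduct_comm, hw]
    · rw [Pi.single_eq_of_ne hj, Matrix.trace_zero]

variable (e)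

/-- The character of a module is the sum of the block characters, with multiplicities. -/
theorem trace_eq_sum_finrank_mul_blockChar [FiniteDimensional ℂ M] {s : G → A}
    (hs : Submodule.span ℂ (Set.range s) = ⊤)
    {rhoM : Representation ℂ G M} {θM : A →ₐ[ℂ] Module.End ℂ M} (hM : ∀ g, θM (s g) = rhoM g) :
    ∃ c : Fin k → ℂ, (∀ a, LinearMap.trace ℂ M (θM a) = ∑ i, c i * blockChar e i a) ∧
      ∀ (F : Type) [AddCommGroup F] [Module ℂ F] (rhoF : Representation ℂ G F)
        (θF : A →ₐ[ℂ] Module.End ℂ F) (i : Fin k), (∀ g, θF (s g) = rhoF g) → IsColumn e θF i →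
        c i = Module.finrank ℂ (Representation.IntertwiningMap rhoF rhoM) := by
  obtain ⟨c, hc⟩ := trace_functional_eq_sum_blockChar e
    (LinearMap.trace ℂ M ∘ₗ θM.toLinearMap) fun a b => by
      change LinearMap.trace ℂ M (θM (a * b)) = LinearMap.trace ℂ M (θM (b * a))
      rw [map_mul θM, map_mul θM, LinearMap.trace_mul_comm]
  refine ⟨c, hc, fun F _ _ rhoF θF i hF hi => ?_⟩
  obtain ⟨f, hf⟩ := id hi
  -- With this vector and coordinate, `ε` is the matrix unit `(0, 0)` of block `i`. Evaluating the
  -- character there isolates `c i`, and the same trace is the dimension of the Hom space.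
  let u : F := f.symm (Pi.single 0 1)
  let φ : Module.Dual ℂ F := LinearMap.proj 0 ∘ₗ f.toLinearMap
  have hfu : f u = Pi.single 0 1 := f.apply_symm_apply _
  have hφu : φ u = 1 := by
    change f u 0 = 1
    rw [hfu, Pi.single_eq_same]
  obtain ⟨ε, hε1, hε2, hε3⟩ := hi.exists_rankOne u φ
  have hgen : ∀ x, ∃ a, θF a u = x := by
    intro x
    refine ⟨e.symm (Pi.single i (Matrix.vecMulVec (f x) (Pi.single 0 1))), ?_⟩
    apply f.injective
    rw [hf, e.apply_symm_apply, Pi.single_eq_same, hfu, Matrix.vecMulVec_mulVec]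
    ext r
    simp
  have h1 := finrank_intertwiningMap_eq_trace hs hF hM hgen
    (ε := ε) (by rw [hε1, hφu, one_smul]) hε2
  have h2 := hc ε
  change LinearMap.trace ℂ M (θM ε) = _ at h2
  rw [h1, h2, Finset.sum_eq_single i (fun j _ hj => by rw [hε3, if_neg hj, mul_zero]) (by simp),
    hε3, if_pos rfl, hφu, mul_one]

end SplitAlgebra

/-! ### LU decomposition of generic matrices -/

theorem eventually_det_add_ne_zero {n : ℕ} (M : Matrix (Fin n) (Fin n) ℂ) :
    ∀ᶠ t : ℂ in Filter.cofinite, (M + t • (1 : Matrix (Fin n) (Fin n) ℂ)).det ≠ 0 := by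
  have h : ∀ t : ℂ, (M + t • (1 : Matrix (Fin n) (Fin n) ℂ)).det = (-M).charpoly.eval t := by
    intro t
    rw [Matrix.eval_charpoly, sub_neg_eq_add, add_comm, Matrix.scalar_apply,
      ← Matrix.smul_one_eq_diagonal]
  simp_rw [h]
  have hne : (-M).charpoly ≠ 0 := (Matrix.charpoly_monic _).ne_zero
  refine ((-M).charpoly.roots.toFinset.finite_toSet).subset fun t ht => ?_
  simp only [Set.mem_compl_iff, Set.mem_ofPred_eq, not_not] at ht
  simp [hne, ht]

/-- Lower triangular with ones on the diagonal. -/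
def IsLowerUni {n : ℕ} (L : Matrix (Fin n) (Fin n) ℂ) : Prop :=
  (∀ i j, i < j → L i j = 0) ∧ ∀ i, L i i = 1

theorem IsLowerUni.det_eq_one {n : ℕ} {L : Matrix (Fin n) (Fin n) ℂ} (h : IsLowerUni L) :
    L.det = 1 := by
  rw [Matrix.det_of_isLowerTriangular L (fun i j hij => h.1 i j hij)]
  exact Finset.prod_eq_one fun i _ => h.2 i

/-- Induction on the size: for all but finitely many `t` the leading block of the shifted matrix is
both factored and invertible, and a bordering step then completes the factorization. -/
theorem eventually_exists_LU {n : ℕ} (M : Matrix (Fin n) (Fin n) ℂ) :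
    ∀ᶠ t : ℂ in Filter.cofinite, ∃ L U : Matrix (Fin n) (Fin n) ℂ,
      IsLowerUni L ∧ U.BlockTriangular id ∧ M + t • (1 : Matrix (Fin n) (Fin n) ℂ) = L * U := by
  induction n with
  | zero =>
    exact Filter.Eventually.of_forall fun t => ⟨1, 1, ⟨fun i => i.elim0, fun i => i.elim0⟩,
      fun i => i.elim0, by ext i; exact i.elim0⟩
  | succ n ih =>
    let M' := M.submatrix Fin.castSucc Fin.castSucc
    filter_upwards [ih M', eventually_det_add_ne_zero M'] with t ⟨L', U', hL, hU, hLU⟩ hdet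
    have hLdet : IsUnit L'.det := by rw [hL.det_eq_one]; exact isUnit_one
    have hUdet : IsUnit U'.det := by
      rw [hLU, Matrix.det_mul] at hdet
      exact (right_ne_zero_of_mul hdet).isUnit
    -- The new row and column solve `l U' = ` last row and `L' y = ` last column; the corner of the
    -- upper factor is the Schur complement.
    let l : Fin n → ℂ := Matrix.vecMul (fun j => M (Fin.last n) j.castSucc) U'⁻¹
    let y : Fin n → ℂ := Matrix.mulVec L'⁻¹ (fun i => M i.castSucc (Fin.last n))
    have hl : ∀ j, ∑ x, l x * U' x j = M (Fin.last n) j.castSucc := by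
      intro j
      have : Matrix.vecMul l U' = fun j => M (Fin.last n) j.castSucc := by
        rw [Matrix.vecMul_vecMul, Matrix.nonsing_inv_mul _ hUdet, Matrix.vecMul_one]
      exact congrFun this j
    have hy : ∀ i, ∑ x, L' i x * y x = M i.castSucc (Fin.last n) := by
      intro i
      have : Matrix.mulVec L' y = fun i => M i.castSucc (Fin.last n) := by
        rw [Matrix.mulVec_mulVec, Matrix.mul_nonsing_inv _ hLdet, Matrix.one_mulVec]
      exact congrFun this i
    have hLU' : ∀ i j, ∑ x, L' i x * U' x j =
        M i.castSucc j.castSucc + t * (1 : Matrix (Fin n) (Fin n) ℂ) i j := fun i j =>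
      (congrFun (congrFun hLU i) j).symm
    refine ⟨Matrix.of fun i j => Fin.lastCases (motive := fun _ => ℂ)
        (Fin.lastCases (motive := fun _ => ℂ) 1 l j)
        (fun i => Fin.lastCases (motive := fun _ => ℂ) 0 (L' i) j) i,
      Matrix.of fun i j => Fin.lastCases (motive := fun _ => ℂ)
        (Fin.lastCases (motive := fun _ => ℂ)
          (M (Fin.last n) (Fin.last n) + t - ∑ x, l x * y x) (fun _ => 0) j)
        (fun i => Fin.lastCases (motive := fun _ => ℂ) (y i) (U' i) j) i, ⟨?_, ?_⟩, ?_, ?_⟩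
    · intro i j hij
      induction i using Fin.lastCases with
      | last => exact absurd hij (Fin.le_last j).not_gt
      | cast i =>
        induction j using Fin.lastCases with
        | last => simp
        | cast j => simpa using hL.1 i j (by simpa using hij)
    · intro i
      induction i using Fin.lastCases with
      | last => simp
      | cast i => simpa using hL.2 i
    · intro i j hij
      change j < i at hij
      induction j using Fin.lastCases with
      | last => exact absurd hij (Fin.le_last i).not_gt
      | cast j =>
        induction i using Fin.lastCases with
        | last => simp
        | cast i => simpa using hU (show id j < id i by simpa using hij)
    · ext i j
      rw [Matrix.mul_apply, Fin.sum_univ_castSucc]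
      induction i using Fin.lastCases with
      | last =>
        induction j using Fin.lastCases with
        | last => simp
        | cast j => simp [hl, (Fin.castSucc_lt_last j).ne']
      | cast i =>
        induction j using Fin.lastCases with
        | last => simp [hy, (Fin.castSucc_lt_last i).ne]
        | cast j => simp [hLU', Matrix.one_apply]

/-! ### Highest weight vectors -/

section HighestWeight

variable {n : ℕ} {V : Type} [AddCommGroup V] [Module ℂ V]

/-- All matrix coefficients are polynomials in the matrix entries. -/
def IsPoly (rho : Representation ℂ (Matrix.GeneralLinearGroup (Fin n) ℂ) V) : Prop :=
  ∀ (phi : Module.Dual ℂ V) (v : V), ∃ p : MvPolynomial (Fin n × Fin n) ℂ,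
    ∀ g : Matrix.GeneralLinearGroup (Fin n) ℂ,
      phi (rho g v) = polyFun p (g : Matrix (Fin n) (Fin n) ℂ)

/-- The vector `v` is scaled by upper triangular matrices according to the weight `w`. -/
def IsHighestVec (rho : Representation ℂ (Matrix.GeneralLinearGroup (Fin n) ℂ) V)
    (w : Fin n → ℕ) (v : V) : Prop :=
  ∀ b : Matrix.GeneralLinearGroup (Fin n) ℂ, (b : Matrix (Fin n) (Fin n) ℂ).BlockTriangular id →
    rho b v = (∏ i, (b : Matrix (Fin n) (Fin n) ℂ) i i ^ w i) • v

theorem continuous_polyFun_comp {T : Type} [TopologicalSpace T]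
    (p : MvPolynomial (Fin n × Fin n) ℂ) {X : T → Matrix (Fin n) (Fin n) ℂ}
    (hX : ∀ i j, Continuous fun t => X t i j) : Continuous fun t => polyFun p (X t) := by
  unfold polyFun
  exact (MvPolynomial.continuous_eval p).comp (continuous_pi fun ij => hX ij.1 ij.2)

theorem eq_of_eventually_cofinite {f g : ℂ → ℂ} (hf : Continuous f) (hg : Continuous g)
    (h : ∀ᶠ t in Filter.cofinite, f t = g t) (t : ℂ) : f t = g t := by
  have hd : Dense {t : ℂ | f t = g t} := by
    have h1 : ({t : ℂ | f t = g t}ᶜ).Finite := h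
    simpa using h1.countable.dense_compl ℂ
  exact congrFun (hf.ext_on hd hg fun t ht => ht) t

/-- A generic matrix is `L * U`, and `U` only rescales `v`, so a functional killing every `rho L v`
kills it there. Its value is polynomial along the line `g + t • 1`, so it vanishes at `t = 0` as
well. -/
theorem mem_span_lowerUni {rho : Representation ℂ (Matrix.GeneralLinearGroup (Fin n) ℂ) V}
    (hrho : IsPoly rho) {w : Fin n → ℕ} {v : V} (hv : IsHighestVec rho w v)
    (g : Matrix.GeneralLinearGroup (Fin n) ℂ) :
    rho g v ∈ Submodule.span ℂ (Set.range fun L : {L : Matrix.GeneralLinearGroup (Fin n) ℂ //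
      IsLowerUni (L : Matrix (Fin n) (Fin n) ℂ)} => rho L.1 v) := by
  by_contra hg
  obtain ⟨φ, hφg, hφ⟩ := Submodule.exists_le_ker_of_notMem hg
  obtain ⟨p, hp⟩ := hrho φ v
  apply hφg
  rw [hp]
  have h1 := eq_of_eventually_cofinite (f := fun t => polyFun p
    ((g : Matrix (Fin n) (Fin n) ℂ) + t • (1 : Matrix (Fin n) (Fin n) ℂ))) (g := fun _ => 0)
    (continuous_polyFun_comp p fun i j => by
      simp only [Matrix.add_apply, Matrix.smul_apply]
      fun_prop) continuous_const ?_ 0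
  · simpa using h1
  filter_upwards [eventually_exists_LU (g : Matrix (Fin n) (Fin n) ℂ),
    eventually_det_add_ne_zero (g : Matrix (Fin n) (Fin n) ℂ)] with t ⟨L, U, hL, hU, hLU⟩ hdet
  have hUdet : U.det ≠ 0 := by
    rw [hLU, Matrix.det_mul] at hdet
    exact right_ne_zero_of_mul hdet
  let L' := Matrix.GeneralLinearGroup.mkOfDetNeZero L (by rw [hL.det_eq_one]; exact one_ne_zero)
  let U' := Matrix.GeneralLinearGroup.mkOfDetNeZero U hUdet
  have h2 : φ (rho (L' * U') v) = 0 := by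
    rw [map_mul, Module.End.mul_apply, hv U' hU, map_smul, map_smul]
    have h3 : φ (rho L' v) = 0 := hφ (Submodule.subset_span ⟨⟨L', hL⟩, rfl⟩)
    rw [h3, smul_zero]
  rw [hp] at h2
  rw [hLU]
  exact h2

/-- A highest weight vector in the module generated by a highest weight vector `v` whose weight is
not smaller than that of `v`, as tested by a strictly decreasing cocharacter, is a multiple of `v`,
and vanishes unless the weights agree. -/
theorem highestVec_eq_smul {rho : Representation ℂ (Matrix.GeneralLinearGroup (Fin n) ℂ) V}
    (hrho : IsPoly rho) {w w' : Fin n → ℕ} {v v' : V} (hv : IsHighestVec rho w v)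
    (hv' : IsHighestVec rho w' v')
    (hmem : v' ∈ Submodule.span ℂ
      (Set.range fun g : Matrix.GeneralLinearGroup (Fin n) ℂ => rho g v))
    {a : Fin n → ℕ} (ha : StrictAnti a) (hle : ∑ i, a i * w i ≤ ∑ i, a i * w' i) :
    ∃ c : ℂ, v' = ((0 : ℂ) ^ (∑ i, a i * w' i - ∑ i, a i * w i) * c) • v := by
  have hmem' : v' ∈ Submodule.span ℂ (Set.range fun L :
      {L : Matrix.GeneralLinearGroup (Fin n) ℂ //
        IsLowerUni (L : Matrix (Fin n) (Fin n) ℂ)} => rho L.1 v) := by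
    refine (Submodule.span_le.mpr ?_) hmem
    rintro _ ⟨g, rfl⟩
    exact mem_span_lowerUni hrho hv g
  obtain ⟨c, hc⟩ := Finsupp.mem_span_range_iff_exists_finsupp.mp hmem'
  refine ⟨∑ L ∈ c.support, c L, ?_⟩
  rw [← sub_eq_zero, ← Module.forall_dual_apply_eq_zero_iff ℂ]
  intro φ
  rw [map_sub, map_smul, sub_eq_zero, smul_eq_mul]
  obtain ⟨p, hp⟩ := hrho φ v
  -- This is the conjugate of `L` by the torus element with entries `z⁻¹ ^ a i`. Below the diagonal
  -- the exponents of `z` are positive because `a` is strictly decreasing, so at `z = 0` it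
  -- degenerates to the identity.
  let sc : Matrix (Fin n) (Fin n) ℂ → ℂ → Matrix (Fin n) (Fin n) ℂ := fun L z =>
    Matrix.of fun i j => L i j * z ^ (a j - a i)
  set N := ∑ i, a i * w' i - ∑ i, a i * w i with hN
  -- The torus action gives the identity for `z ≠ 0`; both sides are continuous, so `z = 0` is
  -- allowed, and there only `v` itself remains.
  have key : ∀ z : ℂ, φ v' = z ^ N * ∑ L ∈ c.support, c L * polyFun p (sc L.1 z) := by
    refine eq_of_eventually_cofinite continuous_const ?_ ?_
    · refine (continuous_pow N).mul (continuous_finsetSum _ fun L _ =>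
        continuous_const.mul (continuous_polyFun_comp p fun i j => ?_))
      exact continuous_const.mul (continuous_pow _)
    · have h0 : ∀ᶠ z : ℂ in Filter.cofinite, z ≠ 0 := by
        simp
      filter_upwards [h0] with z hz
      have hs : z⁻¹ ≠ 0 := inv_ne_zero hz
      let T : Matrix (Fin n) (Fin n) ℂ := Matrix.diagonal fun i => z⁻¹ ^ a i
      have hTdet : T.det ≠ 0 := by
        rw [Matrix.det_diagonal]
        exact Finset.prod_ne_zero_iff.mpr fun i _ => pow_ne_zero _ hs
      let τ := Matrix.GeneralLinearGroup.mkOfDetNeZero T hTdet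
      have hT : T.BlockTriangular id := Matrix.blockTriangular_diagonal _
      have hprod : ∀ w : Fin n → ℕ, ∏ i, T i i ^ w i = z⁻¹ ^ (∑ i, a i * w i) := by
        intro w
        rw [← Finset.prod_pow_eq_pow_sum]
        refine Finset.prod_congr rfl fun i _ => ?_
        rw [show T i i = z⁻¹ ^ a i from Matrix.diagonal_apply_eq _ _, pow_mul]
      have h1 : rho τ v' = z⁻¹ ^ (∑ i, a i * w' i) • v' := by
        rw [hv' τ hT]
        exact congrArg (· • v') (hprod w')
      have h2 : rho τ v = z⁻¹ ^ (∑ i, a i * w i) • v := by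
        rw [hv τ hT]
        exact congrArg (· • v) (hprod w)
      have h3 : ∀ L : {L : Matrix.GeneralLinearGroup (Fin n) ℂ //
          IsLowerUni (L : Matrix (Fin n) (Fin n) ℂ)},
          φ (rho τ (rho L.1 v)) = z⁻¹ ^ (∑ i, a i * w i) * polyFun p (sc L.1 z) := by
        intro L
        have hdet : (sc L.1 z).det ≠ 0 := by
          have : IsLowerUni (sc L.1 z) := by
            refine ⟨fun i j hij => ?_, fun i => ?_⟩
            · simp [sc, L.2.1 i j hij]
            · simp [sc, L.2.2 i]
          rw [this.det_eq_one]
          exact one_ne_zero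
        let L' := Matrix.GeneralLinearGroup.mkOfDetNeZero (sc L.1 z) hdet
        have hcomm : τ * L.1 = L' * τ := by
          apply Units.ext
          ext i j
          change (T * (L.1 : Matrix (Fin n) (Fin n) ℂ)) i j = (sc L.1 z * T) i j
          rw [Matrix.diagonal_mul, Matrix.mul_diagonal]
          change _ = (L.1 : Matrix (Fin n) (Fin n) ℂ) i j * z ^ (a j - a i) * z⁻¹ ^ a j
          rcases lt_or_ge i j with hij | hij
          · rw [L.2.1 i j hij]
            ring
          · have hle : a i ≤ a j := ha.antitone hij
            have : z⁻¹ ^ a j = z⁻¹ ^ (a j - a i) * z⁻¹ ^ a i := by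
              rw [← pow_add, Nat.sub_add_cancel hle]
            rw [this]
            have hz1 : z ^ (a j - a i) * z⁻¹ ^ (a j - a i) = 1 := by
              rw [← mul_pow, mul_inv_cancel₀ hz, one_pow]
            linear_combination
              (-(L.1 : Matrix (Fin n) (Fin n) ℂ) i j * z⁻¹ ^ a i) * hz1
        rw [← Module.End.mul_apply, ← map_mul, hcomm, map_mul, Module.End.mul_apply, h2, map_smul,
          map_smul, hp, smul_eq_mul]
        rfl
      have h4 : φ (rho τ v') = z⁻¹ ^ (∑ i, a i * w i) *
          ∑ L ∈ c.support, c L * polyFun p (sc L.1 z) := by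
        rw [← hc, Finsupp.sum, map_sum, map_sum, Finset.mul_sum]
        refine Finset.sum_congr rfl fun L _ => ?_
        rw [map_smul, map_smul, h3, smul_eq_mul]
        ring
      rw [h1, map_smul, smul_eq_mul] at h4
      have h5 : z⁻¹ ^ (∑ i, a i * w' i) = z⁻¹ ^ N * z⁻¹ ^ (∑ i, a i * w i) := by
        rw [← pow_add, hN, Nat.sub_add_cancel hle]
      rw [h5] at h4
      have h6 : z⁻¹ ^ N * φ v' = ∑ L ∈ c.support, c L * polyFun p (sc L.1 z) := by
        apply mul_left_cancel₀ (pow_ne_zero (∑ i, a i * w i) hs)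
        rw [← h4]
        ring
      rw [← h6, ← mul_assoc, ← mul_pow, mul_inv_cancel₀ hz, one_pow, one_mul]
  rw [key 0, mul_assoc]
  congr 1
  rw [Finset.sum_mul]
  refine Finset.sum_congr rfl fun L _ => ?_
  congr 1
  have h1 : sc L.1 0 = ((1 : Matrix.GeneralLinearGroup (Fin n) ℂ) : Matrix (Fin n) (Fin n) ℂ) := by
    ext i j
    change (L.1 : Matrix (Fin n) (Fin n) ℂ) i j * 0 ^ (a j - a i) = (1 : Matrix _ _ ℂ) i j
    rcases lt_trichotomy i j with hij | hij | hij
    · rw [L.2.1 i j hij, zero_mul, Matrix.one_apply_ne hij.ne]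
    · subst hij
      simp [L.2.2 i]
    · rw [zero_pow (Nat.sub_pos_of_lt (ha hij)).ne', mul_zero, Matrix.one_apply_ne hij.ne']
  rw [h1, ← hp, map_one]
  rfl

end HighestWeight

/-! ### Irreducible representations and their highest weights -/

section Irreducible

variable {G V : Type} [Group G] [AddCommGroup V] [Module ℂ V] {rho : Representation ℂ G V}

theorem eq_bot_or_eq_top_of_isIrreducible (h : rho.IsIrreducible) (U : Submodule ℂ V)
    (hU : ∀ g, ∀ x ∈ U, rho g x ∈ U) : U = ⊥ ∨ U = ⊤ := by
  let s : Subrepresentation rho := ⟨U, fun g x hx => hU g x hx⟩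
  rcases h.eq_bot_or_eq_top s with hs | hs
  · exact Or.inl (congrArg Subrepresentation.toSubmodule hs)
  · exact Or.inr (congrArg Subrepresentation.toSubmodule hs)

theorem isIrreducible_of_forall_submodule {v : V} (hv : v ≠ 0)
    (h : ∀ U : Submodule ℂ V, (∀ g, ∀ x ∈ U, rho g x ∈ U) → U = ⊥ ∨ U = ⊤) :
    rho.IsIrreducible := by
  refine { exists_pair_ne := ⟨⊥, ⊤, fun hbt => hv ?_⟩, eq_bot_or_eq_top := fun s => ?_ }
  · have h' : (⊥ : Submodule ℂ V) = ⊤ := congrArg Subrepresentation.toSubmodule hbt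
    have : v ∈ (⊥ : Submodule ℂ V) := h' ▸ Submodule.mem_top
    simpa using this
  · rcases h s.toSubmodule fun g x hx => s.apply_mem_toSubmodule g hx with hs | hs
    · exact Or.inl (Subrepresentation.toSubmodule_injective hs)
    · exact Or.inr (Subrepresentation.toSubmodule_injective hs)

theorem map_mem_span_orbit (rho : Representation ℂ G V) (v : V) (g : G) {x : V}
    (hx : x ∈ Submodule.span ℂ (Set.range fun g => rho g v)) :
    rho g x ∈ Submodule.span ℂ (Set.range fun g => rho g v) := by
  have hle : Submodule.span ℂ (Set.range fun g => rho g v) ≤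
      (Submodule.span ℂ (Set.range fun g => rho g v)).comap (rho g) := by
    rw [Submodule.span_le]
    rintro _ ⟨h, rfl⟩
    refine Submodule.subset_span ⟨g * h, ?_⟩
    simp
  exact hle hx

theorem mem_span_orbit (rho : Representation ℂ G V) (v : V) :
    v ∈ Submodule.span ℂ (Set.range fun g => rho g v) :=
  Submodule.subset_span ⟨1, by simp⟩

theorem span_orbit_eq_top (h : rho.IsIrreducible) {v : V} (hv : v ≠ 0) :
    Submodule.span ℂ (Set.range fun g => rho g v) = ⊤ := by
  refine (eq_bot_or_eq_top_of_isIrreducible h _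
    fun g x hx => map_mem_span_orbit rho v g hx).resolve_left fun hb => hv ?_
  have := mem_span_orbit rho v
  rw [hb] at this
  simpa using this

end Irreducible

/-! ### Uniqueness of highest weights and of irreducible representations -/

section HighestWeight

variable {n : ℕ} {V : Type} [AddCommGroup V] [Module ℂ V]
  {rho : Representation ℂ (Matrix.GeneralLinearGroup (Fin n) ℂ) V}

/-- The highest weight of an irreducible polynomial representation is unique. -/
theorem highestWeight_unique (hrho : IsPoly rho) (hirr : rho.IsIrreducible) {w w' : Fin n → ℕ}
    {v v' : V} (hv : IsHighestVec rho w v) (hv0 : v ≠ 0) (hv' : IsHighestVec rho w' v')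
    (hv0' : v' ≠ 0) : w = w' := by
  -- If one pairing were strictly larger, its highest vector would carry a positive power of `0`,
  -- hence be zero.
  have key : ∀ a : Fin n → ℕ, StrictAnti a → ∑ i, a i * w i = ∑ i, a i * w' i := by
    intro a ha
    by_contra hne
    rcases lt_or_gt_of_ne hne with h | h
    · obtain ⟨c, hc⟩ := highestVec_eq_smul hrho hv hv'
        (by rw [span_orbit_eq_top hirr hv0]; trivial) ha h.le
      rw [zero_pow (Nat.sub_pos_of_lt h).ne', zero_mul, zero_smul] at hc
      exact hv0' hc
    · obtain ⟨c, hc⟩ := highestVec_eq_smul hrho hv' hv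
        (by rw [span_orbit_eq_top hirr hv0']; trivial) ha h.le
      rw [zero_pow (Nat.sub_pos_of_lt h).ne', zero_mul, zero_smul] at hc
      exact hv0 hc
  ext r
  -- The two strictly decreasing test vectors differ by one in coordinate `r` only, so subtracting
  -- the two equalities gives `w r = w' r`.
  have h1 := key (fun i => (n - i) + if i ≤ r then 1 else 0) fun i j hij => by
    have : (i : ℕ) < j := hij
    have := j.2
    simp only [Fin.le_def]
    split_ifs <;> omega
  have h2 := key (fun i => (n - i) + if i < r then 1 else 0) fun i j hij => by
    have : (i : ℕ) < j := hij
    have := j.2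
    simp only [Fin.lt_def]
    split_ifs <;> omega
  have h3 : ∀ w : Fin n → ℕ, ∑ i : Fin n, ((n - i) + if i ≤ r then 1 else 0) * w i =
      (∑ i : Fin n, ((n - i) + if i < r then 1 else 0) * w i) + w r := by
    intro w
    have h4 : w r = ∑ i, if i = r then w i else 0 := by simp
    rw [h4, ← Finset.sum_add_distrib]
    refine Finset.sum_congr rfl fun i _ => ?_
    rcases lt_trichotomy i r with hi | hi | hi
    · rw [if_pos hi.le, if_pos hi, if_neg hi.ne, add_zero]
    · subst hi
      rw [if_pos le_rfl, if_neg (lt_irrefl _), if_pos rfl]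
      ring
    · rw [if_neg hi.not_ge, if_neg hi.not_gt, if_neg hi.ne', add_zero, add_zero]
  rw [h3, h3, h2] at h1
  exact Nat.add_left_cancel h1

theorem HighestWeightIrrep.isPoly {w : Fin n → ℕ} (E : HighestWeightIrrep n w) : IsPoly E.rho :=
  E.isPolynomial

theorem IsPoly.prod {V' : Type} [AddCommGroup V'] [Module ℂ V']
    {rho' : Representation ℂ (Matrix.GeneralLinearGroup (Fin n) ℂ) V'} (h : IsPoly rho)
    (h' : IsPoly rho') : IsPoly (rho.prod rho') := by
  intro φ v
  obtain ⟨p, hp⟩ := h (φ ∘ₗ LinearMap.inl ℂ V V') v.1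
  obtain ⟨p', hp'⟩ := h' (φ ∘ₗ LinearMap.inr ℂ V V') v.2
  refine ⟨p + p', fun g => ?_⟩
  rw [polyFun_add, ← hp, ← hp', LinearMap.comp_apply, LinearMap.comp_apply, ← map_add]
  congr 1
  simp [Representation.prod]

/-- The irreducible polynomial representation with a given highest weight is unique up to
isomorphism. -/
theorem HighestWeightIrrep.exists_equiv {w : Fin n → ℕ} (E E' : HighestWeightIrrep n w) :
    ∃ f : E.V ≃ₗ[ℂ] E'.V, ∀ g x, f (E.rho g x) = E'.rho g (f x) := by
  obtain ⟨v, hv0, hv⟩ := E.exists_highestWeightVector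
  obtain ⟨v', hv0', hv'⟩ := E'.exists_highestWeightVector
  let R := E.rho.prod E'.rho
  have hR : ∀ g x, R g x = (E.rho g x.1, E'.rho g x.2) := fun _ _ => rfl
  have hpoly : IsPoly R := E.isPoly.prod E'.isPoly
  have hvv : IsHighestVec R w (v, v') := fun b hb => by
    rw [hR, hv b hb, hv' b hb]
    rfl
  -- The submodule generated by `(v, v')` turns out to be the graph of the isomorphism.
  let M := Submodule.span ℂ (Set.range fun g => R g (v, v'))
  have hM : ∀ g x, x ∈ M → R g x ∈ M := fun g x hx => map_mem_span_orbit R _ g hx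
  have hvM : (v, v') ∈ M := mem_span_orbit R _
  have ha : StrictAnti fun i : Fin n => n - (i : ℕ) := fun i j hij => by
    have : (i : ℕ) < j := hij
    have := j.2
    dsimp only
    omega
  -- Otherwise irreducibility puts `(0, v')` in `M`. It is a highest vector of the same weight as
  -- the generator, hence a multiple of `(v, v')`, which is impossible as `v` and `v'` are nonzero.
  have h1 : ∀ x, (0, x) ∈ M → x = 0 := by
    let K : Submodule ℂ E'.V := M.comap (LinearMap.inr ℂ E.V E'.V)
    have hK : K = ⊥ := by
      refine (eq_bot_or_eq_top_of_isIrreducible E'.isIrreducible K fun g x hx => ?_).resolve_right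
        fun ht => ?_
      · have := hM g _ hx
        rw [hR] at this
        simpa [K] using this
      · have hmem : ((0 : E.V), v') ∈ M := by
          have : v' ∈ K := by rw [ht]; trivial
          exact this
        obtain ⟨c, hc⟩ := highestVec_eq_smul hpoly hvv (v' := (0, v')) (w' := w)
          (fun b hb => by rw [hR, hv' b hb]; simp) hmem ha le_rfl
        have hc1 := congrArg Prod.fst hc
        have hc2 := congrArg Prod.snd hc
        rw [Prod.smul_fst] at hc1
        rw [Prod.smul_snd] at hc2
        have hc0 := (smul_eq_zero.mp hc1.symm).resolve_right hv0
        rw [hc0, zero_smul] at hc2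
        exact hv0' hc2
    intro x hx
    have : x ∈ K := hx
    rw [hK] at this
    simpa using this
  have h2 : ∀ x, (x, 0) ∈ M → x = 0 := by
    let K : Submodule ℂ E.V := M.comap (LinearMap.inl ℂ E.V E'.V)
    have hK : K = ⊥ := by
      refine (eq_bot_or_eq_top_of_isIrreducible E.isIrreducible K fun g x hx => ?_).resolve_right
        fun ht => ?_
      · have := hM g _ hx
        rw [hR] at this
        simpa [K] using this
      · have hmem : (v, (0 : E'.V)) ∈ M := by
          have : v ∈ K := by rw [ht]; trivial
          exact this
        obtain ⟨c, hc⟩ := highestVec_eq_smul hpoly hvv (v' := (v, 0)) (w' := w)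
          (fun b hb => by rw [hR, hv b hb]; simp) hmem ha le_rfl
        have hc1 := congrArg Prod.snd hc
        have hc2 := congrArg Prod.fst hc
        rw [Prod.smul_snd] at hc1
        rw [Prod.smul_fst] at hc2
        have hc0 := (smul_eq_zero.mp hc1.symm).resolve_right hv0'
        rw [hc0, zero_smul] at hc2
        exact hv0 hc2
    intro x hx
    have : x ∈ K := hx
    rw [hK] at this
    simpa using this
  let p1 : M →ₗ[ℂ] E.V := LinearMap.fst ℂ E.V E'.V ∘ₗ M.subtype
  let p2 : M →ₗ[ℂ] E'.V := LinearMap.snd ℂ E.V E'.V ∘ₗ M.subtype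
  have hp1 : Function.Bijective p1 := by
    constructor
    · rw [injective_iff_map_eq_zero]
      rintro ⟨⟨x, y⟩, hxy⟩ h
      change x = 0 at h
      subst h
      have := h1 y hxy
      subst this
      rfl
    · rw [← LinearMap.range_eq_top]
      refine (eq_bot_or_eq_top_of_isIrreducible E.isIrreducible _ ?_).resolve_left fun hb => ?_
      · rintro g _ ⟨x, rfl⟩
        exact ⟨⟨R g x.1, hM g _ x.2⟩, rfl⟩
      · have : v ∈ LinearMap.range p1 := ⟨⟨_, hvM⟩, rfl⟩
        rw [hb] at this
        exact hv0 (by simpa using this)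
  have hp2 : Function.Bijective p2 := by
    constructor
    · rw [injective_iff_map_eq_zero]
      rintro ⟨⟨x, y⟩, hxy⟩ h
      change y = 0 at h
      subst h
      have := h2 x hxy
      subst this
      rfl
    · rw [← LinearMap.range_eq_top]
      refine (eq_bot_or_eq_top_of_isIrreducible E'.isIrreducible _ ?_).resolve_left fun hb => ?_
      · rintro g _ ⟨x, rfl⟩
        exact ⟨⟨R g x.1, hM g _ x.2⟩, rfl⟩
      · have : v' ∈ LinearMap.range p2 := ⟨⟨_, hvM⟩, rfl⟩
        rw [hb] at this
        exact hv0' (by simpa using this)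
  let e1 := LinearEquiv.ofBijective p1 hp1
  let e2 := LinearEquiv.ofBijective p2 hp2
  refine ⟨e1.symm.trans e2, fun g x => ?_⟩
  obtain ⟨y, rfl⟩ := e1.surjective x
  have hy : E.rho g (e1 y) = e1 ⟨R g y.1, hM g _ y.2⟩ := rfl
  rw [hy, LinearEquiv.trans_apply, LinearEquiv.trans_apply, e1.symm_apply_apply,
    e1.symm_apply_apply]
  rfl

/-- The scalar matrix `z` as an element of the general linear group. -/
def scalarGL (n : ℕ) (z : ℂˣ) : Matrix.GeneralLinearGroup (Fin n) ℂ :=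
  Units.map (Matrix.scalar (Fin n)).toMonoidHom z

theorem scalarGL_val (z : ℂˣ) :
    (scalarGL n z : Matrix (Fin n) (Fin n) ℂ) = Matrix.scalar (Fin n) (z : ℂ) := rfl

theorem scalarGL_mul_apply (z : ℂˣ) (g : Matrix.GeneralLinearGroup (Fin n) ℂ) (i j : Fin n) :
    ((scalarGL n z * g : Matrix.GeneralLinearGroup (Fin n) ℂ) : Matrix (Fin n) (Fin n) ℂ) i j =
      z * (g : Matrix (Fin n) (Fin n) ℂ) i j := by
  rw [Units.val_mul, scalarGL_val, Matrix.scalar_apply, Matrix.diagonal_mul]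

/-- Scalar matrices act through a power of the scalar. -/
theorem HighestWeightIrrep.rho_scalarGL {w : Fin n → ℕ} (E : HighestWeightIrrep n w) (z : ℂˣ)
    (x : E.V) : E.rho (scalarGL n z) x = (z : ℂ) ^ (∑ i, w i) • x := by
  obtain ⟨v, hv0, hv⟩ := E.exists_highestWeightVector
  let U : Submodule ℂ E.V :=
    LinearMap.ker (E.rho (scalarGL n z) - (z : ℂ) ^ (∑ i, w i) • LinearMap.id)
  have hU : ∀ x, x ∈ U ↔ E.rho (scalarGL n z) x = (z : ℂ) ^ (∑ i, w i) • x := by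
    intro x
    rw [LinearMap.mem_ker, LinearMap.sub_apply, sub_eq_zero]
    rfl
  have hvU : v ∈ U := by
    rw [hU, hv _ (by rw [scalarGL_val]; exact Matrix.blockTriangular_diagonal _)]
    congr 1
    rw [← Finset.prod_pow_eq_pow_sum]
    refine Finset.prod_congr rfl fun i _ => ?_
    rw [scalarGL_val, Matrix.scalar_apply, Matrix.diagonal_apply_eq]
  have hT : U = ⊤ := by
    refine (eq_bot_or_eq_top_of_isIrreducible E.isIrreducible U fun g x hx => ?_).resolve_left
      fun hb => ?_
    · rw [hU] at hx ⊢
      have hcomm : scalarGL n z * g = g * scalarGL n z := by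
        apply Units.ext
        exact (Matrix.scalar_commute (z : ℂ) (fun _ => mul_comm _ _) _).eq
      rw [← Module.End.mul_apply, ← map_mul, hcomm, map_mul, Module.End.mul_apply, hx, map_smul]
    · rw [hb] at hvU
      exact hv0 (by simpa using hvU)
  rw [← hU, hT]
  trivial

theorem polyFun_smul_of_isHomogeneous {p : MvPolynomial (Fin n × Fin n) ℂ} {d : ℕ}
    (hp : p.IsHomogeneous d) (z : ℂ) (X : Matrix (Fin n) (Fin n) ℂ) :
    polyFun p (z • X) = z ^ d * polyFun p X := by
  unfold polyFun
  rw [MvPolynomial.eval_eq, MvPolynomial.eval_eq, Finset.mul_sum]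
  refine Finset.sum_congr rfl fun m hm => ?_
  have hd : ∑ i ∈ m.support, m i = d := by
    rw [← hp (MvPolynomial.mem_support_iff.mp hm)]
    exact DFunLike.congr_fun Finsupp.degree_eq_weight_one m
  simp only [Matrix.smul_apply, smul_eq_mul, mul_pow, Finset.prod_mul_distrib]
  rw [Finset.prod_pow_eq_pow_sum, hd]
  ring

/-- For fixed `g`, the identity `p (z g) = z ^ d * p g` for all `z ≠ 0` is one between polynomials
in `z`. Its coefficient at `z ^ d` shows that `p` may be replaced by its homogeneous component of
degree `d`. -/
theorem IsPoly.isPolyHom (h : IsPoly rho) {d : ℕ}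
    (hs : ∀ (z : ℂˣ) x, rho (scalarGL n z) x = (z : ℂ) ^ d • x) : IsPolyHom rho d := by
  intro φ v
  obtain ⟨p, hp⟩ := h φ v
  refine ⟨MvPolynomial.homogeneousComponent d p,
    MvPolynomial.homogeneousComponent_isHomogeneous d p, fun g => ?_⟩
  let P : Polynomial ℂ := (∑ k ∈ Finset.range (p.totalDegree + 1),
    Polynomial.monomial k (polyFun (MvPolynomial.homogeneousComponent k p) g)) -
      Polynomial.monomial d (polyFun p g)
  have hP : P = 0 := by
    refine Polynomial.eq_zero_of_infinite_isRoot P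
      (Set.Infinite.mono (s := {0}ᶜ) (fun z hz => ?_) (Set.finite_singleton 0).infinite_compl)
    have hz0 : z ≠ 0 := hz
    have h1 : polyFun p (z • (g : Matrix (Fin n) (Fin n) ℂ)) = z ^ d * polyFun p g := by
      have h2 := hp (scalarGL n (Units.mk0 z hz0) * g)
      have h3 : ((scalarGL n (Units.mk0 z hz0) * g : Matrix.GeneralLinearGroup (Fin n) ℂ) :
          Matrix (Fin n) (Fin n) ℂ) = z • (g : Matrix (Fin n) (Fin n) ℂ) := by
        ext i j
        rw [scalarGL_mul_apply]
        rfl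
      rw [map_mul, Module.End.mul_apply, hs, map_smul, hp, h3] at h2
      exact h2.symm
    have h2 : polyFun p (z • (g : Matrix (Fin n) (Fin n) ℂ)) =
        ∑ k ∈ Finset.range (p.totalDegree + 1),
          z ^ k * polyFun (MvPolynomial.homogeneousComponent k p) g := by
      conv_lhs => rw [← MvPolynomial.sum_homogeneousComponent p]
      unfold polyFun
      rw [map_sum]
      exact Finset.sum_congr rfl fun k _ => polyFun_smul_of_isHomogeneous
        (MvPolynomial.homogeneousComponent_isHomogeneous k p) z _
    change Polynomial.eval z P = 0
    rw [Polynomial.eval_sub, Polynomial.eval_finsetSum]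
    simp only [Polynomial.eval_monomial]
    rw [mul_comm (polyFun p g), ← h1, h2, sub_eq_zero]
    exact Finset.sum_congr rfl fun k _ => mul_comm _ _
  have h1 := congrArg (fun Q => Polynomial.coeff Q d) hP
  simp only [P, Polynomial.coeff_sub, Polynomial.finsetSum_coeff, Polynomial.coeff_monomial,
    Polynomial.coeff_zero, if_true] at h1
  rw [hp, ← sub_eq_zero.mp h1, Finset.sum_ite_eq']
  split_ifs with hd
  · rfl
  · rw [MvPolynomial.homogeneousComponent_eq_zero d p (by simpa using hd)]
    simp [polyFun]

theorem HighestWeightIrrep.isPolyHom {w : Fin n → ℕ} (E : HighestWeightIrrep n w) :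
    IsPolyHom E.rho (∑ i, w i) :=
  E.isPoly.isPolyHom E.rho_scalarGL

end HighestWeight

/-! ### Tensor products of irreducible representations -/

/-- The cells are counted row by row; the bound on the length ensures that no row is lost. -/
theorem sum_weight (n : ℕ) (lam : YoungDiagram) (h : lam.colLen 0 ≤ n) :
    ∑ i, weight n lam i = lam.card := by
  have h1 : ∀ c ∈ lam.cells, c.1 ∈ Finset.range n := by
    intro c hc
    have h2 : (c.1, 0) ∈ lam := lam.up_left_mem le_rfl (Nat.zero_le c.2) hc
    exact Finset.mem_range.mpr (lt_of_lt_of_le (YoungDiagram.mem_iff_lt_colLen.mp h2) h)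
  rw [YoungDiagram.card, Finset.card_eq_sum_card_fiberwise h1, Finset.sum_range]
  refine Finset.sum_congr rfl fun i _ => ?_
  exact lam.rowLen_eq_card

theorem irrep_isPolyHom (n : ℕ) (lam : YoungDiagram) (h : lam.colLen 0 ≤ n) :
    IsPolyHom (irrep n lam).rho lam.card := by
  have := (irrep n lam).isPolyHom
  rwa [sum_weight n lam h] at this

/-! ### Characters and degrees of tensor products -/

section PiTensor

variable {n : ℕ} {V : Type} [AddCommGroup V] [Module ℂ V]
  {rho : Representation ℂ (Matrix.GeneralLinearGroup (Fin n) ℂ) V}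

theorem isPolyHom_of_basis {d : ℕ} {κ : Type} [Fintype κ] (b : Module.Basis κ ℂ V)
    (h : ∀ i j, ∃ p : MvPolynomial (Fin n × Fin n) ℂ, p.IsHomogeneous d ∧
      ∀ g : Matrix.GeneralLinearGroup (Fin n) ℂ,
        b.repr (rho g (b i)) j = polyFun p (g : Matrix (Fin n) (Fin n) ℂ)) :
    IsPolyHom rho d := by
  choose p hp hpg using h
  intro φ v
  refine ⟨∑ i, ∑ j, MvPolynomial.C (b.repr v i * φ (b j)) * p i j, ?_, fun g => ?_⟩
  · refine MvPolynomial.IsHomogeneous.sum _ _ _ fun i _ => MvPolynomial.IsHomogeneous.sum _ _ _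
      fun j _ => ?_
    have := (MvPolynomial.isHomogeneous_C (Fin n × Fin n) (b.repr v i * φ (b j))).mul (hp i j)
    rwa [zero_add] at this
  · conv_lhs => rw [← b.sum_repr v, map_sum, map_sum]
    simp only [polyFun, map_sum]
    refine Finset.sum_congr rfl fun i _ => ?_
    conv_lhs => rw [map_smul, ← b.sum_repr (rho g (b i)), map_smul, map_sum, Finset.smul_sum]
    refine Finset.sum_congr rfl fun j _ => ?_
    rw [map_smul, hpg, map_mul, MvPolynomial.eval_C, smul_eq_mul, smul_eq_mul]
    unfold polyFun
    ring

theorem trace_piTensorProduct_map {ι : Type} [Fintype ι] {W : ι → Type}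
    [∀ i, AddCommGroup (W i)] [∀ i, Module ℂ (W i)] [∀ i, FiniteDimensional ℂ (W i)]
    (f : ∀ i, W i →ₗ[ℂ] W i) :
    LinearMap.trace ℂ _ (PiTensorProduct.map f) = ∏ i, LinearMap.trace ℂ _ (f i) := by
  classical
  let b := fun i => Module.finBasis ℂ (W i)
  have h1 : ∀ i, LinearMap.trace ℂ _ (f i) = ∑ q, (b i).repr (f i (b i q)) q := by
    intro i
    rw [LinearMap.trace_eq_matrix_trace ℂ (b i), Matrix.trace]
    exact Finset.sum_congr rfl fun q _ => LinearMap.toMatrix_apply _ _ _ _ _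
  simp_rw [h1]
  rw [LinearMap.trace_eq_matrix_trace ℂ (Basis.piTensorProduct b), Matrix.trace,
    Finset.prod_univ_sum, Fintype.piFinset_univ]
  refine Finset.sum_congr rfl fun p _ => ?_
  rw [Matrix.diag_apply, LinearMap.toMatrix_apply, Basis.piTensorProduct_apply,
    PiTensorProduct.map_tprod, Basis.piTensorProduct_repr_tprod_apply]

theorem tensorRep_apply (n : ℕ) {m : ℕ} (mu : Fin m → YoungDiagram)
    (g : Matrix.GeneralLinearGroup (Fin n) ℂ) :
    tensorRep n mu g = PiTensorProduct.map fun j => (irrep n (mu j)).rho g := rfl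

theorem tensorRep_isPolyHom (n : ℕ) {m : ℕ} (mu : Fin m → YoungDiagram)
    (h : ∀ j, (mu j).colLen 0 ≤ n) : IsPolyHom (tensorRep n mu) (∑ j, (mu j).card) := by
  classical
  let b := fun j => Module.finBasis ℂ (irrep n (mu j)).V
  refine isPolyHom_of_basis (Basis.piTensorProduct b) fun q p => ?_
  have h1 : ∀ j, ∃ P : MvPolynomial (Fin n × Fin n) ℂ, P.IsHomogeneous (mu j).card ∧
      ∀ g : Matrix.GeneralLinearGroup (Fin n) ℂ,
        (b j).repr ((irrep n (mu j)).rho g (b j (q j))) (p j) =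
          polyFun P (g : Matrix (Fin n) (Fin n) ℂ) := fun j =>
    irrep_isPolyHom n (mu j) (h j) ((b j).coord (p j)) (b j (q j))
  choose P hP hPg using h1
  refine ⟨∏ j, P j, MvPolynomial.IsHomogeneous.prod _ _ _ fun j _ => hP j, fun g => ?_⟩
  rw [tensorRep_apply, Basis.piTensorProduct_apply, PiTensorProduct.map_tprod,
    Basis.piTensorProduct_repr_tprod_apply]
  simp only [hPg, polyFun, map_prod]

instance (n : ℕ) {m : ℕ} (mu : Fin m → YoungDiagram) :
    FiniteDimensional ℂ (PiTensorProduct ℂ fun j => (irrep n (mu j)).V) :=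
  Module.Finite.of_basis (Basis.piTensorProduct fun j => Module.finBasis ℂ (irrep n (mu j)).V)

end PiTensor

/-! ### Restriction to smaller general linear groups -/

section Generic

variable {n : ℕ} {ι : Type} [Fintype ι] [DecidableEq ι]

theorem exists_poly_spow (l : schurAlg ι (Fin n) →ₗ[ℂ] ℂ) :
    ∃ p : MvPolynomial (Fin n × Fin n) ℂ, ∀ X, l (spow ι X) = polyFun p X := by
  obtain ⟨l', hl'⟩ := LinearMap.exists_extend (p := Subalgebra.toSubmodule (schurAlg ι (Fin n))) l
  refine ⟨∑ I : ι → Fin n, ∑ J : ι → Fin n, MvPolynomial.C (l' (Matrix.single I J 1)) *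
    ∏ k, MvPolynomial.X (I k, J k), fun X => ?_⟩
  have h1 : l (spow ι X) = l' (tpow ι X) := (LinearMap.congr_fun hl' (spow ι X)).symm
  rw [h1]
  conv_lhs => rw [Matrix.matrix_eq_sum_single (tpow ι X)]
  simp only [polyFun, map_sum, map_mul, map_prod, MvPolynomial.eval_C, MvPolynomial.eval_X]
  refine Finset.sum_congr rfl fun I _ => Finset.sum_congr rfl fun J _ => ?_
  rw [← tpow_apply, ← smul_eq_mul, smul_eq_mul, mul_comm, ← smul_eq_mul, ← map_smul,
    Matrix.smul_single, smul_eq_mul, mul_one]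

theorem continuous_spow_add (l : schurAlg ι (Fin n) →ₗ[ℂ] ℂ) (X : Matrix (Fin n) (Fin n) ℂ) :
    Continuous fun t : ℂ => l (spow ι (X + t • (1 : Matrix (Fin n) (Fin n) ℂ))) := by
  obtain ⟨p, hp⟩ := exists_poly_spow l
  simp only [hp]
  refine continuous_polyFun_comp p fun i j => ?_
  simp only [Matrix.add_apply, Matrix.smul_apply]
  fun_prop

theorem eq_of_eq_on_GL {f f' : Matrix (Fin n) (Fin n) ℂ → ℂ}
    (hf : ∀ X, Continuous fun t : ℂ => f (X + t • (1 : Matrix (Fin n) (Fin n) ℂ)))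
    (hf' : ∀ X, Continuous fun t : ℂ => f' (X + t • (1 : Matrix (Fin n) (Fin n) ℂ)))
    (h : ∀ g : Matrix.GeneralLinearGroup (Fin n) ℂ,
      f (g : Matrix (Fin n) (Fin n) ℂ) = f' (g : Matrix (Fin n) (Fin n) ℂ))
    (X : Matrix (Fin n) (Fin n) ℂ) : f X = f' X := by
  have := eq_of_eventually_cofinite (hf X) (hf' X) (by
    filter_upwards [eventually_det_add_ne_zero X] with t ht
    exact h (Matrix.GeneralLinearGroup.mkOfDetNeZero _ ht)) 0
  simpa using this

theorem exists_schurAlg_apply_eq {V : Type} [AddCommGroup V] [Module ℂ V]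
    {rho : Representation ℂ (Matrix.GeneralLinearGroup (Fin n) ℂ) V} (hirr : rho.IsIrreducible)
    {Θ : schurAlg ι (Fin n) →ₐ[ℂ] Module.End ℂ V}
    (hΘ : ∀ g : Matrix.GeneralLinearGroup (Fin n) ℂ,
      Θ (spow ι (g : Matrix (Fin n) (Fin n) ℂ)) = rho g) {v : V} (hv : v ≠ 0) (x : V) :
    ∃ a, Θ a v = x := by
  let f : schurAlg ι (Fin n) →ₗ[ℂ] V := LinearMap.applyₗ v ∘ₗ Θ.toLinearMap
  have : LinearMap.range f = ⊤ := by
    refine (eq_bot_or_eq_top_of_isIrreducible hirr _ ?_).resolve_left fun hb => hv ?_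
    · rintro g _ ⟨a, rfl⟩
      refine ⟨spow ι (g : Matrix (Fin n) (Fin n) ℂ) * a, ?_⟩
      change Θ _ v = rho g (Θ a v)
      rw [map_mul, hΘ]
      rfl
    · have : v ∈ LinearMap.range f := ⟨1, by
        change Θ 1 v = v
        rw [map_one]
        rfl⟩
      rw [hb] at this
      simpa using this
  exact LinearMap.range_eq_top.mp this x

theorem IsPolyHom.rho_scalarGL {V : Type} [AddCommGroup V] [Module ℂ V]
    {rho : Representation ℂ (Matrix.GeneralLinearGroup (Fin n) ℂ) V} {d : ℕ}
    (h : IsPolyHom rho d) (z : ℂˣ) (x : V) : rho (scalarGL n z) x = (z : ℂ) ^ d • x := by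
  rw [← sub_eq_zero, ← Module.forall_dual_apply_eq_zero_iff ℂ]
  intro φ
  obtain ⟨p, hp, hpg⟩ := h φ x
  have h1 : (scalarGL n z : Matrix (Fin n) (Fin n) ℂ) =
      (z : ℂ) • ((1 : Matrix.GeneralLinearGroup (Fin n) ℂ) : Matrix (Fin n) (Fin n) ℂ) := by
    rw [scalarGL_val, Matrix.scalar_apply, ← Matrix.smul_one_eq_diagonal]
    rfl
  rw [map_sub, hpg, h1, polyFun_smul_of_isHomogeneous hp, ← hpg, map_one, map_smul, smul_eq_mul]
  exact sub_self _

/-- The scalar matrix `2` acts by `2 ^ d` on one side and by `2 ^ d'` on the other. -/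
theorem finrank_intertwiningMap_eq_zero {V V' : Type} [AddCommGroup V] [Module ℂ V]
    [AddCommGroup V'] [Module ℂ V']
    {rho : Representation ℂ (Matrix.GeneralLinearGroup (Fin n) ℂ) V}
    {rho' : Representation ℂ (Matrix.GeneralLinearGroup (Fin n) ℂ) V'} {d d' : ℕ}
    (h : IsPolyHom rho d) (h' : IsPolyHom rho' d') (hne : d ≠ d') :
    Module.finrank ℂ (Representation.IntertwiningMap rho rho') = 0 := by
  have : Subsingleton (Representation.IntertwiningMap rho rho') := by
    refine subsingleton_of_forall_eq 0 fun f => ?_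
    apply Representation.IntertwiningMap.ext
    refine LinearMap.ext fun x => ?_
    have h1 := f.isIntertwining rho rho' (scalarGL n (Units.mk0 2 two_ne_zero)) x
    rw [h.rho_scalarGL, h'.rho_scalarGL, map_smul, ← sub_eq_zero, ← sub_smul,
      smul_eq_zero] at h1
    refine h1.resolve_left fun h2 => hne ?_
    rw [sub_eq_zero, Units.val_mk0] at h2
    have h3 : (2 : ℕ) ^ d = 2 ^ d' := by exact_mod_cast h2
    exact Nat.pow_right_injective le_rfl h3
  exact Module.finrank_zero_of_subsingleton

end Generic

/-! ### Extension by zero and compression between Schur algebras -/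

section Extend

variable {n n' : ℕ} (h : n ≤ n') {ι : Type} [Fintype ι] [DecidableEq ι]

/-- The matrix of the inclusion of the first `n` coordinates. -/
def inclMat : Matrix (Fin n') (Fin n) ℂ :=
  (1 : Matrix (Fin n') (Fin n') ℂ).submatrix id (Fin.castLE h)

theorem inclMat_transpose_mul : (inclMat h).transpose * inclMat h = 1 := by
  ext i j
  simp [inclMat, Matrix.mul_apply, Matrix.one_apply, (Fin.castLE_injective h).eq_iff]

/-- Extension of a matrix by zero. -/
def extendMat (X : Matrix (Fin n) (Fin n) ℂ) : Matrix (Fin n') (Fin n') ℂ :=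
  inclMat h * X * (inclMat h).transpose

theorem extendMat_apply (X : Matrix (Fin n) (Fin n) ℂ) (i j : Fin n') :
    extendMat h X i j = ∑ k, ∑ l, if i = Fin.castLE h k ∧ j = Fin.castLE h l then X k l else 0 := by
  unfold extendMat
  simp only [Matrix.mul_apply, Finset.sum_mul]
  rw [Finset.sum_comm]
  refine Finset.sum_congr rfl fun k _ => Finset.sum_congr rfl fun l _ => ?_
  simp [inclMat, Matrix.one_apply, ite_and]
  split_ifs <;> rfl

theorem extendMat_castLE (X : Matrix (Fin n) (Fin n) ℂ) (i j : Fin n) :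
    extendMat h X (Fin.castLE h i) (Fin.castLE h j) = X i j := by
  rw [extendMat_apply]
  simp [(Fin.castLE_injective h).eq_iff, ite_and]

theorem extendMat_blockTriangular {X : Matrix (Fin n) (Fin n) ℂ} (hX : X.BlockTriangular id) :
    (extendMat h X).BlockTriangular id := by
  intro i j hij
  rw [extendMat_apply]
  refine Finset.sum_eq_zero fun k _ => Finset.sum_eq_zero fun l _ => ?_
  split_ifs with hkl
  · obtain ⟨rfl, rfl⟩ := hkl
    exact hX hij
  · rfl

theorem extendMat_mul (X Y : Matrix (Fin n) (Fin n) ℂ) :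
    extendMat h X * extendMat h Y = extendMat h (X * Y) := by
  unfold extendMat
  calc _ = inclMat h * X * ((inclMat h).transpose * inclMat h) * Y * (inclMat h).transpose := by
        simp only [Matrix.mul_assoc]
    _ = _ := by rw [inclMat_transpose_mul, Matrix.mul_one, Matrix.mul_assoc (inclMat h) X Y]

/-- Extension by zero on Schur algebras. -/
def extendS (ι : Type) [Fintype ι] [DecidableEq ι] :
    schurAlg ι (Fin n) →ₗ[ℂ] schurAlg ι (Fin n') where
  toFun a := ⟨tpow ι (inclMat h) * a.1 * tpow ι (inclMat h).transpose,
    ((tpow_isSymm _).mul a.2).mul (tpow_isSymm _)⟩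
  map_add' a b := Subtype.ext <| by
    change tpow ι (inclMat h) * (a.1 + b.1) * _ = _
    rw [Matrix.mul_add, Matrix.add_mul]
    rfl
  map_smul' c a := Subtype.ext <| by
    change tpow ι (inclMat h) * (c • a.1) * _ = _
    rw [Matrix.mul_smul, Matrix.smul_mul]
    rfl

/-- Compression to the first `n` letters on Schur algebras. -/
def compressS (ι : Type) [Fintype ι] [DecidableEq ι] (a : schurAlg ι (Fin n')) :
    schurAlg ι (Fin n) :=
  ⟨tpow ι (inclMat h).transpose * a.1 * tpow ι (inclMat h),
    ((tpow_isSymm _).mul a.2).mul (tpow_isSymm _)⟩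

theorem tpow_inclMat_transpose_mul :
    tpow ι (inclMat h).transpose * tpow ι (inclMat h) = 1 := by
  rw [← tpow_mul, inclMat_transpose_mul, tpow_one]

theorem extendS_spow (X : Matrix (Fin n) (Fin n) ℂ) :
    extendS h ι (spow ι X) = spow ι (extendMat h X) := by
  apply Subtype.ext
  change _ = tpow ι (inclMat h * X * (inclMat h).transpose)
  rw [tpow_mul, tpow_mul]
  rfl

theorem extendS_mul (a b : schurAlg ι (Fin n)) :
    extendS h ι (a * b) = extendS h ι a * extendS h ι b := by
  apply Subtype.ext
  change tpow ι (inclMat h) * (a.1 * b.1) * tpow ι (inclMat h).transpose =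
    (tpow ι (inclMat h) * a.1 * tpow ι (inclMat h).transpose) *
      (tpow ι (inclMat h) * b.1 * tpow ι (inclMat h).transpose)
  calc _ = tpow ι (inclMat h) * a.1 * (tpow ι (inclMat h).transpose * tpow ι (inclMat h)) * b.1 *
        tpow ι (inclMat h).transpose := by
        rw [tpow_inclMat_transpose_mul, Matrix.mul_one]
        simp only [Matrix.mul_assoc]
    _ = _ := by simp only [Matrix.mul_assoc]

theorem compressS_extendS (a : schurAlg ι (Fin n)) : compressS h ι (extendS h ι a) = a := by
  apply Subtype.ext
  change tpow ι (inclMat h).transpose *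
    (tpow ι (inclMat h) * a.1 * tpow ι (inclMat h).transpose) * tpow ι (inclMat h) = a.1
  calc _ = (tpow ι (inclMat h).transpose * tpow ι (inclMat h)) * a.1 *
        (tpow ι (inclMat h).transpose * tpow ι (inclMat h)) := by simp only [Matrix.mul_assoc]
    _ = _ := by rw [tpow_inclMat_transpose_mul, Matrix.one_mul, Matrix.mul_one]

/-- With `η` the tensor power of the projection to the first `n` coordinates, this identifies the
smaller Schur algebra with the corner `η S η` of the larger one. -/
theorem extendS_compressS (a : schurAlg ι (Fin n')) :
    extendS h ι (compressS h ι a) = spow ι (extendMat h 1) * a * spow ι (extendMat h 1) := by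
  apply Subtype.ext
  change tpow ι (inclMat h) * (tpow ι (inclMat h).transpose * a.1 * tpow ι (inclMat h)) *
    tpow ι (inclMat h).transpose = tpow ι (inclMat h * 1 * (inclMat h).transpose) * a.1 *
      tpow ι (inclMat h * 1 * (inclMat h).transpose)
  rw [Matrix.mul_one, tpow_mul]
  simp only [Matrix.mul_assoc]

end Extend

/-! ### Truncation of representations by the corner idempotent -/

section Truncation

variable {n n' : ℕ} (h : n ≤ n') {ι : Type} [Fintype ι] [DecidableEq ι]

/-- The weight formula passes from invertible to arbitrary upper triangular matrices by shifting
along `t • 1`. It is needed for the singular matrices `extendMat h X`. -/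
theorem highestVec_spow {V : Type} [AddCommGroup V] [Module ℂ V]
    {rho : Representation ℂ (Matrix.GeneralLinearGroup (Fin n) ℂ) V}
    {Θ : schurAlg ι (Fin n) →ₐ[ℂ] Module.End ℂ V}
    (hΘ : ∀ g : Matrix.GeneralLinearGroup (Fin n) ℂ,
      Θ (spow ι (g : Matrix (Fin n) (Fin n) ℂ)) = rho g) {w : Fin n → ℕ} {v : V}
    (hv : IsHighestVec rho w v) {X : Matrix (Fin n) (Fin n) ℂ} (hX : X.BlockTriangular id) :
    Θ (spow ι X) v = (∏ i, X i i ^ w i) • v := by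
  rw [← sub_eq_zero, ← Module.forall_dual_apply_eq_zero_iff ℂ]
  intro φ
  rw [map_sub, map_smul, sub_eq_zero, smul_eq_mul]
  have := eq_of_eventually_cofinite
    (continuous_spow_add (φ ∘ₗ LinearMap.applyₗ v ∘ₗ Θ.toLinearMap) X)
    (g := fun t => (∏ i, (X + t • (1 : Matrix (Fin n) (Fin n) ℂ)) i i ^ w i) * φ v)
    (by
      simp only [Matrix.add_apply, Matrix.smul_apply]
      fun_prop) (by
      filter_upwards [eventually_det_add_ne_zero X] with t ht
      have hb : (X + t • (1 : Matrix (Fin n) (Fin n) ℂ)).BlockTriangular id :=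
        hX.add fun i j hij => by
          rw [Matrix.smul_apply, Matrix.one_apply_ne (show i ≠ j from ne_of_gt hij), smul_zero]
      have h1 := hv (Matrix.GeneralLinearGroup.mkOfDetNeZero _ ht) hb
      rw [← hΘ] at h1
      have h2 := congrArg φ h1
      rw [map_smul, smul_eq_mul] at h2
      exact h2) 0
  simpa using this

/-- The first `n` coordinates cut out of an irreducible representation of `GL_n'` the irreducible
representation of `GL_n` with the same highest weight. -/
theorem exists_truncation_irrep {lam : YoungDiagram} (hlam : lam.colLen 0 ≤ n)
    {Θ : schurAlg ι (Fin n') →ₐ[ℂ] Module.End ℂ (irrep n' lam).V}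
    (hΘ : ∀ g : Matrix.GeneralLinearGroup (Fin n') ℂ,
      Θ (spow ι (g : Matrix (Fin n') (Fin n') ℂ)) = (irrep n' lam).rho g) :
    ∃ i : (irrep n lam).V →ₗ[ℂ] (irrep n' lam).V, Function.Injective i ∧
      (∀ (g : Matrix.GeneralLinearGroup (Fin n) ℂ) x, i ((irrep n lam).rho g x) =
        Θ (spow ι (extendMat h (g : Matrix (Fin n) (Fin n) ℂ))) (i x)) ∧
      LinearMap.range i = LinearMap.range (Θ (spow ι (extendMat h 1))) := by
  obtain ⟨v, hv0, hv⟩ := (irrep n' lam).exists_highestWeightVector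
  have hirr := (irrep n' lam).isIrreducible
  let η := spow ι (extendMat h 1)
  let W := LinearMap.range (Θ η)
  have hηX : ∀ X : Matrix (Fin n) (Fin n) ℂ,
      η * spow ι (extendMat h X) = spow ι (extendMat h X) := fun X => by
    rw [← spow_mul, extendMat_mul, one_mul]
  have hW : ∀ x, x ∈ W ↔ Θ η x = x := by
    intro x
    constructor
    · rintro ⟨y, rfl⟩
      rw [← Module.End.mul_apply, ← map_mul, hηX]
    · exact fun hx => ⟨x, hx⟩
  have hstab : ∀ X, ∀ x ∈ W, Θ (spow ι (extendMat h X)) x ∈ W := fun X x _ => by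
    rw [hW, ← Module.End.mul_apply, ← map_mul, hηX]
  let R : Representation ℂ (Matrix.GeneralLinearGroup (Fin n) ℂ) W :=
    { toFun := fun g => (Θ (spow ι (extendMat h (g : Matrix (Fin n) (Fin n) ℂ)))).restrict
        (hstab _)
      map_one' := LinearMap.ext fun x => Subtype.ext ((hW x).mp x.2)
      map_mul' := fun g g' => LinearMap.ext fun x => Subtype.ext <| by
        change Θ (spow ι (extendMat h ((g : Matrix (Fin n) (Fin n) ℂ) * g'))) x =
          Θ (spow ι (extendMat h g)) (Θ (spow ι (extendMat h g')) x)
        rw [← extendMat_mul, spow_mul, map_mul]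
        rfl }
  have hR : ∀ g x, ((R g x : W) : (irrep n' lam).V) =
      Θ (spow ι (extendMat h (g : Matrix (Fin n) (Fin n) ℂ))) x := fun _ _ => rfl
  have htri : ∀ X : Matrix (Fin n) (Fin n) ℂ, X.BlockTriangular id →
      Θ (spow ι (extendMat h X)) v = (∏ i, X i i ^ weight n lam i) • v := by
    intro X hX
    rw [highestVec_spow hΘ hv (extendMat_blockTriangular h hX)]
    congr 1
    have h1 : ∏ i, X i i ^ weight n lam i =
        ∏ i ∈ Finset.univ.image (Fin.castLE h), extendMat h X i i ^ weight n' lam i := by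
      rw [Finset.prod_image fun a _ b _ hab => Fin.castLE_injective h hab]
      refine Finset.prod_congr rfl fun i _ => ?_
      rw [extendMat_castLE]
      rfl
    rw [h1]
    symm
    refine Finset.prod_subset (Finset.subset_univ _) fun i _ hi => ?_
    have h2 : n ≤ i := by
      by_contra hlt
      exact hi (Finset.mem_image.mpr ⟨⟨i, not_le.mp hlt⟩, Finset.mem_univ _, rfl⟩)
    have h3 : weight n' lam i = 0 := by
      by_contra h0
      have h4 : ((i : ℕ), 0) ∈ lam := YoungDiagram.mem_iff_lt_rowLen.mpr (Nat.pos_of_ne_zero h0)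
      have h5 := YoungDiagram.mem_iff_lt_colLen.mp h4
      omega
    -- The diagonal of the extension may vanish beyond position `n`, but there the exponent is zero,
    -- and `0 ^ 0 = 1`.
    rw [h3, pow_zero]
  have hvW : v ∈ W := by
    rw [hW, htri 1 (Matrix.blockTriangular_one)]
    simp
  -- Given a nonzero `w` in `U` and `x` in `W`, simplicity upstairs yields `a` with `Θ a w = x`.
  -- Both vectors are fixed by `η`, so `η a η` also works, and it comes from the smaller Schur
  -- algebra.
  have hirrR : R.IsIrreducible := by
    refine isIrreducible_of_forall_submodule (v := ⟨v, hvW⟩)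
      (fun h0 => hv0 (congrArg Subtype.val h0)) fun U hU => ?_
    by_cases hUb : U = ⊥
    · exact Or.inl hUb
    right
    obtain ⟨⟨w, hwW⟩, hwU, hw0⟩ := Submodule.exists_mem_ne_zero_of_ne_bot hUb
    have hw0' : w ≠ 0 := fun h0 => hw0 (Subtype.ext h0)
    have hU' : ∀ b : schurAlg ι (Fin n), Θ (extendS h ι b) w ∈ U.map W.subtype := by
      intro b
      induction b using schurAlg_induction with
      | hg g =>
        rw [extendS_spow]
        exact ⟨R g ⟨w, hwW⟩, hU g _ hwU, rfl⟩
      | h0 => simp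
      | hadd a b ha hb =>
        rw [map_add, map_add]
        exact add_mem ha hb
      | hsmul c a ha =>
        rw [map_smul, map_smul]
        exact Submodule.smul_mem _ c ha
    refine top_unique fun x _ => ?_
    obtain ⟨a, ha⟩ := exists_schurAlg_apply_eq hirr hΘ hw0' x.1
    have h1 : Θ (extendS h ι (compressS h ι a)) w = x.1 := by
      rw [extendS_compressS, map_mul, map_mul, Module.End.mul_apply, Module.End.mul_apply,
        (hW w).mp hwW, ha]
      exact (hW x).mp x.2
    have h2 := hU' (compressS h ι a)
    rw [h1] at h2
    obtain ⟨y, hy, hyx⟩ := h2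
    have : y = x := Subtype.ext hyx
    exact this ▸ hy
  let E : HighestWeightIrrep n (weight n lam) :=
    { V := W
      rho := R
      finiteDimensional := inferInstance
      isIrreducible := hirrR
      isPolynomial := by
        intro φ x
        obtain ⟨ψ, hψ⟩ := LinearMap.exists_extend φ
        obtain ⟨p, hp⟩ := exists_poly_spow (ψ ∘ₗ LinearMap.applyₗ x.1 ∘ₗ Θ.toLinearMap ∘ₗ
          extendS h ι)
        refine ⟨p, fun g => ?_⟩
        refine Eq.trans ?_ (hp g)
        change φ (R g x) = ψ (Θ (extendS h ι (spow ι (g : Matrix (Fin n) (Fin n) ℂ))) x)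
        rw [extendS_spow]
        exact (LinearMap.congr_fun hψ (R g x)).symm
      exists_highestWeightVector := ⟨⟨v, hvW⟩, fun h0 => hv0 (congrArg Subtype.val h0),
        fun b hb => Subtype.ext (htri b hb)⟩ }
  obtain ⟨f, hf⟩ := (irrep n lam).exists_equiv E
  refine ⟨W.subtype ∘ₗ f.toLinearMap, Subtype.val_injective.comp f.injective, fun g x => ?_, ?_⟩
  · change ((f ((irrep n lam).rho g x) : W) : (irrep n' lam).V) = _
    rw [hf]
    rfl
  · rw [LinearMap.range_comp]
    change Submodule.map W.subtype (LinearMap.range f.toLinearMap) = W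
    rw [LinearMap.range_eq_top.mpr f.surjective, Submodule.map_top, Submodule.range_subtype]

theorem truncation_equivariant {V V' : Type} [AddCommGroup V] [Module ℂ V] [AddCommGroup V']
    [Module ℂ V'] {rho : Representation ℂ (Matrix.GeneralLinearGroup (Fin n) ℂ) V}
    {Θ : schurAlg ι (Fin n) →ₐ[ℂ] Module.End ℂ V} {Θ' : schurAlg ι (Fin n') →ₐ[ℂ] Module.End ℂ V'}
    (hΘ : ∀ g : Matrix.GeneralLinearGroup (Fin n) ℂ,
      Θ (spow ι (g : Matrix (Fin n) (Fin n) ℂ)) = rho g) {i : V →ₗ[ℂ] V'}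
    (hi : ∀ (g : Matrix.GeneralLinearGroup (Fin n) ℂ) x, i (rho g x) =
        Θ' (spow ι (extendMat h (g : Matrix (Fin n) (Fin n) ℂ))) (i x))
    (a : schurAlg ι (Fin n)) (x : V) : i (Θ a x) = Θ' (extendS h ι a) (i x) := by
  induction a using schurAlg_induction with
  | hg g => rw [hΘ, hi, extendS_spow]
  | h0 => simp
  | hadd a b ha hb => simp [ha, hb]
  | hsmul c a ha => simp [ha]

/-- A vector of an irreducible representation that is fixed by an idempotent `η` generates the
corresponding column of an idempotent below `η`. -/
theorem exists_column_generator {F : Type} [AddCommGroup F] [Module ℂ F] [FiniteDimensional ℂ F]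
    {rho : Representation ℂ (Matrix.GeneralLinearGroup (Fin n) ℂ) F} (hirr : rho.IsIrreducible)
    {Θ : schurAlg ι (Fin n) →ₐ[ℂ] Module.End ℂ F}
    (hΘ : ∀ g : Matrix.GeneralLinearGroup (Fin n) ℂ,
      Θ (spow ι (g : Matrix (Fin n) (Fin n) ℂ)) = rho g) {u : F} (hu : u ≠ 0)
    {η : schurAlg ι (Fin n)} (hη : η * η = η) (hηu : Θ η u = u) :
    ∃ ε, Θ ε u = u ∧ (∀ a, Θ a u = 0 → a * ε = 0) ∧ η * ε = ε ∧ ε * η = ε := by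
  obtain ⟨φ, hφ⟩ : ∃ φ : Module.Dual ℂ F, φ u = 1 := by
    have : ∃ φ : Module.Dual ℂ F, φ u ≠ 0 := by
      by_contra! h0
      exact hu ((Module.forall_dual_apply_eq_zero_iff ℂ _).mp h0)
    obtain ⟨φ, hφ⟩ := this
    exact ⟨(φ u)⁻¹ • φ, by rw [LinearMap.smul_apply, smul_eq_mul, inv_mul_cancel₀ hφ]⟩
  obtain ⟨k, d, hd, ⟨e⟩⟩ :=
    IsSemisimpleRing.exists_algEquiv_pi_matrix_of_isAlgClosed ℂ (schurAlg ι (Fin n))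
  obtain ⟨r, hr⟩ := exists_isColumn e Θ hu
    fun w hw x => exists_schurAlg_apply_eq hirr hΘ hw x
  obtain ⟨ε₁, hε1, hε2, -⟩ := hr.exists_rankOne u φ
  -- Multiplying `ε₁` by `η` on the right keeps the annihilation property and the action on `u`.
  -- Applying that property to `η - 1` then gives `η * ε = ε`.
  have hεker : ∀ a, Θ a u = 0 → a * (ε₁ * η) = 0 := fun a ha => by
    rw [← mul_assoc, hε2 a ha, zero_mul]
  refine ⟨ε₁ * η, ?_, hεker, ?_, by rw [mul_assoc, hη]⟩
  · rw [map_mul, Module.End.mul_apply, hηu, hε1, hφ, one_smul]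
  · have := hεker (η - 1) (by
      rw [map_sub, map_one, LinearMap.sub_apply, hηu]
      exact sub_self _)
    rwa [sub_mul, one_mul, sub_eq_zero] at this

theorem finrank_intertwiningMap_eq_fixed {F M : Type} [AddCommGroup F] [Module ℂ F]
    [AddCommGroup M] [Module ℂ M]
    {rhoF : Representation ℂ (Matrix.GeneralLinearGroup (Fin n) ℂ) F}
    {rhoM : Representation ℂ (Matrix.GeneralLinearGroup (Fin n) ℂ) M} (hirr : rhoF.IsIrreducible)
    {ΘF : schurAlg ι (Fin n) →ₐ[ℂ] Module.End ℂ F} {ΘM : schurAlg ι (Fin n) →ₐ[ℂ] Module.End ℂ M}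
    (hΘF : ∀ g : Matrix.GeneralLinearGroup (Fin n) ℂ,
      ΘF (spow ι (g : Matrix (Fin n) (Fin n) ℂ)) = rhoF g)
    (hΘM : ∀ g : Matrix.GeneralLinearGroup (Fin n) ℂ,
      ΘM (spow ι (g : Matrix (Fin n) (Fin n) ℂ)) = rhoM g) {u : F} (hu : u ≠ 0)
    {ε : schurAlg ι (Fin n)} (hεu : ΘF ε u = u) (hε : ∀ a, ΘF a u = 0 → a * ε = 0) :
    Module.finrank ℂ (Representation.IntertwiningMap rhoF rhoM) =
      Module.finrank ℂ (LinearMap.ker (ΘM ε - 1)) := by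
  have hgen := exists_schurAlg_apply_eq hirr hΘF hu
  obtain ⟨e⟩ := nonempty_equiv_fixed (A := schurAlg ι (Fin n))
    (s := fun g : Matrix.GeneralLinearGroup (Fin n) ℂ => spow ι (g : Matrix (Fin n) (Fin n) ℂ))
    span_spow_GL hΘF hΘM hgen hεu hε
  exact e.finrank_eq

/-- Along an embedding onto the range of an idempotent `η`, the fixed spaces of two compatible
operators below `η` correspond. -/
theorem finrank_fixed_eq {M M' : Type} [AddCommGroup M] [Module ℂ M] [AddCommGroup M'] [Module ℂ M']
    {j : M →ₗ[ℂ] M'} (hj : Function.Injective j) {T : Module.End ℂ M} {T' P : Module.End ℂ M'}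
    (hT : ∀ x, j (T x) = T' (j x)) (hP : LinearMap.range j = LinearMap.range P)
    (hPT : P * T' = T') :
    Module.finrank ℂ (LinearMap.ker (T - 1)) = Module.finrank ℂ (LinearMap.ker (T' - 1)) := by
  have hmem : ∀ x, x ∈ LinearMap.ker (T - 1) ↔ T x = x := fun x => by
    rw [LinearMap.mem_ker, LinearMap.sub_apply, sub_eq_zero]
    rfl
  have hmem' : ∀ x, x ∈ LinearMap.ker (T' - 1) ↔ T' x = x := fun x => by
    rw [LinearMap.mem_ker, LinearMap.sub_apply, sub_eq_zero]
    rfl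
  have hmap : (LinearMap.ker (T - 1)).map j = LinearMap.ker (T' - 1) := by
    ext m
    rw [hmem']
    constructor
    · rintro ⟨x, hx, rfl⟩
      rw [← hT, (hmem x).mp hx]
    · intro hm
      have h1 : m ∈ LinearMap.range j := by
        rw [hP]
        refine ⟨m, ?_⟩
        nth_rewrite 1 [← hm]
        rw [← Module.End.mul_apply, hPT, hm]
      obtain ⟨x, rfl⟩ := h1
      exact ⟨x, (hmem x).mpr (hj (by rw [hT, hm])), rfl⟩
  rw [← hmap]
  exact (Submodule.equivMapOfInjective j hj _).finrank_eq

/-- Spaces of equivariant maps are preserved by truncation. -/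
theorem finrank_intertwiningMap_truncation {F F' M M' : Type} [AddCommGroup F] [Module ℂ F]
    [AddCommGroup F'] [Module ℂ F'] [FiniteDimensional ℂ F']
    [AddCommGroup M] [Module ℂ M] [AddCommGroup M'] [Module ℂ M']
    {rhoF : Representation ℂ (Matrix.GeneralLinearGroup (Fin n) ℂ) F}
    {rhoM : Representation ℂ (Matrix.GeneralLinearGroup (Fin n) ℂ) M}
    {rhoF' : Representation ℂ (Matrix.GeneralLinearGroup (Fin n') ℂ) F'}
    {rhoM' : Representation ℂ (Matrix.GeneralLinearGroup (Fin n') ℂ) M'}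
    {ΘF : schurAlg ι (Fin n) →ₐ[ℂ] Module.End ℂ F} {ΘM : schurAlg ι (Fin n) →ₐ[ℂ] Module.End ℂ M}
    {ΘF' : schurAlg ι (Fin n') →ₐ[ℂ] Module.End ℂ F'}
    {ΘM' : schurAlg ι (Fin n') →ₐ[ℂ] Module.End ℂ M'}
    (hΘF : ∀ g : Matrix.GeneralLinearGroup (Fin n) ℂ,
      ΘF (spow ι (g : Matrix (Fin n) (Fin n) ℂ)) = rhoF g)
    (hΘM : ∀ g : Matrix.GeneralLinearGroup (Fin n) ℂ,
      ΘM (spow ι (g : Matrix (Fin n) (Fin n) ℂ)) = rhoM g)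
    (hΘF' : ∀ g : Matrix.GeneralLinearGroup (Fin n') ℂ,
      ΘF' (spow ι (g : Matrix (Fin n') (Fin n') ℂ)) = rhoF' g)
    (hΘM' : ∀ g : Matrix.GeneralLinearGroup (Fin n') ℂ,
      ΘM' (spow ι (g : Matrix (Fin n') (Fin n') ℂ)) = rhoM' g)
    (hirr : rhoF.IsIrreducible) (hirr' : rhoF'.IsIrreducible)
    {i : F →ₗ[ℂ] F'} (hi_inj : Function.Injective i)
    (hi : ∀ (g : Matrix.GeneralLinearGroup (Fin n) ℂ) x, i (rhoF g x) =
        ΘF' (spow ι (extendMat h (g : Matrix (Fin n) (Fin n) ℂ))) (i x))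
    (hi_range : LinearMap.range i = LinearMap.range (ΘF' (spow ι (extendMat h 1))))
    {j : M →ₗ[ℂ] M'} (hj_inj : Function.Injective j)
    (hj : ∀ (g : Matrix.GeneralLinearGroup (Fin n) ℂ) x, j (rhoM g x) =
        ΘM' (spow ι (extendMat h (g : Matrix (Fin n) (Fin n) ℂ))) (j x))
    (hj_range : LinearMap.range j = LinearMap.range (ΘM' (spow ι (extendMat h 1)))) :
    Module.finrank ℂ (Representation.IntertwiningMap rhoF rhoM) =
      Module.finrank ℂ (Representation.IntertwiningMap rhoF' rhoM') := by
  have hiS := truncation_equivariant h hΘF hi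
  have hjS := truncation_equivariant h hΘM hj
  have hηη : spow ι (extendMat h 1) * spow ι (extendMat h 1) = spow ι (extendMat h 1) := by
    rw [← spow_mul, extendMat_mul, one_mul]
  have hcomp : ∀ a, spow ι (extendMat h 1) * a = a → a * spow ι (extendMat h 1) = a →
      ∃ a₀, extendS h ι a₀ = a := fun a h1 h2 =>
    ⟨compressS h ι a, by rw [extendS_compressS, h1, h2]⟩
  revert hcomp hi_range hj_range hηη
  generalize spow ι (extendMat h 1) = η
  intro hi_range hj_range hηη hcomp
  obtain ⟨u, hu⟩ : ∃ u : F, u ≠ 0 := by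
    by_contra! hF
    obtain ⟨s, s', hs⟩ := hirr.exists_pair_ne
    apply hs
    apply Subrepresentation.toSubmodule_injective
    ext x
    rw [hF x]
    simp
  have hu' : i u ≠ 0 := fun h0 => hu (hi_inj (h0.trans (map_zero i).symm))
  have hηu : ΘF' η (i u) = i u := by
    obtain ⟨y, hy⟩ : i u ∈ LinearMap.range (ΘF' η) := hi_range ▸ LinearMap.mem_range_self i u
    rw [← hy, ← Module.End.mul_apply, ← map_mul, hηη]
  -- The element `ε` lies in the corner, so it comes from some `ε₀` of the smaller algebra. Both Hom
  -- spaces are fixed spaces, of `ε₀` and of `ε`, and `j` matches these because `ε` is below `η`.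
  obtain ⟨ε, hεu, hεker, hηε, hεη⟩ := exists_column_generator hirr' hΘF' hu' hηη hηu
  obtain ⟨ε₀, hε₀⟩ : ∃ ε₀, extendS h ι ε₀ = ε := hcomp ε hηε hεη
  have hinjS : Function.Injective (extendS h ι) :=
    Function.LeftInverse.injective (compressS_extendS h)
  have hε₀u : ΘF ε₀ u = u := hi_inj (by rw [hiS, hε₀, hεu])
  have hε₀ker : ∀ a, ΘF a u = 0 → a * ε₀ = 0 := fun a ha => hinjS (by
    rw [extendS_mul, hε₀, map_zero]
    exact hεker _ (by rw [← hiS, ha, map_zero]))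
  rw [finrank_intertwiningMap_eq_fixed hirr hΘF hΘM hu hε₀u hε₀ker,
    finrank_intertwiningMap_eq_fixed hirr' hΘF' hΘM' hu' hεu hεker]
  refine finrank_fixed_eq hj_inj (fun x => ?_) hj_range ?_
  · rw [hjS, hε₀]
  · rw [← map_mul, hηε]

end Truncation

/-! ### Independence of the multiplicities of the rank -/

section TensorTruncation

variable {n n' m : ℕ}

/-- The formula is the definition of the diagonal action on invertible matrices, and matrix
coefficients are polynomial in `X`. The singular case `X = extendMat h 1` is essential for
truncation. -/
theorem tensorRep_spow {mu : Fin m → YoungDiagram} {ι : Type} [Fintype ι] [DecidableEq ι]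
    {Θ : ∀ j, schurAlg (Fin (mu j).card) (Fin n) →ₐ[ℂ] Module.End ℂ (irrep n (mu j)).V}
    (hΘ : ∀ j, ∀ g : Matrix.GeneralLinearGroup (Fin n) ℂ,
      Θ j (spow _ (g : Matrix (Fin n) (Fin n) ℂ)) = (irrep n (mu j)).rho g)
    {Φ : schurAlg ι (Fin n) →ₐ[ℂ] Module.End ℂ (PiTensorProduct ℂ fun j => (irrep n (mu j)).V)}
    (hΦ : ∀ g : Matrix.GeneralLinearGroup (Fin n) ℂ,
      Φ (spow ι (g : Matrix (Fin n) (Fin n) ℂ)) = tensorRep n mu g)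
    (X : Matrix (Fin n) (Fin n) ℂ) :
    Φ (spow ι X) = PiTensorProduct.map fun j => Θ j (spow _ X) := by
  classical
  let b := fun j => Module.finBasis ℂ (irrep n (mu j)).V
  let B := Basis.piTensorProduct b
  refine B.ext fun q => B.ext_elem fun p => ?_
  have hR : ∀ f : ∀ j, Module.End ℂ (irrep n (mu j)).V,
      B.repr (PiTensorProduct.map f (B q)) p = ∏ j, (b j).repr (f j (b j (q j))) (p j) := by
    intro f
    rw [Basis.piTensorProduct_apply, PiTensorProduct.map_tprod,
      Basis.piTensorProduct_repr_tprod_apply]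
  rw [hR]
  refine eq_of_eq_on_GL
    (f := fun X => B.repr (Φ (spow ι X) (B q)) p)
    (f' := fun X => ∏ j, (b j).repr (Θ j (spow _ X) (b j (q j))) (p j)) ?_ ?_ ?_ X
  · intro X
    exact continuous_spow_add (B.coord p ∘ₗ LinearMap.applyₗ (B q) ∘ₗ Φ.toLinearMap) X
  · intro X
    refine continuous_finsetProd _ fun j _ => ?_
    exact continuous_spow_add
      ((b j).coord (p j) ∘ₗ LinearMap.applyₗ (b j (q j)) ∘ₗ (Θ j).toLinearMap) X
  · intro g
    simp only [hΦ, hΘ]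
    rw [tensorRep_apply, hR]

theorem piTensorProduct_map_injective {κ : Type} {V W : κ → Type} [∀ j, AddCommGroup (V j)]
    [∀ j, Module ℂ (V j)] [∀ j, AddCommGroup (W j)] [∀ j, Module ℂ (W j)]
    {i : ∀ j, V j →ₗ[ℂ] W j} (hi : ∀ j, Function.Injective (i j)) :
    Function.Injective (PiTensorProduct.map i) := by
  choose r hr using fun j => LinearMap.exists_leftInverse_of_injective (i j)
    (LinearMap.ker_eq_bot.mpr (hi j))
  refine Function.LeftInverse.injective (g := PiTensorProduct.map r) fun x => ?_
  rw [← LinearMap.comp_apply, ← PiTensorProduct.map_comp]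
  simp only [hr]
  rw [PiTensorProduct.map_id]
  rfl

/-- With `r` a left inverse of `i`, one has `i = P ∘ i` and `P = i ∘ (r ∘ P)` in every factor, so
each tensor map factors through the other. -/
theorem piTensorProduct_range_map {κ : Type} {V W : κ → Type} [∀ j, AddCommGroup (V j)]
    [∀ j, Module ℂ (V j)] [∀ j, AddCommGroup (W j)] [∀ j, Module ℂ (W j)]
    {i : ∀ j, V j →ₗ[ℂ] W j} {P : ∀ j, W j →ₗ[ℂ] W j}
    (hi : ∀ j, Function.Injective (i j)) (hP : ∀ j, P j ∘ₗ P j = P j)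
    (h : ∀ j, LinearMap.range (i j) = LinearMap.range (P j)) :
    LinearMap.range (PiTensorProduct.map i) = LinearMap.range (PiTensorProduct.map P) := by
  choose r hr using fun j => LinearMap.exists_leftInverse_of_injective (i j)
    (LinearMap.ker_eq_bot.mpr (hi j))
  have h1 : ∀ j, P j ∘ₗ i j = i j := fun j => LinearMap.ext fun x => by
    obtain ⟨y, hy⟩ : i j x ∈ LinearMap.range (P j) := h j ▸ LinearMap.mem_range_self (i j) x
    rw [LinearMap.comp_apply, ← hy, ← LinearMap.comp_apply, hP]
  have h2 : ∀ j, i j ∘ₗ (r j ∘ₗ P j) = P j := fun j => LinearMap.ext fun x => by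
    obtain ⟨y, hy⟩ : P j x ∈ LinearMap.range (i j) := h j ▸ LinearMap.mem_range_self (P j) x
    rw [LinearMap.comp_apply, LinearMap.comp_apply, ← hy, ← LinearMap.comp_apply (r j), hr]
    rfl
  apply le_antisymm
  · have := PiTensorProduct.map_comp (R := ℂ) P i
    simp only [h1] at this
    rw [this]
    exact LinearMap.range_comp_le_range _ _
  · have := PiTensorProduct.map_comp (R := ℂ) i fun j => r j ∘ₗ P j
    simp only [h2] at this
    rw [this]
    exact LinearMap.range_comp_le_range _ _

theorem exists_truncation_tensorRep (h : n ≤ n') {mu : Fin m → YoungDiagram}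
    (hmu : ∀ j, (mu j).colLen 0 ≤ n) {ι : Type} [Fintype ι] [DecidableEq ι]
    {Φ : schurAlg ι (Fin n') →ₐ[ℂ] Module.End ℂ (PiTensorProduct ℂ fun j => (irrep n' (mu j)).V)}
    (hΦ : ∀ g : Matrix.GeneralLinearGroup (Fin n') ℂ,
      Φ (spow ι (g : Matrix (Fin n') (Fin n') ℂ)) = tensorRep n' mu g) :
    ∃ i : PiTensorProduct ℂ (fun j => (irrep n (mu j)).V) →ₗ[ℂ]
        PiTensorProduct ℂ (fun j => (irrep n' (mu j)).V), Function.Injective i ∧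
      (∀ (g : Matrix.GeneralLinearGroup (Fin n) ℂ) x, i (tensorRep n mu g x) =
        Φ (spow ι (extendMat h (g : Matrix (Fin n) (Fin n) ℂ))) (i x)) ∧
      LinearMap.range i = LinearMap.range (Φ (spow ι (extendMat h 1))) := by
  choose Θ hΘ using fun j =>
    (irrep_isPolyHom n' (mu j) ((hmu j).trans h)).exists_algHom
  choose i hi_inj hi hi_range using fun j => exists_truncation_irrep h (hmu j) (hΘ j)
  refine ⟨PiTensorProduct.map i, piTensorProduct_map_injective hi_inj, fun g x => ?_, ?_⟩
  · rw [tensorRep_spow hΘ hΦ, tensorRep_apply, ← LinearMap.comp_apply, ← PiTensorProduct.map_comp,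
      ← LinearMap.comp_apply, ← PiTensorProduct.map_comp]
    congr 2
    funext j
    exact LinearMap.ext fun y => hi j g y
  · rw [tensorRep_spow hΘ hΦ]
    refine piTensorProduct_range_map hi_inj (fun j => ?_) hi_range
    rw [← Module.End.mul_eq_comp, ← map_mul, ← spow_mul, extendMat_mul, one_mul]

theorem lrCoeff_eq_zero {lam : YoungDiagram} {mu : Fin m → YoungDiagram}
    (hlam : lam.colLen 0 ≤ n) (hmu : ∀ j, (mu j).colLen 0 ≤ n)
    (hne : lam.card ≠ ∑ j, (mu j).card) : lrCoeff n lam mu = 0 :=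
  finrank_intertwiningMap_eq_zero (irrep_isPolyHom n lam hlam) (tensorRep_isPolyHom n mu hmu) hne

theorem lrCoeff_eq_of_le (h : n ≤ n') {lam : YoungDiagram} {mu : Fin m → YoungDiagram}
    (hlam : lam.colLen 0 ≤ n) (hmu : ∀ j, (mu j).colLen 0 ≤ n) :
    lrCoeff n lam mu = lrCoeff n' lam mu := by
  by_cases hne : lam.card = ∑ j, (mu j).card
  -- When the sizes match, source and target are modules over one Schur algebra in each rank.
  -- Otherwise both multiplicities vanish by degree.
  · obtain ⟨ΘF, hΘF⟩ := (irrep_isPolyHom n lam hlam).exists_algHom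
    obtain ⟨ΘF', hΘF'⟩ := (irrep_isPolyHom n' lam (hlam.trans h)).exists_algHom
    obtain ⟨ΘM, hΘM⟩ := (hne ▸ tensorRep_isPolyHom n mu hmu :
      IsPolyHom (tensorRep n mu) lam.card).exists_algHom
    obtain ⟨ΘM', hΘM'⟩ := (hne ▸ tensorRep_isPolyHom n' mu (fun j => (hmu j).trans h) :
      IsPolyHom (tensorRep n' mu) lam.card).exists_algHom
    obtain ⟨i, hi_inj, hi, hi_range⟩ := exists_truncation_irrep h hlam hΘF'
    obtain ⟨j, hj_inj, hj, hj_range⟩ := exists_truncation_tensorRep h hmu hΘM'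
    exact finrank_intertwiningMap_truncation h hΘF hΘM hΘF' hΘM' (irrep n lam).isIrreducible
      (irrep n' lam).isIrreducible hi_inj hi hi_range hj_inj hj hj_range
  · rw [lrCoeff_eq_zero hlam hmu hne,
      lrCoeff_eq_zero (hlam.trans h) (fun j => (hmu j).trans h) hne]

/-- The multiplicities do not depend on the rank. -/
theorem lrCoeff_eq {lam : YoungDiagram} {mu : Fin m → YoungDiagram}
    (hlam : lam.colLen 0 ≤ n) (hmu : ∀ j, (mu j).colLen 0 ≤ n)
    (hlam' : lam.colLen 0 ≤ n') (hmu' : ∀ j, (mu j).colLen 0 ≤ n') :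
    lrCoeff n lam mu = lrCoeff n' lam mu := by
  rcases le_total n n' with h | h
  · exact lrCoeff_eq_of_le h hlam hmu
  · exact (lrCoeff_eq_of_le h hlam' hmu').symm

end TensorTruncation

/-! ### Young diagrams of a given size -/

section Diagrams

theorem card_eq_sum_rowLens (lam : YoungDiagram) : lam.rowLens.sum = lam.card := by
  rw [← sum_weight (lam.colLen 0) lam le_rfl]
  unfold YoungDiagram.rowLens weight
  rw [← Finset.sum_range fun i => lam.rowLen i]
  rfl

theorem colLen_le_card (lam : YoungDiagram) : lam.colLen 0 ≤ lam.card := by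
  rw [YoungDiagram.colLen_eq_card]
  exact Finset.card_le_card (Finset.filter_subset _ _)

/-- Young diagrams of size `d` correspond to partitions of `d`. -/
def diagramEquiv (d : ℕ) : {lam : YoungDiagram // lam.card = d} ≃ Nat.Partition d :=
  Equiv.ofBijective (fun lam =>
    { parts := (lam.1.rowLens : Multiset ℕ)
      parts_pos := fun {x} hx => lam.1.pos_of_mem_rowLens x hx
      parts_sum := by rw [Multiset.sum_coe, card_eq_sum_rowLens, lam.2] }) <| by
    constructor
    · rintro ⟨lam, h⟩ ⟨lam', h'⟩ heq
      have h1 : (lam.rowLens : Multiset ℕ) = lam'.rowLens := congrArg Nat.Partition.parts heq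
      have h2 := List.Perm.eq_of_sortedGE lam.rowLens_sorted lam'.rowLens_sorted
        (Multiset.coe_eq_coe.mp h1)
      exact Subtype.ext (YoungDiagram.equivListRowLens.injective (Subtype.ext h2))
    · intro p
      let l := p.parts.sort (· ≥ ·)
      have hl : l.SortedGE := (p.parts.pairwise_sort (· ≥ ·)).sortedGE
      have hpos : ∀ x ∈ l, 0 < x := fun x hx => p.parts_pos ((Multiset.mem_sort _).mp hx)
      have h1 := YoungDiagram.rowLens_ofRowLens_eq_self (hw := hl) hpos
      have h2 : (l : Multiset ℕ) = p.parts := p.parts.sort_eq _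
      refine ⟨⟨YoungDiagram.ofRowLens l hl, ?_⟩, Nat.Partition.ext ?_⟩
      · rw [← card_eq_sum_rowLens, h1, ← Multiset.sum_coe, h2, p.parts_sum]
      · change (((YoungDiagram.ofRowLens l hl).rowLens : List ℕ) : Multiset ℕ) = _
        rw [h1, h2]

instance (d : ℕ) : Fintype {lam : YoungDiagram // lam.card = d} :=
  Fintype.ofEquiv _ (diagramEquiv d).symm

instance (d : ℕ) : DecidableEq {lam : YoungDiagram // lam.card = d} :=
  (diagramEquiv d).decidableEq

theorem weight_injective {n : ℕ} {lam lam' : YoungDiagram} (h : lam.colLen 0 ≤ n)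
    (h' : lam'.colLen 0 ≤ n) (hw : weight n lam = weight n lam') : lam = lam' := by
  have key : ∀ nu : YoungDiagram, nu.colLen 0 ≤ n → ∀ i, n ≤ i → nu.rowLen i = 0 := by
    intro nu hnu i hi
    by_contra h0
    have h4 : (i, 0) ∈ nu := YoungDiagram.mem_iff_lt_rowLen.mpr (Nat.pos_of_ne_zero h0)
    have h5 := YoungDiagram.mem_iff_lt_colLen.mp h4
    omega
  have hrow : ∀ i, lam.rowLen i = lam'.rowLen i := by
    intro i
    by_cases hi : i < n
    · exact congrFun hw ⟨i, hi⟩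
    · rw [key lam h i (not_lt.mp hi), key lam' h' i (not_lt.mp hi)]
  ext ⟨i, j⟩
  rw [YoungDiagram.mem_cells, YoungDiagram.mem_cells, YoungDiagram.mem_iff_lt_rowLen,
    YoungDiagram.mem_iff_lt_rowLen, hrow]

theorem card_conjClasses_le (d : ℕ) :
    Fintype.card (ConjClasses (Equiv.Perm (Fin d))) ≤
      Fintype.card {lam : YoungDiagram // lam.card = d} := by
  have h : Fintype.card {lam : YoungDiagram // lam.card = d} =
      Fintype.card (Nat.Partition (Fintype.card (Fin d))) := by
    rw [Fintype.card_congr (diagramEquiv d), Fintype.card_fin]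
  rw [h]
  refine Fintype.card_le_of_injective (Quotient.lift Equiv.Perm.partition fun σ τ hστ =>
    Equiv.Perm.partition_eq_of_isConj.mp hστ) ?_
  rintro ⟨σ⟩ ⟨τ⟩ hστ
  exact Quotient.sound (Equiv.Perm.partition_eq_of_isConj.mpr hστ)

end Diagrams

/-! ### The blocks of the Schur algebra -/

section Blocks

variable {d n k : ℕ} {dd : Fin k → ℕ} [∀ i, NeZero (dd i)]

theorem blockChar_independent₂ {A : Type} [Ring A] [Algebra ℂ A] (e : A ≃ₐ[ℂ] PiMat dd)
    {c : Fin k → Fin k → ℂ}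
    (h : ∀ x y, ∑ i, ∑ j, c i j * (blockChar e i x * blockChar e j y) = 0) : c = 0 := by
  ext i j
  have h1 : ∀ y, (fun i => ∑ j, c i j * blockChar e j y) = 0 := by
    intro y
    refine blockChar_independent e fun x => ?_
    rw [← h x y]
    refine Finset.sum_congr rfl fun i _ => ?_
    rw [Finset.sum_mul]
    exact Finset.sum_congr rfl fun j _ => by ring
  have h2 := blockChar_independent e (c := c i) fun y => congrFun (h1 y) i
  exact congrFun h2 j

/-- A twisted trace is a trace functional, hence a combination of block characters. The
orthogonality relation compares the two evaluations of the trace of `a ↦ x a y`, using the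
independence of products of block characters. The numbers `P σ i` play the role of irreducible
characters of the symmetric group. -/
theorem exists_permTrace_coeff (e : schurAlg (Fin d) (Fin n) ≃ₐ[ℂ] PiMat dd) :
    ∃ P : Equiv.Perm (Fin d) → Fin k → ℂ,
      (∀ σ a, permTrace σ a = ∑ i, P σ i * blockChar e i a) ∧
      (∀ σ τ, IsConj σ τ → P σ = P τ) ∧
      ∀ i j, (d.factorial : ℂ)⁻¹ * ∑ σ, P σ i * P σ j = if i = j then 1 else 0 := by
  choose P hP using fun σ : Equiv.Perm (Fin d) =>
    trace_functional_eq_sum_blockChar e (permTrace σ) (permTrace_mul_comm σ)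
  refine ⟨P, hP, fun σ τ h => ?_, fun i j => ?_⟩
  · rw [← sub_eq_zero]
    refine blockChar_independent e fun a => ?_
    simp only [Pi.sub_apply, sub_mul, Finset.sum_sub_distrib]
    rw [← hP, ← hP, permTrace_eq_of_isConj h, sub_self]
  · have h1 : (fun i j => (d.factorial : ℂ)⁻¹ * ∑ σ, P σ i * P σ j -
        if i = j then 1 else 0) = (0 : Fin k → Fin k → ℂ) := by
      refine blockChar_independent₂ e fun x y => ?_
      have h2 := (trace_mulLeft_mulRight x y).symm.trans
        (trace_mulLeft_mulRight_eq_sum_blockChar e x y)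
      simp only [sub_mul, Finset.sum_sub_distrib, ite_mul, one_mul, zero_mul,
        Finset.sum_ite_eq, Finset.mem_univ, if_true]
      rw [← h2, sub_eq_zero, Fintype.card_fin, Finset.mul_sum]
      have h3 : ∀ σ : Equiv.Perm (Fin d), (d.factorial : ℂ)⁻¹ * (permTrace σ x * permTrace σ y) =
          ∑ i, ∑ j, (d.factorial : ℂ)⁻¹ * (P σ i * P σ j) *
            (blockChar e i x * blockChar e j y) := by
        intro σ
        rw [hP, hP, Finset.sum_mul_sum, Finset.mul_sum]
        refine Finset.sum_congr rfl fun i _ => ?_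
        rw [Finset.mul_sum]
        exact Finset.sum_congr rfl fun j _ => by ring
      simp only [h3, Finset.mul_sum, Finset.sum_mul]
      rw [Finset.sum_comm (s := (Finset.univ : Finset (Equiv.Perm (Fin d))))]
      exact Finset.sum_congr rfl fun i _ => Finset.sum_comm
    exact sub_eq_zero.mp (congrFun (congrFun h1 i) j)

/-- Orthogonality makes the functions `σ ↦ P σ i` linearly independent, and they are class
functions. -/
theorem card_blocks_le (e : schurAlg (Fin d) (Fin n) ≃ₐ[ℂ] PiMat dd) :
    k ≤ Fintype.card (ConjClasses (Equiv.Perm (Fin d))) := by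
  obtain ⟨P, -, hPc, hPo⟩ := exists_permTrace_coeff e
  let v : Fin k → ConjClasses (Equiv.Perm (Fin d)) → ℂ := fun i =>
    Quotient.lift (fun σ => P σ i) fun σ τ h => congrFun (hPc σ τ h) i
  have hv : LinearIndependent ℂ v := by
    rw [Fintype.linearIndependent_iff]
    intro g hg j
    have h1 : ∀ σ, ∑ i, g i * P σ i = 0 := by
      intro σ
      have := congrFun hg (ConjClasses.mk σ)
      rw [Finset.sum_apply] at this
      exact this
    calc g j = ∑ i, g i * ((d.factorial : ℂ)⁻¹ * ∑ σ, P σ i * P σ j) := by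
          simp [hPo]
      _ = (d.factorial : ℂ)⁻¹ * ∑ σ, (∑ i, g i * P σ i) * P σ j := by
          simp only [Finset.mul_sum, Finset.sum_mul]
          rw [Finset.sum_comm]
          exact Finset.sum_congr rfl fun σ _ => Finset.sum_congr rfl fun i _ => by ring
      _ = 0 := by simp [h1]
  have := hv.fintype_card_le_finrank
  rwa [Fintype.card_fin, Module.finrank_fintype_fun_eq_card] at this

/-- Two modules on the same column are isomorphic, so a highest weight vector of one is carried to
the other, where the highest weight is unique. -/
theorem IsColumn.eq_of_irrep {lam lam' : YoungDiagram} (h : lam.colLen 0 ≤ n)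
    (h' : lam'.colLen 0 ≤ n) {e : schurAlg (Fin d) (Fin n) ≃ₐ[ℂ] PiMat dd}
    {Θ : schurAlg (Fin d) (Fin n) →ₐ[ℂ] Module.End ℂ (irrep n lam).V}
    (hΘ : ∀ g : Matrix.GeneralLinearGroup (Fin n) ℂ,
      Θ (spow _ (g : Matrix (Fin n) (Fin n) ℂ)) = (irrep n lam).rho g)
    {Θ' : schurAlg (Fin d) (Fin n) →ₐ[ℂ] Module.End ℂ (irrep n lam').V}
    (hΘ' : ∀ g : Matrix.GeneralLinearGroup (Fin n) ℂ,
      Θ' (spow _ (g : Matrix (Fin n) (Fin n) ℂ)) = (irrep n lam').rho g)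
    {i : Fin k} (hi : IsColumn e Θ i) (hi' : IsColumn e Θ' i) : lam = lam' := by
  obtain ⟨f, hf⟩ := hi
  obtain ⟨f', hf'⟩ := hi'
  obtain ⟨v, hv0, hv⟩ := (irrep n lam).exists_highestWeightVector
  obtain ⟨v', hv0', hv'⟩ := (irrep n lam').exists_highestWeightVector
  have hF : ∀ g x, f'.symm (f ((irrep n lam).rho g x)) =
      (irrep n lam').rho g (f'.symm (f x)) := by
    intro g x
    apply f'.injective
    rw [f'.apply_symm_apply, ← hΘ, ← hΘ', hf, hf', f'.apply_symm_apply]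
  refine weight_injective h h' (highestWeight_unique (irrep n lam').isPoly
    (irrep n lam').isIrreducible (v := f'.symm (f v)) ?_ ?_ hv' hv0')
  · intro b hb
    rw [← hF, hv b hb, map_smul, map_smul]
  · exact fun h0 => hv0 (f.injective (f'.symm.injective (by rw [h0, map_zero, map_zero])))

/-- The blocks of the Schur algebra of degree `d` correspond to the partitions of `d`. -/
theorem exists_blocks (h : d ≤ n) :
    ∃ (k : ℕ) (dd : Fin k → ℕ) (_ : ∀ i, NeZero (dd i))
      (e : schurAlg (Fin d) (Fin n) ≃ₐ[ℂ] PiMat dd)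
      (f : {lam : YoungDiagram // lam.card = d} ≃ Fin k)
      (Θ : ∀ lam : {lam : YoungDiagram // lam.card = d},
        schurAlg (Fin d) (Fin n) →ₐ[ℂ] Module.End ℂ (irrep n lam.1).V),
      (∀ lam, ∀ g : Matrix.GeneralLinearGroup (Fin n) ℂ,
        Θ lam (spow _ (g : Matrix (Fin n) (Fin n) ℂ)) = (irrep n lam.1).rho g) ∧
      ∀ lam, IsColumn e (Θ lam) (f lam) := by
  obtain ⟨k, dd, hdd, ⟨e⟩⟩ :=
    IsSemisimpleRing.exists_algEquiv_pi_matrix_of_isAlgClosed ℂ (schurAlg (Fin d) (Fin n))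
  have hcol : ∀ lam : {lam : YoungDiagram // lam.card = d}, lam.1.colLen 0 ≤ n := fun lam =>
    (colLen_le_card lam.1).trans (lam.2.le.trans h)
  have hex : ∀ lam : {lam : YoungDiagram // lam.card = d},
      ∃ Θ : schurAlg (Fin d) (Fin n) →ₐ[ℂ] Module.End ℂ (irrep n lam.1).V,
        ∀ g : Matrix.GeneralLinearGroup (Fin n) ℂ,
          Θ (spow _ (g : Matrix (Fin n) (Fin n) ℂ)) = (irrep n lam.1).rho g := by
    rintro ⟨lam, rfl⟩
    exact (irrep_isPolyHom n lam (hcol ⟨lam, rfl⟩)).exists_algHom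
  choose Θ hΘ using hex
  have hcolumn : ∀ lam, ∃ i, IsColumn e (Θ lam) i := by
    intro lam
    obtain ⟨v, hv0, -⟩ := (irrep n lam.1).exists_highestWeightVector
    exact exists_isColumn e (Θ lam) hv0 fun w hw x =>
      exists_schurAlg_apply_eq (irrep n lam.1).isIrreducible (hΘ lam) hw x
  choose f hf using hcolumn
  have hinj : Function.Injective f := fun lam lam' hll => Subtype.ext <|
    IsColumn.eq_of_irrep (hcol lam) (hcol lam') (hΘ lam) (hΘ lam') (hf lam) (hll ▸ hf lam')
  -- Partitions inject into blocks, blocks are at most as many as conjugacy classes, and these are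
  -- at most as many as partitions; so `f` is bijective.
  have h1 := Fintype.card_le_of_injective f hinj
  have h2 := card_blocks_le e
  have h3 := card_conjClasses_le d
  rw [Fintype.card_fin] at h1
  have hbij : Function.Bijective f := (Fintype.bijective_iff_injective_and_card f).mpr
    ⟨hinj, by rw [Fintype.card_fin]; omega⟩
  exact ⟨k, dd, hdd, e, Equiv.ofBijective f hbij, Θ, hΘ, hf⟩

end Blocks

/-! ### Characters of the irreducible representations of a given degree -/

section Characters

variable {d n : ℕ}

/-- The character of the irreducible representation with highest weight `lam`. -/
def irrChar (n : ℕ) (lam : YoungDiagram) (g : Matrix.GeneralLinearGroup (Fin n) ℂ) : ℂ :=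
  LinearMap.trace ℂ _ ((irrep n lam).rho g)

/-- The value of the power sum belonging to the cycle type of `σ` on the eigenvalues of `X`. -/
def powerTrace {ι α : Type} [Fintype ι] [DecidableEq ι] [Fintype α] (σ : Equiv.Perm ι)
    (X : Matrix α α ℂ) : ℂ :=
  ∑ I : ι → α, ∏ k, X (I k) (I (σ k))

theorem permTrace_spow {ι α : Type} [Fintype ι] [DecidableEq ι] [Fintype α] [DecidableEq α]
    (σ : Equiv.Perm ι) (X : Matrix α α ℂ) : permTrace σ (spow ι X) = powerTrace σ X := rfl

/-- This translates the block decomposition into characters of group elements. Blocks are renamed by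
partitions and permutations enter through their cycle types, so that `Q` becomes a square table. The
bound `d ≤ n` makes all partitions of `d` occur. -/
theorem exists_character_table (h : d ≤ n) :
    ∃ Q : Nat.Partition (Fintype.card (Fin d)) → {lam : YoungDiagram // lam.card = d} → ℂ,
      (∀ (σ : Equiv.Perm (Fin d)) (g : Matrix.GeneralLinearGroup (Fin n) ℂ),
        powerTrace σ (g : Matrix (Fin n) (Fin n) ℂ) =
          ∑ lam, Q σ.partition lam * irrChar n lam.1 g) ∧
      (∀ lam lam', (d.factorial : ℂ)⁻¹ * ∑ σ : Equiv.Perm (Fin d),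
        Q σ.partition lam * Q σ.partition lam' = if lam = lam' then 1 else 0) ∧
      (∀ c : {lam : YoungDiagram // lam.card = d} → ℂ,
        (∀ g, ∑ lam, c lam * irrChar n lam.1 g = 0) → c = 0) ∧
      ∀ (M : Type) [AddCommGroup M] [Module ℂ M] [FiniteDimensional ℂ M]
        (rho : Representation ℂ (Matrix.GeneralLinearGroup (Fin n) ℂ) M), IsPolyHom rho d →
        ∀ g, LinearMap.trace ℂ M (rho g) = ∑ lam : {lam : YoungDiagram // lam.card = d},
          (Module.finrank ℂ (Representation.IntertwiningMap (irrep n lam.1).rho rho) : ℂ) *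
            irrChar n lam.1 g := by
  obtain ⟨k, dd, hdd, e, f, Θ, hΘ, hf⟩ := exists_blocks h
  obtain ⟨P, hP, hPc, hPo⟩ := exists_permTrace_coeff e
  have hchar : ∀ lam (g : Matrix.GeneralLinearGroup (Fin n) ℂ),
      blockChar e (f lam) (spow _ (g : Matrix (Fin n) (Fin n) ℂ)) = irrChar n lam.1 g := by
    intro lam g
    rw [← (hf lam).trace_eq, hΘ]
    rfl
  have hsum : ∀ (c : Fin k → ℂ) (g : Matrix.GeneralLinearGroup (Fin n) ℂ),
      ∑ i, c i * blockChar e i (spow _ (g : Matrix (Fin n) (Fin n) ℂ)) =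
        ∑ lam, c (f lam) * irrChar n lam.1 g := by
    intro c g
    rw [← Equiv.sum_comp f]
    exact Finset.sum_congr rfl fun lam _ => by rw [hchar]
  -- A permutation is chosen for each cycle type; the choice is immaterial because `P` is constant
  -- on conjugacy classes.
  let r : Nat.Partition (Fintype.card (Fin d)) → Equiv.Perm (Fin d) :=
    Function.invFun Equiv.Perm.partition
  have hr : ∀ σ : Equiv.Perm (Fin d), P (r σ.partition) = P σ := fun σ =>
    hPc _ _ (Equiv.Perm.partition_eq_of_isConj.mpr (Function.invFun_eq ⟨σ, rfl⟩))
  refine ⟨fun p lam => P (r p) (f lam), fun σ g => ?_, fun lam lam' => ?_, fun c hc => ?_, ?_⟩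
  · simp only [hr]
    rw [← permTrace_spow, hP, hsum]
  · simp only [hr]
    rw [hPo]
    simp only [f.injective.eq_iff]
  · have h1 : (fun i => c (f.symm i)) = 0 := by
      refine blockChar_independent e fun a => ?_
      induction a using schurAlg_induction with
      | hg g => rw [hsum]; simpa using hc g
      | h0 => simp
      | hadd a b ha hb => simp [mul_add, Finset.sum_add_distrib, ha, hb]
      | hsmul z a ha =>
        simp only [map_smul, smul_eq_mul, mul_left_comm _ z]
        rw [← Finset.mul_sum, ha, mul_zero]
    ext lam
    simpa using congrFun h1 (f lam)
  · intro M _ _ _ rho hrho g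
    obtain ⟨Φ, hΦ⟩ := hrho.exists_algHom
    obtain ⟨c, hc, hc'⟩ := trace_eq_sum_finrank_mul_blockChar (A := schurAlg (Fin d) (Fin n))
      (s := fun g : Matrix.GeneralLinearGroup (Fin n) ℂ =>
        spow (Fin d) (g : Matrix (Fin n) (Fin n) ℂ)) e span_spow_GL hΦ
    rw [← hΦ, hc, hsum]
    exact Finset.sum_congr rfl fun lam _ => by rw [hc' _ _ _ _ (hΘ lam) (hf lam)]

/-- The Cauchy identity in degree `d`. -/
theorem sum_irrChar_mul_irrChar (h : d ≤ n) (x y : Matrix.GeneralLinearGroup (Fin n) ℂ) :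
    ∑ lam : {lam : YoungDiagram // lam.card = d}, irrChar n lam.1 x * irrChar n lam.1 y =
      (d.factorial : ℂ)⁻¹ * ∑ σ : Equiv.Perm (Fin d),
        powerTrace σ (x : Matrix (Fin n) (Fin n) ℂ) *
          powerTrace σ (y : Matrix (Fin n) (Fin n) ℂ) := by
  obtain ⟨Q, hQ, hQo, -, -⟩ := exists_character_table h
  have h3 : ∀ σ : Equiv.Perm (Fin d), (d.factorial : ℂ)⁻¹ *
      (powerTrace σ (x : Matrix (Fin n) (Fin n) ℂ) *
        powerTrace σ (y : Matrix (Fin n) (Fin n) ℂ)) =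
      ∑ lam, ∑ lam', (d.factorial : ℂ)⁻¹ * (Q σ.partition lam * Q σ.partition lam') *
        (irrChar n lam.1 x * irrChar n lam'.1 y) := by
    intro σ
    rw [hQ, hQ, Finset.sum_mul_sum, Finset.mul_sum]
    refine Finset.sum_congr rfl fun i _ => ?_
    rw [Finset.mul_sum]
    exact Finset.sum_congr rfl fun j _ => by ring
  rw [Finset.mul_sum]
  simp only [h3]
  rw [Finset.sum_comm]
  refine Finset.sum_congr rfl fun lam _ => ?_
  rw [Finset.sum_comm]
  have h4 : ∀ lam' : {lam : YoungDiagram // lam.card = d},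
      ∑ σ : Equiv.Perm (Fin d), (d.factorial : ℂ)⁻¹ * (Q σ.partition lam * Q σ.partition lam') *
        (irrChar n lam.1 x * irrChar n lam'.1 y) =
      (if lam = lam' then 1 else 0) * (irrChar n lam.1 x * irrChar n lam'.1 y) := by
    intro lam'
    rw [← Finset.sum_mul, ← Finset.mul_sum, hQo]
  simp [h4]

/-- Column orthogonality for a square matrix with orthogonal rows. -/
theorem card_fiber_mul_sum_sq {κ D S : Type} [Fintype κ] [DecidableEq κ] [Fintype D]
    [DecidableEq D] [Fintype S] (hcard : Fintype.card κ = Fintype.card D) (r : S → κ)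
    {Q : κ → D → ℂ} {N : ℂ} (hN : N ≠ 0)
    (hQ : ∀ a b, N⁻¹ * ∑ s, Q (r s) a * Q (r s) b = if a = b then 1 else 0) (p : κ) :
    ∑ s with r s = p, ∑ a, Q (r s) a ^ 2 = N := by
  -- Row orthogonality says that this rescaled transpose is a left inverse of `Q`. As the table is
  -- square it is also a right inverse, and its diagonal entry at `p` is the claim.
  let R : Matrix D κ ℂ := Matrix.of fun a q => N⁻¹ * (∑ s with r s = q, 1) * Q q a
  have h1 : R * Matrix.of Q = 1 := by
    ext a b
    rw [Matrix.mul_apply, Matrix.one_apply, ← hQ a b, Finset.mul_sum,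
      ← Finset.sum_fiberwise Finset.univ r]
    refine Finset.sum_congr rfl fun q _ => ?_
    simp only [R, Matrix.of_apply]
    rw [mul_assoc, mul_assoc, Finset.sum_mul, Finset.mul_sum]
    refine Finset.sum_congr rfl fun s hs => ?_
    rw [(Finset.mem_filter.mp hs).2, one_mul]
  have h2 := congrFun (congrFun ((Matrix.mul_eq_one_comm_of_card_eq D κ ℂ hcard.symm).mp h1) p) p
  rw [Matrix.mul_apply, Matrix.one_apply_eq] at h2
  have h3 : N⁻¹ * ∑ s with r s = p, ∑ a, Q (r s) a ^ 2 = 1 := by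
    rw [← h2, Finset.sum_comm, Finset.mul_sum]
    refine Finset.sum_congr rfl fun a _ => ?_
    simp only [R, Matrix.of_apply]
    rw [Finset.mul_sum, Finset.mul_sum, Finset.sum_mul, Finset.mul_sum]
    refine Finset.sum_congr rfl fun s hs => ?_
    rw [(Finset.mem_filter.mp hs).2]
    ring
  field_simp at h3
  exact h3

end Characters

/-! ### Words fixed by a permutation -/

section Words

variable {ι κ α β : Type} [Fintype ι] [DecidableEq ι] [Fintype κ] [DecidableEq κ]

/-- The number of words of content `d` fixed by the permutation `σ` of positions. -/
def wordCount (d : α →₀ ℕ) (σ : Equiv.Perm ι) : ℕ :=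
  Nat.card {f : ι → α // f ∘ σ = f ∧ content f = d}

theorem content_comp_equiv (e : κ ≃ ι) (f : ι → α) : content (f ∘ e) = content f :=
  Equiv.sum_comp e fun k => Finsupp.single (f k) 1

theorem wordCount_permCongr (d : α →₀ ℕ) (e : ι ≃ κ) (σ : Equiv.Perm ι) :
    wordCount d (e.permCongr σ) = wordCount d σ := by
  refine Nat.card_congr ((Equiv.arrowCongr e (Equiv.refl α)).symm.subtypeEquiv fun f => ?_)
  change _ ↔ (f ∘ e) ∘ σ = f ∘ e ∧ content (f ∘ e) = d
  rw [content_comp_equiv]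
  refine and_congr_left fun _ => ⟨fun h => ?_, fun h => ?_⟩
  · ext k
    have := congrFun h (e k)
    simpa using this
  · ext k
    have := congrFun h (e.symm k)
    simpa using this

theorem powerTrace_permCongr [Fintype α] (e : ι ≃ κ) (σ : Equiv.Perm ι) (X : Matrix α α ℂ) :
    powerTrace (e.permCongr σ) X = powerTrace σ X := by
  unfold powerTrace
  rw [← Equiv.sum_comp (Equiv.arrowCongr e (Equiv.refl α))]
  refine Finset.sum_congr rfl fun I _ => ?_
  rw [← Equiv.prod_comp e]
  refine Finset.prod_congr rfl fun k _ => ?_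
  simp

theorem powerTrace_conj [Fintype α] (σ τ : Equiv.Perm ι) (X : Matrix α α ℂ) :
    powerTrace (τ * σ * τ⁻¹) X = powerTrace σ X :=
  powerTrace_permCongr τ σ X

theorem powerTrace_sigmaCongrRight [Fintype α] {B : κ → Type}
    [∀ j, Fintype (B j)] [∀ j, DecidableEq (B j)] (s : ∀ j, Equiv.Perm (B j)) (X : Matrix α α ℂ) :
    powerTrace (Equiv.Perm.sigmaCongrRight s) X = ∏ j, powerTrace (s j) X := by
  unfold powerTrace
  rw [Finset.prod_univ_sum, Fintype.piFinset_univ,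
    ← Equiv.sum_comp (Equiv.piCurry fun (_ : κ) _ => α).symm]
  refine Finset.sum_congr rfl fun I _ => ?_
  rw [Fintype.prod_sigma]
  rfl

theorem card_sigma_fst_eq [Fintype α] [DecidableEq α] (d : α →₀ ℕ) (j : α) :
    Fintype.card {a : (Σ j, Fin (d j)) // a.1 = j} = d j := by
  rw [Fintype.card_congr (Equiv.sigmaSubtype j), Fintype.card_fin]

theorem content_sigma_fst [Fintype α] [DecidableEq α] (d : α →₀ ℕ) :
    content (Sigma.fst : (Σ j, Fin (d j)) → α) = d := by
  ext j
  rw [content_apply, card_sigma_fst_eq]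

theorem card_stabilizer_fst [Fintype α] [DecidableEq α] (d : α →₀ ℕ) :
    Fintype.card {g : Equiv.Perm (Σ j, Fin (d j)) // Sigma.fst ∘ g = Sigma.fst} =
      ∏ j, (d j).factorial := by
  rw [DomMulAct.stabilizer_card]
  exact Finset.prod_congr rfl fun j _ => by rw [card_sigma_fst_eq]

/-- The rearrangements producing a given word form a coset of the stabilizer of the standard word
`Sigma.fst`. -/
theorem card_rearrangement [Fintype α] [DecidableEq α] {d : α →₀ ℕ} {f : (Σ j, Fin (d j)) → α}
    (hf : content f = d) :
    Fintype.card {τ : Equiv.Perm (Σ j, Fin (d j)) // Sigma.fst ∘ τ = f} =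
      ∏ j, (d j).factorial := by
  obtain ⟨τ₀, rfl⟩ := exists_perm_of_content_eq ((content_sigma_fst d).trans hf.symm)
  rw [← card_stabilizer_fst]
  refine Fintype.card_congr ((Equiv.mulRight τ₀⁻¹).subtypeEquiv fun τ => ?_)
  constructor
  · intro h
    ext k
    have := congrFun h (τ₀⁻¹ k)
    simpa using this
  · intro h
    ext k
    have := congrFun h (τ₀ k)
    simpa using this

/-- The permutations `τ` are sorted by the word `Sigma.fst ∘ τ`, which runs over the fixed words of
content `d`, each reached equally often. -/
theorem card_conjugating [Fintype α] [DecidableEq α] (d : α →₀ ℕ)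
    (σ : Equiv.Perm (Σ j, Fin (d j))) :
    Fintype.card {τ : Equiv.Perm (Σ j, Fin (d j)) // (Sigma.fst ∘ τ) ∘ σ = Sigma.fst ∘ τ} =
      wordCount d σ * ∏ j, (d j).factorial := by
  classical
  let W := {f : (Σ j, Fin (d j)) → α // f ∘ σ = f ∧ content f = d}
  let e : {τ : Equiv.Perm (Σ j, Fin (d j)) // (Sigma.fst ∘ τ) ∘ σ = Sigma.fst ∘ τ} ≃
      Σ f : W, {τ : Equiv.Perm (Σ j, Fin (d j)) // Sigma.fst ∘ τ = f.1} :=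
    { toFun := fun τ => ⟨⟨Sigma.fst ∘ τ.1, τ.2, (content_comp _ _).trans (content_sigma_fst d)⟩,
        τ.1, rfl⟩
      invFun := fun x => ⟨x.2.1, by rw [x.2.2]; exact x.1.2.1⟩
      left_inv := fun _ => rfl
      right_inv := fun x => by
        obtain ⟨⟨f, hf⟩, ⟨τ, hτ⟩⟩ := x
        change Sigma.fst ∘ τ = f at hτ
        subst hτ
        rfl }
  rw [Fintype.card_congr e, Fintype.card_sigma,
    Finset.sum_congr rfl fun f _ => card_rearrangement f.2.2, Finset.sum_const, smul_eq_mul,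
    Finset.card_univ, wordCount, Nat.card_eq_fintype_card]

/-- The stabilizer of the standard word is the Young subgroup, i.e. the product of the symmetric
groups of the blocks. -/
theorem sum_stabilizer_fst [Fintype α] [DecidableEq α] (d : α →₀ ℕ)
    (F : Equiv.Perm (Σ j, Fin (d j)) → ℂ) :
    ∑ σ : {g : Equiv.Perm (Σ j, Fin (d j)) // Sigma.fst ∘ g = Sigma.fst}, F σ.1 =
      ∑ s : ∀ j, Equiv.Perm (Fin (d j)), F (Equiv.Perm.sigmaCongrRight s) := by
  let φ : (∀ j, Equiv.Perm (Fin (d j))) →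
      {g : Equiv.Perm (Σ j, Fin (d j)) // Sigma.fst ∘ g = Sigma.fst} := fun s =>
    ⟨Equiv.Perm.sigmaCongrRight s, rfl⟩
  have hφ : Function.Bijective φ := by
    refine (Fintype.bijective_iff_injective_and_card φ).mpr ⟨fun s t hst => ?_, ?_⟩
    · exact Equiv.Perm.sigmaCongrRightHom_injective (congrArg Subtype.val hst)
    · rw [card_stabilizer_fst, Fintype.card_pi]
      exact Finset.prod_congr rfl fun j _ => by rw [Fintype.card_perm, Fintype.card_fin]
  exact (hφ.sum_comp fun σ => F σ.1).symm

/-- Pairs `(σ, τ)` such that `σ` fixes the word `Sigma.fst ∘ τ` are counted twice. For fixed `σ`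
there are `wordCount d σ * ∏ j, (d j)!` of them. For fixed `τ` the condition says that `τ σ τ⁻¹`
lies in the Young subgroup. This is Frobenius reciprocity for the permutation character on words. -/
theorem sum_wordCount_mul [Fintype α] [DecidableEq α] (d : α →₀ ℕ)
    {F : Equiv.Perm (Σ j, Fin (d j)) → ℂ} (hF : ∀ σ τ, F (τ * σ * τ⁻¹) = F σ) :
    (∑ σ, (wordCount d σ : ℂ) * F σ) * ∏ j, ((d j).factorial : ℂ) =
      (Fintype.card (Equiv.Perm (Σ j, Fin (d j))) : ℂ) *
        ∑ s : ∀ j, Equiv.Perm (Fin (d j)), F (Equiv.Perm.sigmaCongrRight s) := by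
  rw [← sum_stabilizer_fst]
  have h1 : ∀ τ : Equiv.Perm (Σ j, Fin (d j)), ∑ σ : Equiv.Perm (Σ j, Fin (d j)),
      (if (Sigma.fst ∘ τ) ∘ σ = Sigma.fst ∘ τ then F σ else 0) =
        ∑ σ : {g : Equiv.Perm (Σ j, Fin (d j)) // Sigma.fst ∘ g = Sigma.fst}, F σ.1 := by
    intro τ
    rw [← Finset.sum_subtype (Finset.univ.filter fun g : Equiv.Perm (Σ j, Fin (d j)) =>
      Sigma.fst ∘ g = Sigma.fst) (by simp) F, Finset.sum_filter,
      ← Equiv.sum_comp (MulAut.conj τ⁻¹).toEquiv]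
    refine Finset.sum_congr rfl fun σ _ => ?_
    change (if (Sigma.fst ∘ τ) ∘ (τ⁻¹ * σ * τ⁻¹⁻¹ : Equiv.Perm (Σ j, Fin (d j))) = Sigma.fst ∘ τ
      then F (τ⁻¹ * σ * τ⁻¹⁻¹) else 0) = _
    rw [hF]
    refine if_congr ⟨fun h => ?_, fun h => ?_⟩ rfl rfl
    · ext k
      have := congrFun h (τ⁻¹ k)
      simpa using this
    · ext k
      have := congrFun h (τ k)
      simpa using this
  calc _ = ∑ σ : Equiv.Perm (Σ j, Fin (d j)), ∑ τ : Equiv.Perm (Σ j, Fin (d j)),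
        (if (Sigma.fst ∘ τ) ∘ σ = Sigma.fst ∘ τ then F σ else 0) := by
        rw [Finset.sum_mul]
        refine Finset.sum_congr rfl fun σ _ => ?_
        rw [← Finset.sum_filter, Finset.sum_const, ← Fintype.card_subtype, card_conjugating,
          nsmul_eq_mul]
        push_cast
        ring
    _ = _ := by
        rw [Finset.sum_comm, Finset.sum_congr rfl fun τ _ => h1 τ, Finset.sum_const,
          Finset.card_univ, nsmul_eq_mul]

end Words

/-! ### The sum of the squares of the multiplicities -/

section Squares

/-- The preceding identity is applied to a product of two power traces, which is a class function
and multiplicative over the blocks of the Young subgroup. -/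
theorem sum_wordCount_mul_powerTrace {α β : Type} [Fintype α] [DecidableEq α] [Fintype β]
    (d : α →₀ ℕ) {N : ℕ} (hN : ∑ j, d j = N) (X Y : Matrix β β ℂ) :
    (N.factorial : ℂ)⁻¹ * ∑ σ : Equiv.Perm (Fin N),
        (wordCount d σ : ℂ) * (powerTrace σ X * powerTrace σ Y) =
      ∏ j, (((d j).factorial : ℂ)⁻¹ * ∑ s : Equiv.Perm (Fin (d j)),
        powerTrace s X * powerTrace s Y) := by
  have hcard : Fintype.card (Σ j, Fin (d j)) = N := by simp [hN]
  have hN0 : (N.factorial : ℂ) ≠ 0 := by exact_mod_cast N.factorial_ne_zero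
  have hd0 : (∏ j, ((d j).factorial : ℂ)) ≠ 0 :=
    Finset.prod_ne_zero_iff.mpr fun j _ => by exact_mod_cast (d j).factorial_ne_zero
  have e : (Σ j, Fin (d j)) ≃ Fin N := Fintype.equivFinOfCardEq hcard
  have h1 := sum_wordCount_mul d (F := fun σ => powerTrace σ X * powerTrace σ Y)
    fun σ τ => by rw [powerTrace_conj, powerTrace_conj]
  rw [Fintype.card_perm, hcard] at h1
  rw [← Equiv.sum_comp e.permCongr]
  simp only [wordCount_permCongr, powerTrace_permCongr, powerTrace_sigmaCongrRight] at h1 ⊢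
  rw [Finset.prod_mul_distrib, Finset.prod_univ_sum, Fintype.piFinset_univ, Finset.prod_inv_distrib,
    inv_mul_eq_iff_eq_mul₀ hN0]
  simp only [Finset.prod_mul_distrib]
  rw [mul_left_comm, ← h1, mul_comm, mul_assoc, mul_inv_cancel₀ hd0, mul_one]

theorem sum_sum_mul_eq_sum_mul_mul {S D : Type} [Fintype S] [Fintype D] (w : S → ℂ) (a : S → D → ℂ)
    (u v : D → ℂ) :
    ∑ l, ∑ k, (∑ s, w s * (a s l * a s k)) * (u l * v k) =
      ∑ s, w s * ((∑ l, a s l * u l) * ∑ k, a s k * v k) := by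
  simp only [Finset.sum_mul]
  rw [Finset.sum_congr rfl fun l _ => Finset.sum_comm, Finset.sum_comm]
  refine Finset.sum_congr rfl fun s _ => ?_
  rw [Finset.mul_sum]
  refine Finset.sum_congr rfl fun l _ => ?_
  rw [Finset.mul_sum, Finset.mul_sum]
  exact Finset.sum_congr rfl fun k _ => by ring

theorem eq_of_sum_irrChar_mul_irrChar {n N : ℕ}
    (hind : ∀ c : {lam : YoungDiagram // lam.card = N} → ℂ,
      (∀ g, ∑ lam, c lam * irrChar n lam.1 g = 0) → c = 0)
    {c c' : {lam : YoungDiagram // lam.card = N} → {lam : YoungDiagram // lam.card = N} → ℂ}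
    (h : ∀ x y, ∑ lam, ∑ nu, c lam nu * (irrChar n lam.1 x * irrChar n nu.1 y) =
      ∑ lam, ∑ nu, c' lam nu * (irrChar n lam.1 x * irrChar n nu.1 y)) : c = c' := by
  have h1 : ∀ y, (fun lam => ∑ nu, (c lam nu - c' lam nu) * irrChar n nu.1 y) = 0 := by
    intro y
    refine hind _ fun x => ?_
    rw [← sub_eq_zero.mpr (h x y), ← Finset.sum_sub_distrib]
    refine Finset.sum_congr rfl fun lam _ => ?_
    rw [← Finset.sum_sub_distrib, Finset.sum_mul]
    exact Finset.sum_congr rfl fun nu _ => by ring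
  ext lam nu
  have h2 := hind (fun nu => c lam nu - c' lam nu) fun y => congrFun (h1 y) lam
  exact sub_eq_zero.mp (congrFun h2 nu)

/-- For a fixed multidegree, the sum of the squares of the multiplicities is the number of words
of that content fixed by a permutation, summed over the cycle types. -/
theorem sum_lrCoeff_sq {m : ℕ} (d : Fin m →₀ ℕ) {N : ℕ} (hN : ∑ j, d j = N)
    {W : Nat.Partition (Fintype.card (Fin N)) → ℕ}
    (hW : ∀ σ : Equiv.Perm (Fin N), wordCount d σ = W σ.partition) :
    ∑ lam : {lam : YoungDiagram // lam.card = N},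
      ∑ mu : ∀ j, {lam : YoungDiagram // lam.card = d j},
        lrCoeff N lam.1 (fun j => (mu j).1) ^ 2 = ∑ p, W p := by
  obtain ⟨Q, hQ, hQo, hind, hM⟩ := exists_character_table (le_refl N)
  have hN0 : (N.factorial : ℂ) ≠ 0 := by exact_mod_cast N.factorial_ne_zero
  have hdN : ∀ j, d j ≤ N := fun j =>
    (Finset.single_le_sum (f := fun j => d j) (fun _ _ => Nat.zero_le _) (Finset.mem_univ j)).trans
      hN.le
  have hmu : ∀ (mu : ∀ j, {lam : YoungDiagram // lam.card = d j}) (g),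
      ∏ j, irrChar N (mu j).1 g = ∑ lam : {lam : YoungDiagram // lam.card = N},
        (lrCoeff N lam.1 (fun j => (mu j).1) : ℂ) * irrChar N lam.1 g := by
    intro mu g
    have h1 : IsPolyHom (tensorRep N fun j => (mu j).1) N := by
      have := tensorRep_isPolyHom N (fun j => (mu j).1) fun j =>
        (colLen_le_card _).trans ((mu j).2.le.trans (hdN j))
      rwa [Finset.sum_congr rfl fun j _ => (mu j).2, hN] at this
    refine Eq.trans ?_ (hM _ _ h1 g)
    rw [tensorRep_apply, trace_piTensorProduct_map]
    rfl
  have hcoeff : (fun lam nu => ∑ mu : ∀ j, {lam : YoungDiagram // lam.card = d j},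
      (lrCoeff N lam.1 (fun j => (mu j).1) : ℂ) * lrCoeff N nu.1 (fun j => (mu j).1)) =
      fun lam nu => (N.factorial : ℂ)⁻¹ * ∑ σ : Equiv.Perm (Fin N),
        (wordCount d σ : ℂ) * (Q σ.partition lam * Q σ.partition nu) := by
    -- Both families are coefficients of one function of `(x, y)`, the product of the Cauchy kernels
    -- of degrees `d j`: the left through tensor product characters, the right through power sums.
    -- Products of irreducible characters are independent.
    refine eq_of_sum_irrChar_mul_irrChar hind fun x y => ?_
    have h1 := sum_wordCount_mul_powerTrace d hN (x : Matrix (Fin N) (Fin N) ℂ)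
      (y : Matrix (Fin N) (Fin N) ℂ)
    simp only [← sum_irrChar_mul_irrChar (hdN _)] at h1
    rw [Finset.prod_univ_sum, Fintype.piFinset_univ] at h1
    simp only [Finset.prod_mul_distrib, hmu, hQ] at h1
    have h2 := sum_sum_mul_eq_sum_mul_mul (fun σ : Equiv.Perm (Fin N) => (wordCount d σ : ℂ))
      (fun σ => Q σ.partition) (fun lam => irrChar N lam.1 x) fun lam => irrChar N lam.1 y
    have h3 := sum_sum_mul_eq_sum_mul_mul (fun _ => 1)
      (fun (mu : ∀ j, {lam : YoungDiagram // lam.card = d j})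
        (lam : {lam : YoungDiagram // lam.card = N}) => (lrCoeff N lam.1 (fun j => (mu j).1) : ℂ))
      (fun lam => irrChar N lam.1 x) fun lam => irrChar N lam.1 y
    simp only [one_mul] at h3
    rw [h3, ← h1, ← h2]
    rw [Finset.mul_sum]
    refine Finset.sum_congr rfl fun lam _ => ?_
    rw [Finset.mul_sum]
    exact Finset.sum_congr rfl fun nu _ => (mul_assoc _ _ _).symm
  have hdiag := fun lam => congrFun (congrFun hcoeff lam) lam
  -- Column orthogonality: on each cycle type the squares of the table entries add up to `N!`,
  -- cancelling the averaging factor.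
  have hfib := card_fiber_mul_sum_sq (S := Equiv.Perm (Fin N)) (by
    rw [Fintype.card_congr (diagramEquiv N), Fintype.card_fin]) Equiv.Perm.partition hN0 hQo
  have key : (((∑ lam : {lam : YoungDiagram // lam.card = N},
      ∑ mu : ∀ j, {lam : YoungDiagram // lam.card = d j},
        lrCoeff N lam.1 (fun j => (mu j).1) ^ 2 : ℕ)) : ℂ) = ((∑ p, W p : ℕ) : ℂ) := by
    push_cast
    simp only [pow_two]
    rw [Finset.sum_congr rfl fun lam _ => hdiag lam, ← Finset.mul_sum, Finset.sum_comm,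
      ← Finset.sum_fiberwise Finset.univ Equiv.Perm.partition, Finset.mul_sum]
    refine Finset.sum_congr rfl fun p _ => ?_
    have h2 : ∑ σ : Equiv.Perm (Fin N) with σ.partition = p,
        ∑ lam, (wordCount d σ : ℂ) * (Q σ.partition lam * Q σ.partition lam) =
        W p * ∑ σ : Equiv.Perm (Fin N) with σ.partition = p, ∑ lam, Q σ.partition lam ^ 2 := by
      rw [Finset.mul_sum]
      refine Finset.sum_congr rfl fun σ hσ => ?_
      rw [hW, (Finset.mem_filter.mp hσ).2, ← Finset.mul_sum]
      simp only [pow_two]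
    rw [h2, hfib, mul_left_comm, inv_mul_cancel₀ hN0, mul_one]
  exact_mod_cast key

end Squares

/-! ### Fixed words and power sums -/

section FixedWords

variable {ι α : Type} [Fintype ι] [DecidableEq ι] [Fintype α] [DecidableEq α]

theorem content_comp_fiber {Ω : Type} [Fintype Ω] [DecidableEq Ω] (π : ι → Ω) (g : Ω → α) :
    content (g ∘ π) = ∑ o, Finsupp.single (g o) (Fintype.card {k // π k = o}) := by
  unfold content
  rw [← Finset.sum_fiberwise Finset.univ π]
  refine Finset.sum_congr rfl fun o _ => ?_
  rw [Finset.sum_congr rfl fun k hk => show Finsupp.single ((g ∘ π) k) 1 = Finsupp.single (g o) 1 by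
    rw [Function.comp_apply, (Finset.mem_filter.mp hk).2], Finset.sum_const,
    Finsupp.smul_single, smul_eq_mul, mul_one, Fintype.card_subtype]

theorem coeff_prod_psum {Ω : Type} [Fintype Ω] [DecidableEq Ω] (c : Ω → ℕ) (d : α →₀ ℕ) :
    MvPolynomial.coeff d (∏ o, MvPolynomial.psum α ℕ (c o)) =
      Nat.card {g : Ω → α // ∑ o, Finsupp.single (g o) (c o) = d} := by
  classical
  unfold MvPolynomial.psum
  rw [Finset.prod_univ_sum, Fintype.piFinset_univ, MvPolynomial.coeff_sum,
    Nat.card_eq_fintype_card, Fintype.card_subtype, Finset.card_filter]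
  refine Finset.sum_congr rfl fun g _ => ?_
  have : ∏ o, (MvPolynomial.X (g o) : MvPolynomial α ℕ) ^ c o =
      MvPolynomial.monomial (∑ o, Finsupp.single (g o) (c o)) 1 := by
    rw [MvPolynomial.monomial_sum_one]
    exact Finset.prod_congr rfl fun o _ => MvPolynomial.X_pow_eq_monomial
  rw [this, MvPolynomial.coeff_monomial]

/-- A fixed word is constant on cycles, so it is a choice of one letter per cycle, counted with the
cycle length. Expanding the product of power sums makes exactly these choices. -/
theorem wordCount_eq_coeff_of_fibers {Ω : Type} [Fintype Ω] [DecidableEq Ω] {σ : Equiv.Perm ι}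
    {π : ι → Ω} (hsurj : Function.Surjective π) (hσ : ∀ k, π (σ k) = π k)
    (hπ : ∀ k l, π k = π l → σ.SameCycle k l) (d : α →₀ ℕ) :
    wordCount d σ = MvPolynomial.coeff d
      (∏ o, MvPolynomial.psum α ℕ (Fintype.card {k // π k = o})) := by
  rw [coeff_prod_psum]
  symm
  refine Nat.card_congr (Equiv.ofBijective (fun g => ⟨g.1 ∘ π, ?_, ?_⟩) ⟨?_, ?_⟩)
  · ext k
    simp [hσ]
  · rw [content_comp_fiber]
    exact g.2
  · intro g g' h
    exact Subtype.ext (hsurj.injective_comp_right (congrArg Subtype.val h))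
  · rintro ⟨f, hf, hfd⟩
    have hfac : ∀ k l, π k = π l → f k = f l := by
      intro k l hkl
      obtain ⟨z, rfl⟩ := hπ k l hkl
      have hz : ∀ (τ : Equiv.Perm ι), f ∘ τ = f → f ∘ (τ⁻¹ : Equiv.Perm ι) = f := by
        intro τ hτ
        ext k
        have := congrFun hτ (τ⁻¹ k)
        simpa using this.symm
      have hn : ∀ n : ℕ, f ∘ (σ ^ n : Equiv.Perm ι) = f := by
        intro n
        induction n with
        | zero => rfl
        | succ n ih =>
          rw [pow_succ, Equiv.Perm.coe_mul, ← Function.comp_assoc, ih, hf]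
      rcases Int.eq_nat_or_neg z with ⟨n, rfl | rfl⟩
      · rw [zpow_natCast]
        exact (congrFun (hn n) k).symm
      · rw [zpow_neg, zpow_natCast]
        exact (congrFun (hz _ (hn n)) k).symm
    have hfeq : (fun o => f (Function.surjInv hsurj o)) ∘ π = f := by
      ext k
      exact hfac _ _ (Function.surjInv_eq hsurj (π k))
    refine ⟨⟨fun o => f (Function.surjInv hsurj o), ?_⟩, Subtype.ext hfeq⟩
    rw [← content_comp_fiber, hfeq, hfd]

/-- The number of words fixed by a permutation is a coefficient of a product of power sums. -/
theorem wordCount_eq_coeff (d : α →₀ ℕ) (σ : Equiv.Perm ι) :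
    wordCount d σ =
      MvPolynomial.coeff d (σ.partition.parts.map (MvPolynomial.psum α ℕ)).prod := by
  -- This indexes all cycles. Fixed points are added separately since the cycle factors, like
  -- `cycleType`, omit them, whereas `partition` records them as parts equal to `1`.
  let Ω := {c // c ∈ σ.cycleFactorsFinset} ⊕ {k // k ∉ σ.support}
  let π : ι → Ω := fun k => if h : k ∈ σ.support then
    Sum.inl ⟨σ.cycleOf k, Equiv.Perm.cycleOf_mem_cycleFactorsFinset_iff.mpr h⟩ else Sum.inr ⟨k, h⟩
  have hinl : ∀ k c, π k = Sum.inl c ↔ k ∈ c.1.support := by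
    intro k c
    by_cases h : k ∈ σ.support
    · simp only [π, dif_pos h]
      constructor
      · intro hc
        obtain rfl := Sum.inl_injective hc
        exact Equiv.Perm.mem_support_cycleOf_iff.mpr ⟨Equiv.Perm.SameCycle.refl _ _, h⟩
      · exact fun hk => congrArg Sum.inl (Subtype.ext (Equiv.Perm.cycle_is_cycleOf hk c.2).symm)
    · simp only [π, dif_neg h, reduceCtorEq, false_iff]
      exact fun hk => h (Equiv.Perm.mem_cycleFactorsFinset_support_le c.2 hk)
  have hinr : ∀ k x, π k = Sum.inr x ↔ k = x.1 := by
    intro k x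
    by_cases h : k ∈ σ.support
    · simp only [π, dif_pos h, reduceCtorEq, false_iff]
      rintro rfl
      exact x.2 h
    · simp only [π, dif_neg h]
      exact Sum.inr_injective.eq_iff.trans Subtype.ext_iff
  have hsurj : Function.Surjective π := by
    rintro (c | x)
    · obtain ⟨k, hk⟩ := (Equiv.Perm.mem_cycleFactorsFinset_iff.mp c.2).1.nonempty_support
      exact ⟨k, (hinl k c).mpr hk⟩
    · exact ⟨x.1, (hinr _ x).mpr rfl⟩
  have hσ : ∀ k, π (σ k) = π k := by
    intro k
    rcases hk : π k with c | x
    · rw [hinl] at hk ⊢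
      rw [← (Equiv.Perm.mem_cycleFactorsFinset_iff.mp c.2).2 k hk]
      exact Equiv.Perm.apply_mem_support.mpr hk
    · rw [hinr] at hk ⊢
      rw [hk]
      exact Equiv.Perm.notMem_support.mp x.2
  have hπ : ∀ k l, π k = π l → σ.SameCycle k l := by
    intro k l h
    rcases hk : π k with c | x
    · have hl := (hinl l c).mp (h ▸ hk)
      rw [hinl] at hk
      rw [Equiv.Perm.cycle_is_cycleOf hk c.2] at hl
      exact (Equiv.Perm.mem_support_cycleOf_iff.mp hl).1
    · have hl := (hinr l x).mp (h ▸ hk)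
      rw [hinr] at hk
      rw [hk, hl]
  rw [wordCount_eq_coeff_of_fibers hsurj hσ hπ, Fintype.prod_sum_type,
    Equiv.Perm.parts_partition, Multiset.map_add, Multiset.prod_add, Equiv.Perm.cycleType_def,
    Multiset.map_map, Multiset.map_replicate, Multiset.prod_replicate]
  congr 2
  · have h1 : ∀ c : {c // c ∈ σ.cycleFactorsFinset},
        Fintype.card {k // π k = Sum.inl c} = c.1.support.card := by
      intro c
      simp only [hinl]
      exact Fintype.card_coe _
    simp only [h1]
    exact Finset.prod_coe_sort σ.cycleFactorsFinset
      fun c => MvPolynomial.psum α ℕ c.support.card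
  · have h1 : ∀ x : {k // k ∉ σ.support}, Fintype.card {k // π k = Sum.inr x} = 1 := by
      intro x
      simp only [hinr]
      exact Fintype.card_subtype_eq _
    simp only [h1, Finset.prod_const, Finset.card_univ]
    congr 1
    rw [Fintype.card_subtype_compl, Fintype.card_coe]

end FixedWords

/-! ### Partitions and exponent vectors -/

section Partitions

/-- The multiset in which `i + 1` occurs `a i` times. -/
def multisetOfCount {N : ℕ} (a : Fin N → ℕ) : Multiset ℕ :=
  ∑ i, Multiset.replicate (a i) ((i : ℕ) + 1)

theorem count_multisetOfCount {N : ℕ} (a : Fin N → ℕ) (j : Fin N) :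
    (multisetOfCount a).count ((j : ℕ) + 1) = a j := by
  rw [multisetOfCount, Multiset.count_sum', Finset.sum_eq_single j]
  · rw [Multiset.count_replicate_self]
  · intro i _ hij
    rw [Multiset.count_replicate, if_neg]
    exact fun h => hij (Fin.ext (Nat.succ_injective h))
  · simp

theorem exists_of_mem_multisetOfCount {N : ℕ} {a : Fin N → ℕ} {k : ℕ}
    (hk : k ∈ multisetOfCount a) : ∃ i : Fin N, k = i + 1 := by
  obtain ⟨i, -, hi⟩ := Multiset.mem_sum.mp hk
  exact ⟨i, Multiset.eq_of_mem_replicate hi⟩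

theorem multisetOfCount_count {N : ℕ} {s : Multiset ℕ} (hs : ∀ k ∈ s, 0 < k ∧ k ≤ N) :
    multisetOfCount (fun i : Fin N => s.count ((i : ℕ) + 1)) = s := by
  ext k
  by_cases hk : ∃ i : Fin N, k = i + 1
  · obtain ⟨i, rfl⟩ := hk
    rw [count_multisetOfCount]
  · rw [Multiset.count_eq_zero.mpr fun h => hk (exists_of_mem_multisetOfCount h),
      Multiset.count_eq_zero.mpr fun h => hk ?_]
    obtain ⟨h1, h2⟩ := hs k h
    exact ⟨⟨k - 1, by omega⟩, by simp; omega⟩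

theorem prod_map_multisetOfCount {R : Type} [CommMonoid R] {N : ℕ} (a : Fin N → ℕ) (x : ℕ → R) :
    ((multisetOfCount a).map x).prod = ∏ i : Fin N, x ((i : ℕ) + 1) ^ a i := by
  have h : ((multisetOfCount a).map x).prod =
      ∏ i : Fin N, ((Multiset.replicate (a i) ((i : ℕ) + 1)).map x).prod := by
    unfold multisetOfCount
    induction (Finset.univ : Finset (Fin N)) using Finset.induction_on with
    | empty => simp
    | insert i s hi ih =>
      rw [Finset.sum_insert hi, Finset.prod_insert hi, Multiset.map_add, Multiset.prod_add, ih]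
  rw [h]
  exact Finset.prod_congr rfl fun i _ => by
    rw [Multiset.map_replicate, Multiset.prod_replicate]

theorem sum_multisetOfCount {N : ℕ} (a : Fin N → ℕ) :
    (multisetOfCount a).sum = ∑ i : Fin N, a i * ((i : ℕ) + 1) := by
  unfold multisetOfCount
  rw [Multiset.sum_sum]
  simp

/-- A partition of `N` is recorded by the multiplicities of the parts `1, …, N`. These are at most
`N`, so the box of exponents loses nothing. -/
theorem sum_partition_prod {R : Type} [CommSemiring R] (N : ℕ) (x : ℕ → R) :
    ∑ p : Nat.Partition N, (p.parts.map x).prod =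
      ∑ a ∈ Fintype.piFinset fun _ : Fin N => Finset.range (N + 1) with
        ∑ i : Fin N, a i * ((i : ℕ) + 1) = N, ∏ i : Fin N, x ((i : ℕ) + 1) ^ a i := by
  have hparts : ∀ p : Nat.Partition N, ∀ k ∈ p.parts, 0 < k ∧ k ≤ N := fun p k hk =>
    ⟨p.parts_pos hk, (Multiset.le_sum_of_mem hk).trans p.parts_sum.le⟩
  have hp : ∀ p : Nat.Partition N, multisetOfCount (fun i : Fin N => p.parts.count ((i : ℕ) + 1)) =
      p.parts := fun p => multisetOfCount_count (hparts p)
  have hsum : ∀ p : Nat.Partition N,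
      ∑ i : Fin N, p.parts.count ((i : ℕ) + 1) * ((i : ℕ) + 1) = N := fun p => by
    rw [← sum_multisetOfCount, hp, p.parts_sum]
  refine Finset.sum_bij (fun p _ i => p.parts.count ((i : ℕ) + 1)) (fun p _ => ?_)
    (fun p _ p' _ h => ?_) (fun a ha => ?_) fun p _ => ?_
  · refine Finset.mem_filter.mpr ⟨Fintype.mem_piFinset.mpr fun i => ?_, hsum p⟩
    have h1 := Finset.single_le_sum (f := fun i : Fin N => p.parts.count ((i : ℕ) + 1) *
      ((i : ℕ) + 1)) (fun _ _ => Nat.zero_le _) (Finset.mem_univ i)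
    rw [hsum] at h1
    have h2 : p.parts.count ((i : ℕ) + 1) ≤ p.parts.count ((i : ℕ) + 1) * ((i : ℕ) + 1) :=
      Nat.le_mul_of_pos_right _ (Nat.succ_pos _)
    exact Finset.mem_range.mpr (by omega)
  · refine Nat.Partition.ext ?_
    rw [← hp p, ← hp p', h]
  · have hN := (Finset.mem_filter.mp ha).2
    refine ⟨⟨multisetOfCount a, fun {k} hk => ?_, by rw [sum_multisetOfCount, hN]⟩,
      Finset.mem_univ _, funext fun i => count_multisetOfCount a i⟩
    obtain ⟨i, rfl⟩ := exists_of_mem_multisetOfCount hk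
    exact Nat.succ_pos _
  · rw [← prod_map_multisetOfCount, hp]

end Partitions

/-! ### Power series modulo high coefficients -/

section LowCoefficients

open MvPowerSeries

/-- The power series whose coefficients at all exponents `e ≤ D` vanish. -/
def lowIdeal (D : ℕ →₀ ℕ) : Ideal (MvPowerSeries ℕ ℤ) where
  carrier := {f | ∀ e ≤ D, coeff e f = 0}
  add_mem' hf hg e he := by rw [map_add, hf e he, hg e he, add_zero]
  zero_mem' e _ := map_zero _
  smul_mem' c f hf e he := by
    classical
    rw [smul_eq_mul, coeff_mul]
    refine Finset.sum_eq_zero fun p hp => ?_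
    have h1 : p.2 ≤ e := (Finset.HasAntidiagonal.mem_antidiagonal.mp hp) ▸ le_add_self
    rw [hf p.2 (h1.trans he), mul_zero]

theorem mk_lowIdeal_eq_iff {D : ℕ →₀ ℕ} {f g : MvPowerSeries ℕ ℤ} :
    Ideal.Quotient.mk (lowIdeal D) f = Ideal.Quotient.mk (lowIdeal D) g ↔
      ∀ e ≤ D, coeff e f = coeff e g := by
  rw [Ideal.Quotient.eq]
  change (∀ e ≤ D, coeff e (f - g) = 0) ↔ _
  simp only [map_sub, sub_eq_zero]

theorem coeff_powerSum {k : ℕ} (hk : k ≠ 0) (e : ℕ →₀ ℕ) :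
    coeff e (powerSum k) = ∑' j : ℕ, coeff e ((X j : MvPowerSeries ℕ ℤ) ^ k) :=
  ((WithPiTopology.hasSum_iff_hasSum_coeff.mp (summable_X_pow hk).hasSum) e).tsum_eq.symm

/-- All monomials of `f` have degree `k`. -/
def IsOfDegree (f : MvPowerSeries ℕ ℤ) (k : ℕ) : Prop :=
  ∀ e : ℕ →₀ ℕ, e.degree ≠ k → coeff e f = 0

theorem isOfDegree_powerSum {k : ℕ} (hk : k ≠ 0) : IsOfDegree (powerSum k) k := by
  classical
  intro e he
  rw [coeff_powerSum hk]
  refine (tsum_congr fun j => ?_).trans tsum_zero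
  rw [coeff_X_pow, if_neg]
  rintro rfl
  exact he (by simp)

theorem isOfDegree_one : IsOfDegree 1 0 := by
  classical
  intro e he
  rw [coeff_one, if_neg]
  rintro rfl
  exact he (map_zero _)

theorem IsOfDegree.mul {f g : MvPowerSeries ℕ ℤ} {k l : ℕ} (hf : IsOfDegree f k)
    (hg : IsOfDegree g l) : IsOfDegree (f * g) (k + l) := by
  classical
  intro e he
  rw [coeff_mul]
  refine Finset.sum_eq_zero fun p hp => ?_
  by_cases h1 : p.1.degree = k
  · rw [hg p.2, mul_zero]
    rintro rfl
    exact he (by rw [← Finset.HasAntidiagonal.mem_antidiagonal.mp hp, map_add, h1])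
  · rw [hf p.1 h1, zero_mul]

theorem IsOfDegree.pow {f : MvPowerSeries ℕ ℤ} {k : ℕ} (hf : IsOfDegree f k) (a : ℕ) :
    IsOfDegree (f ^ a) (a * k) := by
  induction a with
  | zero => simpa using isOfDegree_one
  | succ a ih => simpa [pow_succ, Nat.succ_mul] using ih.mul hf

theorem isOfDegree_prod {κ : Type} (s : Finset κ) {f : κ → MvPowerSeries ℕ ℤ} {k : κ → ℕ}
    (hf : ∀ i, IsOfDegree (f i) (k i)) : IsOfDegree (∏ i ∈ s, f i) (∑ i ∈ s, k i) := by
  classical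
  induction s using Finset.induction_on with
  | empty => simpa using isOfDegree_one
  | insert i s hi ih =>
    rw [Finset.prod_insert hi, Finset.sum_insert hi]
    exact (hf i).mul ih

theorem mk_eq_zero_of_isOfDegree {D : ℕ →₀ ℕ} {f : MvPowerSeries ℕ ℤ} {k : ℕ}
    (hf : IsOfDegree f k) (hk : D.degree < k) : Ideal.Quotient.mk (lowIdeal D) f = 0 := by
  rw [← map_zero (Ideal.Quotient.mk (lowIdeal D)), mk_lowIdeal_eq_iff]
  intro e he
  rw [map_zero]
  refine hf e fun h => ?_
  have := Finsupp.degree_mono he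
  omega

/-- The remainder of the geometric sum is a multiple of `powerSum k ^ (D.degree + 1)`, whose degree
exceeds that of `D`. -/
theorem mk_geomFactor {D : ℕ →₀ ℕ} {k : ℕ} (hk : k ≠ 0) :
    Ideal.Quotient.mk (lowIdeal D) (geomFactor k) =
      Ideal.Quotient.mk (lowIdeal D) (∑ a ∈ Finset.range (D.degree + 1), powerSum k ^ a) := by
  have h1 : (1 - powerSum k) * ∑ a ∈ Finset.range (D.degree + 1), powerSum k ^ a =
      1 - powerSum k ^ (D.degree + 1) := mul_neg_geom_sum _ _
  have h2 := (isOfDegree_powerSum hk).pow (D.degree + 1)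
  have h3 := mk_eq_zero_of_isOfDegree (D := D) h2
    (lt_of_lt_of_le (Nat.lt_succ_self _) (Nat.le_mul_of_pos_right _ (Nat.pos_of_ne_zero hk)))
  have h4 : ∑ a ∈ Finset.range (D.degree + 1), powerSum k ^ a =
      geomFactor k - geomFactor k * powerSum k ^ (D.degree + 1) := by
    calc _ = geomFactor k * ((1 - powerSum k) *
          ∑ a ∈ Finset.range (D.degree + 1), powerSum k ^ a) := by
          rw [← mul_assoc, mul_comm (geomFactor k), mul_geomFactor hk, one_mul]
      _ = _ := by rw [h1, mul_sub, mul_one]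
  rw [h4, map_sub, map_mul, h3, mul_zero, sub_zero]

/-- Here `powerSum k` is already zero in the quotient, so the inverse of `1 - powerSum k` is `1`. -/
theorem mk_geomFactor_of_lt {D : ℕ →₀ ℕ} {k : ℕ} (hk : D.degree < k) :
    Ideal.Quotient.mk (lowIdeal D) (geomFactor k) = 1 := by
  have hk0 : k ≠ 0 := by omega
  have h1 := mk_eq_zero_of_isOfDegree (isOfDegree_powerSum hk0) hk
  have h2 := congrArg (Ideal.Quotient.mk (lowIdeal D)) (mul_geomFactor hk0)
  rwa [map_mul, map_sub, h1, map_one, sub_zero, one_mul] at h2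

/-- The coefficient of the product of the geometric series is a sum over partitions. -/
theorem coeff_prod_geomFactor (D : ℕ →₀ ℕ) :
    coeff D (∏ k ∈ Finset.range D.degree, geomFactor (k + 1)) =
      ∑ p : Nat.Partition D.degree, coeff D (p.parts.map powerSum).prod := by
  have h1 : Ideal.Quotient.mk (lowIdeal D) (∏ k ∈ Finset.range D.degree, geomFactor (k + 1)) =
      Ideal.Quotient.mk (lowIdeal D) (∏ k : Fin D.degree,
        ∑ a ∈ Finset.range (D.degree + 1), powerSum ((k : ℕ) + 1) ^ a) := by
    rw [Finset.prod_range, map_prod, map_prod]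
    exact Finset.prod_congr rfl fun k _ => mk_geomFactor (Nat.succ_ne_zero _)
  rw [mk_lowIdeal_eq_iff.mp h1 D le_rfl, Finset.prod_univ_sum, ← map_sum, sum_partition_prod,
    map_sum, map_sum, Finset.sum_filter]
  refine Finset.sum_congr rfl fun a _ => ?_
  -- An exponent vector whose weight is not `D.degree` gives a series homogeneous of another degree,
  -- which has no coefficient at `D`.
  split_ifs with h
  · rfl
  · have h2 := isOfDegree_prod Finset.univ (f := fun i : Fin D.degree =>
      powerSum ((i : ℕ) + 1) ^ a i) fun i =>
        (isOfDegree_powerSum (Nat.succ_ne_zero _)).pow (a i)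
    exact h2 D fun h' => h h'.symm

/-- The product of all the geometric series. -/
def geomProduct : MvPowerSeries ℕ ℤ :=
  fun D => coeff D (∏ k ∈ Finset.range D.degree, geomFactor (k + 1))

theorem coeff_geomProduct (D : ℕ →₀ ℕ) :
    coeff D geomProduct = coeff D (∏ k ∈ Finset.range D.degree, geomFactor (k + 1)) := rfl

/-- Factors with parameter above `D.degree` do not affect the coefficient at `D`, so it is constant
along the finite sets containing `range D.degree`. -/
theorem hasProd_geomFactor : HasProd (fun k : ℕ => geomFactor (k + 1)) geomProduct := by
  rw [HasProd, SummationFilter.unconditional_filter, WithPiTopology.tendsto_iff_coeff_tendsto]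
  intro D
  refine tendsto_const_nhds.congr' ?_
  filter_upwards [Filter.eventually_ge_atTop (Finset.range D.degree)] with s hs
  rw [coeff_geomProduct]
  refine mk_lowIdeal_eq_iff.mp ?_ D le_rfl
  rw [map_prod, map_prod]
  refine Finset.prod_subset hs fun k _ hk => mk_geomFactor_of_lt ?_
  rw [Finset.mem_range] at hk
  omega

end LowCoefficients

/-! ### The coefficients of the product -/

section Coefficients

variable {D : ℕ →₀ ℕ} {m : ℕ}

/-- The first `m` exponents. -/
def restrictExponent (D : ℕ →₀ ℕ) (m : ℕ) : Fin m →₀ ℕ :=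
  D.comapDomain Fin.val Fin.val_injective.injOn

theorem restrictExponent_apply (j : Fin m) : restrictExponent D m j = D j := rfl

theorem mapDomain_restrictExponent (hm : ∀ j, m ≤ j → D j = 0) :
    (restrictExponent D m).mapDomain Fin.val = D := by
  refine Finsupp.mapDomain_comapDomain _ Fin.val_injective _ fun j hj => ?_
  by_contra h
  refine Finsupp.mem_support_iff.mp hj (hm j ?_)
  by_contra h'
  exact h ⟨⟨j, not_le.mp h'⟩, rfl⟩

theorem sum_restrictExponent (hm : ∀ j, m ≤ j → D j = 0) :
    ∑ j, restrictExponent D m j = D.degree := by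
  rw [Finsupp.degree_apply]
  simp only [restrictExponent_apply]
  rw [← Finset.sum_range fun j => D j]
  symm
  refine Finset.sum_subset (fun j hj => ?_) fun j _ hj => Finsupp.notMem_support_iff.mp hj
  by_contra h
  exact Finsupp.mem_support_iff.mp hj (hm j (not_lt.mp fun h' => h (Finset.mem_range.mpr h')))

/-- Polynomials in `m` variables as power series. -/
def polyToSeries (m : ℕ) : MvPolynomial (Fin m) ℕ →+* MvPowerSeries ℕ ℤ :=
  MvPolynomial.coeToMvPowerSeries.ringHom.comp
    ((MvPolynomial.rename (R := ℤ) (Fin.val : Fin m → ℕ)).toRingHom.comp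
      (MvPolynomial.map (Nat.castRingHom ℤ)))

theorem coeff_polyToSeries (hm : ∀ j, m ≤ j → D j = 0) (p : MvPolynomial (Fin m) ℕ) :
    MvPowerSeries.coeff D (polyToSeries m p) =
      ((MvPolynomial.coeff (restrictExponent D m) p : ℕ) : ℤ) := by
  change MvPowerSeries.coeff D ((MvPolynomial.rename (R := ℤ) (Fin.val : Fin m → ℕ)
    (MvPolynomial.map (Nat.castRingHom ℤ) p) : MvPolynomial ℕ ℤ) : MvPowerSeries ℕ ℤ) = _
  rw [MvPolynomial.coeff_coe]
  conv_lhs => rw [← mapDomain_restrictExponent hm]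
  rw [MvPolynomial.coeff_rename_mapDomain _ Fin.val_injective, MvPolynomial.coeff_map]
  rfl

theorem polyToSeries_psum (k : ℕ) : polyToSeries m (MvPolynomial.psum (Fin m) ℕ k) =
    ∑ j : Fin m, (MvPowerSeries.X (j : ℕ) : MvPowerSeries ℕ ℤ) ^ k := by
  rw [MvPolynomial.psum, map_sum]
  refine Finset.sum_congr rfl fun j _ => ?_
  rw [map_pow]
  congr 1
  simp [polyToSeries]

/-- A positive power of a variable of index at least `m` does not divide any monomial below `D`, so
the infinite sum may be cut off at `m`. -/
theorem mk_powerSum (hm : ∀ j, m ≤ j → D j = 0) {k : ℕ} (hk : k ≠ 0) :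
    Ideal.Quotient.mk (lowIdeal D) (powerSum k) =
      Ideal.Quotient.mk (lowIdeal D) (polyToSeries m (MvPolynomial.psum (Fin m) ℕ k)) := by
  classical
  rw [mk_lowIdeal_eq_iff]
  intro e he
  rw [polyToSeries_psum, map_sum, coeff_powerSum hk, tsum_eq_sum (s := Finset.range m),
    Finset.sum_range]
  intro j hj
  rw [MvPowerSeries.coeff_X_pow, if_neg]
  rintro rfl
  have h1 := he j
  rw [Finsupp.single_eq_same, hm j (not_lt.mp fun h => hj (Finset.mem_range.mpr h))] at h1
  exact hk (Nat.le_zero.mp h1)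

theorem coeff_prod_powerSum (hm : ∀ j, m ≤ j → D j = 0) {s : Multiset ℕ} (hs : ∀ k ∈ s, k ≠ 0) :
    MvPowerSeries.coeff D (s.map powerSum).prod =
      ((MvPolynomial.coeff (restrictExponent D m)
        (s.map (MvPolynomial.psum (Fin m) ℕ)).prod : ℕ) : ℤ) := by
  rw [← coeff_polyToSeries hm]
  refine mk_lowIdeal_eq_iff.mp ?_ D le_rfl
  rw [map_multiset_prod, map_multiset_prod, map_multiset_prod]
  simp only [Multiset.map_map]
  exact congrArg _ (Multiset.map_congr rfl fun k hk => mk_powerSum hm (hs k hk))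

theorem sum_lrCoeff_sq_eq_coeff (hm : ∀ j, m ≤ j → D j = 0) :
    ∑ lam : {lam : YoungDiagram // lam.card = D.degree},
      ∑ mu : ∀ j : Fin m, {lam : YoungDiagram // lam.card = D j},
        (lrCoeff D.degree lam.1 (fun j => (mu j).1) : ℤ) ^ 2 =
      MvPowerSeries.coeff D geomProduct := by
  rw [coeff_geomProduct, coeff_prod_geomFactor]
  have h1 := sum_lrCoeff_sq (restrictExponent D m) (sum_restrictExponent hm)
    (W := fun p => MvPolynomial.coeff (restrictExponent D m)
      (p.parts.map (MvPolynomial.psum (Fin m) ℕ)).prod) fun σ => wordCount_eq_coeff _ σ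
  -- Cycle types are partitions of `Fintype.card (Fin _)`, equal to `D.degree` only propositionally;
  -- the sum is transported along this equality.
  have h2 : ∀ r, r = D.degree → ∑ p : Nat.Partition r, MvPolynomial.coeff (restrictExponent D m)
      (p.parts.map (MvPolynomial.psum (Fin m) ℕ)).prod =
      ∑ p : Nat.Partition D.degree, MvPolynomial.coeff (restrictExponent D m)
        (p.parts.map (MvPolynomial.psum (Fin m) ℕ)).prod := by
    rintro r rfl
    rfl
  rw [h2 _ (Fintype.card_fin _)] at h1
  rw [Finset.sum_congr rfl fun p _ => coeff_prod_powerSum hm fun k hk => (p.parts_pos hk).ne',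
    ← Nat.cast_sum, ← h1]
  push_cast
  rfl

end Coefficients

/-! ### Sequences of partitions of given sizes -/

section Sequences

variable {D : ℕ →₀ ℕ} {m : ℕ}

theorem PartitionSeq.sizes_apply (mu : PartitionSeq) (j : ℕ) : mu.sizes j = (mu.1 j).card := rfl

theorem card_eq_zero_iff {lam : YoungDiagram} : lam.card = 0 ↔ lam = ⊥ := by
  constructor
  · intro h
    ext c
    rw [Finset.card_eq_zero.mp h]
    simp
  · rintro rfl
    rfl

/-- The number of entries of `D` up to its last nonzero entry. -/
def exponentLength (D : ℕ →₀ ℕ) : ℕ := sInf {m | ∀ j, m ≤ j → D j = 0}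

theorem eq_zero_of_exponentLength_le (D : ℕ →₀ ℕ) : ∀ j, exponentLength D ≤ j → D j = 0 := by
  have hne : {m | ∀ j, m ≤ j → D j = 0}.Nonempty := by
    refine ⟨D.support.sup id + 1, fun j hj => ?_⟩
    by_contra h
    have := Finset.le_sup (f := id) (Finsupp.mem_support_iff.mpr h)
    rw [id] at this
    omega
  exact Nat.sInf_mem hne

/-- A partition is empty exactly when its size is zero, so the length of a sequence depends only on
its exponent. -/
theorem PartitionSeq.length_eq (mu : PartitionSeq) : mu.length = exponentLength mu.sizes := by
  unfold PartitionSeq.length exponentLength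
  simp only [PartitionSeq.sizes_apply, card_eq_zero_iff]

/-- The sequence of partitions with given first terms, followed by empty partitions. -/
def extendSeq (mu : Fin m → YoungDiagram) : PartitionSeq :=
  ⟨fun j => if h : j < m then mu ⟨j, h⟩ else ⊥, m, fun _ hj => dif_neg (not_lt.mpr hj)⟩

theorem extendSeq_apply (mu : Fin m → YoungDiagram) (j : Fin m) : (extendSeq mu).1 j = mu j :=
  dif_pos j.2

theorem sizes_extendSeq (hm : ∀ j, m ≤ j → D j = 0)
    (mu : ∀ j : Fin m, {lam : YoungDiagram // lam.card = D j}) :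
    (extendSeq fun j => (mu j).1).sizes = D := by
  ext j
  rw [PartitionSeq.sizes_apply]
  by_cases h : j < m
  · rw [extendSeq_apply _ ⟨j, h⟩, (mu ⟨j, h⟩).2]
  · rw [hm j (not_lt.mp h)]
    exact card_eq_zero_iff.mpr (dif_neg h)

theorem lrCoeff_toFin {n : ℕ} {lam : YoungDiagram} (mu : PartitionSeq) (h : mu.length = m) :
    lrCoeff n lam mu.toFin = lrCoeff n lam fun j : Fin m => mu.1 j := by
  subst h
  rfl

theorem sum_card_toFin (mu : PartitionSeq) : ∑ j, (mu.toFin j).card = mu.sizes.degree := by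
  have h := eq_zero_of_exponentLength_le mu.sizes
  rw [← mu.length_eq] at h
  rw [← sum_restrictExponent h]
  rfl

/-- At a given exponent `D` only pairs with `mu.sizes = D` and `lam.card = D.degree` can contribute.
They form a finite set, parametrized by `g`, on which `sum_lrCoeff_sq_eq_coeff` gives the sum. -/
theorem hasSum_coeff_lrCoeff_sq {n : YoungDiagram → PartitionSeq → ℕ}
    (hn : ∀ lam mu, lam.colLen 0 ≤ n lam mu ∧ ∀ j, (mu.1 j).colLen 0 ≤ n lam mu)
    (D : ℕ →₀ ℕ) :
    HasSum (fun x : YoungDiagram × PartitionSeq => MvPowerSeries.coeff D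
      (MvPowerSeries.monomial x.2.sizes ((lrCoeff (n x.1 x.2) x.1 x.2.toFin : ℤ) ^ 2)))
      (MvPowerSeries.coeff D geomProduct) := by
  classical
  have hm := eq_zero_of_exponentLength_le D
  have hlen : ∀ mu : PartitionSeq, mu.sizes = D → mu.length = exponentLength D := by
    rintro mu rfl
    exact mu.length_eq
  let g : {lam : YoungDiagram // lam.card = D.degree} ×
      (∀ j : Fin (exponentLength D), {lam : YoungDiagram // lam.card = D j}) →
      YoungDiagram × PartitionSeq := fun x => (x.1.1, extendSeq fun j => (x.2 j).1)
  have hg : Function.Injective g := by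
    rintro ⟨lam, mu⟩ ⟨lam', mu'⟩ h
    refine Prod.ext (Subtype.ext (congrArg Prod.fst h)) (funext fun j => Subtype.ext ?_)
    have h1 : extendSeq (fun j => (mu j).1) = extendSeq fun j => (mu' j).1 := congrArg Prod.snd h
    rw [← extendSeq_apply (fun j => (mu j).1) j, h1, extendSeq_apply]
  rw [← hg.hasSum_iff]
  · rw [← sum_lrCoeff_sq_eq_coeff hm, ← Fintype.sum_prod_type']
    convert hasSum_fintype _ using 1
    refine Finset.sum_congr rfl fun x _ => ?_
    obtain ⟨⟨lam, hlam⟩, mu⟩ := x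
    have hs := sizes_extendSeq hm mu
    have hle : ∀ j, ((extendSeq fun j => (mu j).1).toFin j).colLen 0 ≤ D.degree := fun j =>
      (colLen_le_card _).trans ((DFunLike.congr_fun hs (j : ℕ)).le.trans (Finsupp.le_degree _ _))
    have hn' := hn lam (extendSeq fun j => (mu j).1)
    change _ = MvPowerSeries.coeff D (MvPowerSeries.monomial (extendSeq fun j => (mu j).1).sizes
      ((lrCoeff (n lam (extendSeq fun j => (mu j).1)) lam
        (extendSeq fun j => (mu j).1).toFin : ℤ) ^ 2))
    have hc : lrCoeff (n lam (extendSeq fun j => (mu j).1)) lam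
        (extendSeq fun j => (mu j).1).toFin = lrCoeff D.degree lam fun j => (mu j).1 := by
      -- The prescribed rank is exchanged for `D.degree`, which bounds all the lengths because a
      -- partition has at most as many parts as its size.
      refine (lrCoeff_eq (mu := (extendSeq fun j => (mu j).1).toFin) hn'.1 (fun j => hn'.2 j)
        ((colLen_le_card lam).trans hlam.le) hle).trans ?_
      rw [lrCoeff_toFin _ (hlen _ hs)]
      simp only [extendSeq_apply]
    rw [MvPowerSeries.coeff_monomial, if_pos hs.symm, hc]
  · rintro ⟨lam, mu⟩ hx
    rw [MvPowerSeries.coeff_monomial]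
    split_ifs with hD
    -- A pair with the right exponent outside the range of `g` has `lam` of the wrong size, so its
    -- multiplicity vanishes by degree.
    · have h0 : lrCoeff (n lam mu) lam mu.toFin = 0 := by
        refine lrCoeff_eq_zero (hn lam mu).1 (fun j => (hn lam mu).2 j) fun hcard => hx ?_
        rw [sum_card_toFin] at hcard
        subst hD
        refine ⟨(⟨lam, hcard⟩, fun j => ⟨mu.1 j, rfl⟩), Prod.ext rfl (Subtype.ext (funext fun j => ?_))⟩
        by_cases h : j < exponentLength mu.sizes
        · exact extendSeq_apply (fun j : Fin _ => mu.1 j) ⟨j, h⟩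
        · refine (dif_neg h).trans (mu.eq_bot_of_length_le ?_).symm
          rw [mu.length_eq]
          exact not_lt.mp h
      rw [h0]
      rfl
    · rfl

end Sequences

end LRSquares

end

theorem mainTheorem1
    (n : YoungDiagram → LRSquares.PartitionSeq → ℕ)
    (hn : ∀ (lam : YoungDiagram) (mu : LRSquares.PartitionSeq),
      lam.colLen 0 ≤ n lam mu ∧ ∀ j, (mu.1 j).colLen 0 ≤ n lam mu) :
    Multipliable (fun k : ℕ => LRSquares.geomFactor (k + 1)) ∧
      HasSum
        (fun x : YoungDiagram × LRSquares.PartitionSeq =>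
          MvPowerSeries.monomial x.2.sizes
            ((LRSquares.lrCoeff (n x.1 x.2) x.1 x.2.toFin : ℤ) ^ 2))
        (∏' k : ℕ, LRSquares.geomFactor (k + 1)) := by
  refine ⟨LRSquares.hasProd_geomFactor.multipliable, ?_⟩
  rw [LRSquares.hasProd_geomFactor.tprod_eq, MvPowerSeries.WithPiTopology.hasSum_iff_hasSum_coeff]
  exact LRSquares.hasSum_coeff_lrCoeff_sq hn
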